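/- **Conventions.** $\mathfrak{gl}_\infty$ is the Lie algebra of $\mathbb Z^\times\times\mathbb Z^\times$ complex matrices with finitely many non-zero entries ($\mathbb Z^\times=\mathbb Z\setminus\{0\}$), with simple roots $\alpha_{-i}=\epsilon_{-i-1}-\epsilon_{-i}$, $\alpha_0=\epsilon_{-1}-\epsilon_1$, $\alpha_i=\epsilon_i-\epsilon_{i+1}$ ($i\ge1$), simple coroots $h_i$ ($i\in\mathbb Z$), and weight lattice $P=\bigoplus_{k\in\mathbb Z^\times}\mathbb Z\epsilon_k\oplus\mathbb Z\Lambda_0$, where $\langle\Lambda_0,h_i\rangle=\delta_{i0}$. Its Weyl group $W$ is generated by the transpositions $s_i$ of the two indices occurring in $\alpha_i$, $i\in\mathbb Z$; $\ell$ is the length function, and $W^{\Lambda_0}=\{w\in W: \ell(ws_i)>\ell(w)\text{ for all }s_i\text{ fixing }\Lambda_0\}$. For $w\in W^{\Lambda_0}$, $\lambda(w)$ is the partition with parts $\lambda(w)_i=|\{j\in\mathbb Z^\times: -i<w^{-1}(j),\ j<w(-i)\}|$. Crystals are in Kashiwara's sense, with $\tilde f_i(b_1\otimes b_2)=\tilde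 f_ib_1\otimes b_2$ if $\varphi_i(b_1)>\varepsilon_i(b_2)$ and $b_1\otimes\tilde f_ib_2$ otherwise. $T_\mu=\{t_\mu\}$ is the one-element crystal of weight $\mu$ with $\varepsilon_i=\varphi_i=-\infty$. A subset of a crystal carries the restricted structure (operators leading out of the subset are set to $\mathbf 0$). * $\mathcal M$ is the set of $\mathbb N\times\mathbb N$ matrices $A=(a_{-i^\vee,j})_{i,j\ge1}$ of non-negative integers with finite support, and $\mathrm{wt}(A)=\sum a_{-i^\vee,j}(-\epsilon_{-i}+\epsilon_j)$. For $k<0$ (resp. $k>0$) the operators $\tilde e_k,\tilde f_k$ and the functions $\varepsilon_k,\varphi_k$ are those of the word of row letters (resp. column letters) of $A$. The row word has letters in $-1^\vee\xrightarrow{-1}-2^\vee\xrightarrow{-2}\cdots$, and is read with $(i,j)$ before $(k,l)$ iff $j<l$, or $j=l$ and the row of $(i,j)$ is lower. The column word has letters in $1\xrightarrow{1}2\xrightarrow{2}\cdots$, and is read by increasing row and, within a row, by decreasing column. Here a word is the tensor product of its letters. Finally $\tilde f_0$ (resp. $\tilde e_0$) adds (resp. subtracts, if possible) $1$ at $(-1^\vee,1)$,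 $\varepsilon_0(A)=a_{-1^\vee,1}$ and $\varphi_0(A)=\langle\mathrm{wt}(A),h_0\rangle+\varepsilon_0(A)$. * $\mathbf B(\Lambda_0)$ is the connected component of $H_{\Lambda_0}=\cdots{-3}\,{-2}\,{-1}$ in the crystal of semi-infinite strictly increasing words $\cdots w_{-2}w_{-1}$ in $\mathbb Z^\times$ with $w_i=i+c$ for $i\ll0$. $\mathbf B(n\Lambda_0)\subset\mathbf B(\Lambda_0)^{\otimes n}$ consists of the $w^{(1)}\otimes\cdots\otimes w^{(n)}$ with $w^{(i+1)}_k\le w^{(i)}_k$ for all $i,k$, and $H_{n\Lambda_0}=H_{\Lambda_0}^{\otimes n}$. * For a reduced expression $w=s_{i_1}\cdots s_{i_r}$ of $w\in W^{\Lambda_0}$, $$\mathcal M_w=\{\tilde f_{i_1}^{m_1}\cdots\tilde f_{i_r}^{m_r}\mathbb O\mid m_1,\dots,m_r\ge0\}\setminus\{\mathbf 0\},\qquad \mathbf B_w(n\Lambda_0)=\{\tilde f_{i_1}^{m_1}\cdots\tilde f_{i_r}^{m_r}H_{n\Lambda_0}\mid m_1,\dots,m_r\ge0\}\setminus\{\mathbf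 0\},$$ where $\mathbb O$ is the zero matrix. * $\mathcal P$ is the set of plane partitions $\pi=(\pi_{ij})_{i,j\ge1}$. A partition $\lambda$ is identified with the word in $\mathbf B(\Lambda_0)$ whose letter $w_{-i}$ is $\lambda_i-i$ if this is negative and $\lambda_i-i+1$ otherwise, so that $\tilde f_r$ adds a box of residue $r$ (column minus row). The crystal structure on $\mathcal P$ is obtained by identifying $\pi$ with $\lambda^{(1)}\otimes\cdots\otimes\lambda^{(N)}\otimes t_{-N\Lambda_0}\in\mathbf B(\Lambda_0)^{\otimes N}\otimes T_{-N\Lambda_0}$ for $N$ sufficiently large, where $\lambda^{(k)}=\{(i,j):\pi_{ij}\ge k\}$. Put $\mathcal P(\lambda)=\{\pi\in\mathcal P:\{(i,j):\pi_{ij}\ne0\}\subset\lambda\}$ and $\mathcal P(\lambda)_{\le n}=\{\pi\in\mathcal P(\lambda):\pi_{11}\le n\}$. **Proposition.** Let $\lambda$ be a partition, let $n\ge1$, and let $w\in W^{\Lambda_0}$ be such that $\lambda(w)=\lambda$. Then, for every reduced expression of $w$, the sets below are $\mathfrak{gl}_\infty$-crystals, and as $\mathfrak{gl}_\infty$-crystals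 1. $\mathcal P(\lambda)\simeq\mathcal M_w$; 2. $\mathcal P(\lambda)_{\le n}\simeq\mathbf B_w(n\Lambda_0)\otimes T_{-n\Lambda_0}$. -/

import Mathlib

noncomputable section

namespace GlInf

/-! ### Weights of `gl_∞` -/

/-- The set of non-zero integers, which indexes the rows and columns of `gl_∞`. -/
abbrev NZ := {k : ℤ // k ≠ 0}

/-- The simple root `α_i` (`i ∈ ℤ`) is `ε_a - ε_b` for consecutive non-zero integers `a < b`;
this is the smaller index `a`. -/
def lo (i : ℤ) : NZ := ⟨if i ≤ 0 then i - 1 else i, by split_ifs <;> omega⟩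

/-- The larger index `b` in `α_i = ε_a - ε_b`. -/
def hi (i : ℤ) : NZ := ⟨if i < 0 then i else i + 1, by split_ifs <;> omega⟩

/-- The weight lattice `P = (⨁_{k ≠ 0} ℤ ε_k) ⊕ ℤ Λ_0`. -/
abbrev Weight := (NZ →₀ ℤ) × ℤ

/-- The weight `ε_k`. -/
def epsW (k : NZ) : Weight := (Finsupp.single k 1, 0)

/-- The fundamental weight `Λ_0`. -/
def Lam0 : Weight := (0, 1)

/-- The simple root `α_i`. -/
def simpleRoot (i : ℤ) : Weight := epsW (lo i) - epsW (hi i)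

/-- The value `⟨μ, E_{kk}⟩`, where `⟨Λ_0, E_{kk}⟩` is `1/2` for `k < 0` and `-1/2` for `k > 0`. -/
def diagValue (μ : Weight) (k : NZ) : ℚ :=
  (μ.1 k : ℚ) + (μ.2 : ℚ) * (if (k : ℤ) < 0 then 1 / 2 else -(1 / 2))

/-- The pairing `⟨μ, h_i⟩` with the simple coroot `h_i`, as an integer. -/
def pairing (μ : Weight) (i : ℤ) : ℤ :=
  μ.1 (lo i) - μ.1 (hi i) + if i = 0 then μ.2 else 0

/-- The simple coroot is `h_i = E_{aa} - E_{bb}` when `α_i = ε_a - ε_b`. -/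
theorem pairing_eq (μ : Weight) (i : ℤ) :
    (pairing μ i : ℚ) = diagValue μ (lo i) - diagValue μ (hi i) := by
  rcases lt_trichotomy i 0 with h | h | h
  · have h1 : i ≠ 0 := by omega
    have h2 : i ≤ 0 := by omega
    have h3 : i - 1 < 0 := by omega
    simp [pairing, diagValue, lo, hi, h, h1, h2, h3]
  · subst h
    simp [pairing, diagValue, lo, hi]
    ring
  · have h1 : i ≠ 0 := by omega
    have h2 : ¬ i ≤ 0 := by omega
    have h3 : ¬ i < 0 := by omega
    have h4 : ¬ i + 1 < 0 := by omega
    simp [pairing, diagValue, lo, hi, h1, h2, h3, h4]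

/-- The simple reflection `s_i` on weights. -/
def reflect (i : ℤ) (μ : Weight) : Weight := μ - pairing μ i • simpleRoot i

/-! ### Crystals -/

/-- The data of a crystal on `B`; the formal symbol `0` is `none`, and `-∞` is `⊥`. -/
structure CrystalData (B : Type) where
  /-- the weight -/
  wt : B → Weight
  /-- the function `ε_i` -/
  eps : ℤ → B → WithBot ℤ
  /-- the function `φ_i` -/
  phi : ℤ → B → WithBot ℤ
  /-- the raising operator -/
  e : ℤ → B → Option B
  /-- the lowering operator -/
  f : ℤ → B → Option B

namespace CrystalData

/-- The axioms of a `gl_∞`-crystal. -/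
structure IsCrystal {B : Type} (C : CrystalData B) : Prop where
  phi_eq : ∀ i b, C.phi i b = (pairing (C.wt b) i : WithBot ℤ) + C.eps i b
  e_some : ∀ i b b', C.e i b = some b' →
    C.eps i b' = C.eps i b + ((-1 : ℤ) : WithBot ℤ) ∧
    C.phi i b' = C.phi i b + ((1 : ℤ) : WithBot ℤ) ∧
    C.wt b' = C.wt b + simpleRoot i
  f_some : ∀ i b b', C.f i b = some b' →
    C.eps i b' = C.eps i b + ((1 : ℤ) : WithBot ℤ) ∧
    C.phi i b' = C.phi i b + ((-1 : ℤ) : WithBot ℤ) ∧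
    C.wt b' = C.wt b - simpleRoot i
  f_iff_e : ∀ i b b', C.f i b = some b' ↔ C.e i b' = some b
  bot : ∀ i b, C.phi i b = ⊥ → C.e i b = none ∧ C.f i b = none

/-- Isomorphisms of crystals: bijections that preserve `wt`, `ε_i` and `φ_i` and commute with the
raising and lowering operators, `0` being sent to `0`. -/
structure Iso {B₁ B₂ : Type} (C₁ : CrystalData B₁) (C₂ : CrystalData B₂) extends B₁ ≃ B₂ where
  wt_eq : ∀ b, C₂.wt (toFun b) = C₁.wt b
  eps_eq : ∀ i b, C₂.eps i (toFun b) = C₁.eps i b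
  phi_eq : ∀ i b, C₂.phi i (toFun b) = C₁.phi i b
  e_eq : ∀ i b, C₂.e i (toFun b) = (C₁.e i b).map toFun
  f_eq : ∀ i b, C₂.f i (toFun b) = (C₁.f i b).map toFun

open Classical in
/-- The subcrystal on a subset `S`: the data are restricted, and an operator that leads out of `S`
is set to `0`. -/
def restrict {B : Type} (C : CrystalData B) (S : Set B) : CrystalData S where
  wt b := C.wt b
  eps i b := C.eps i b
  phi i b := C.phi i b
  e i b := (C.e i b).bind fun b' => if h : b' ∈ S then some ⟨b', h⟩ else none
  f i b := (C.f i b).bind fun b' => if h : b' ∈ S then some ⟨b', h⟩ else none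

/-- The dual crystal. -/
def dual {B : Type} (C : CrystalData B) : CrystalData B where
  wt b := -C.wt b
  eps := C.phi
  phi := C.eps
  e := C.f
  f := C.e

/-- The tensor product of two crystals. -/
def tensor {B₁ B₂ : Type} (C₁ : CrystalData B₁) (C₂ : CrystalData B₂) :
    CrystalData (B₁ × B₂) where
  wt p := C₁.wt p.1 + C₂.wt p.2
  eps i p := max (C₁.eps i p.1) (C₂.eps i p.2 + ((-pairing (C₁.wt p.1) i : ℤ) : WithBot ℤ))
  phi i p := max (C₁.phi i p.1 + ((pairing (C₂.wt p.2) i : ℤ) : WithBot ℤ)) (C₂.phi i p.2)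
  e i p :=
    if C₂.eps i p.2 ≤ C₁.phi i p.1 then (C₁.e i p.1).map fun b => (b, p.2)
    else (C₂.e i p.2).map fun b => (p.1, b)
  f i p :=
    if C₂.eps i p.2 < C₁.phi i p.1 then (C₁.f i p.1).map fun b => (b, p.2)
    else (C₂.f i p.2).map fun b => (p.1, b)

/-- The one-element crystal `T_μ = {t_μ}`. -/
def T (μ : Weight) : CrystalData Unit where
  wt _ := μ
  eps _ _ := ⊥
  phi _ _ := ⊥
  e _ _ := none
  f _ _ := none

/-- The weight of a word `w_1 ⊗ ⋯ ⊗ w_r`. -/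
def wordWt {B : Type} (C : CrystalData B) : List B → Weight
  | [] => 0
  | b :: w => C.wt b + wordWt C w

/-- `ε_i` of a word. -/
def wordEps {B : Type} (C : CrystalData B) (i : ℤ) : List B → WithBot ℤ
  | [] => 0
  | b :: w => max (C.eps i b) (wordEps C i w + ((-pairing (C.wt b) i : ℤ) : WithBot ℤ))

/-- `φ_i` of a word. -/
def wordPhi {B : Type} (C : CrystalData B) (i : ℤ) : List B → WithBot ℤ
  | [] => 0
  | b :: w => max (C.phi i b + ((pairing (wordWt C w) i : ℤ) : WithBot ℤ)) (wordPhi C i w)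

/-- The raising operator on words. -/
def wordE {B : Type} (C : CrystalData B) (i : ℤ) : List B → Option (List B)
  | [] => none
  | b :: w =>
    if wordEps C i w ≤ C.phi i b then (C.e i b).map fun b' => b' :: w
    else (wordE C i w).map fun w' => b :: w'

/-- The lowering operator on words. -/
def wordF {B : Type} (C : CrystalData B) (i : ℤ) : List B → Option (List B)
  | [] => none
  | b :: w =>
    if wordEps C i w < C.phi i b then (C.f i b).map fun b' => b' :: w
    else (wordF C i w).map fun w' => b :: w'

/-- The crystal of finite words `w_1 ⋯ w_r = w_1 ⊗ ⋯ ⊗ w_r`, the disjoint union of the tensor powers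
of `C`; the empty word has weight `0`, `ε_i = φ_i = 0`, and is killed by all operators. -/
def words {B : Type} (C : CrystalData B) : CrystalData (List B) where
  wt := wordWt C
  eps := wordEps C
  phi := wordPhi C
  e := wordE C
  f := wordF C

/-- A non-empty word is the tensor product of its first letter and the remaining word. -/
theorem words_cons {B : Type} (C : CrystalData B) (i : ℤ) (b : B) (w : List B) :
    C.words.wt (b :: w) = (C.tensor C.words).wt (b, w) ∧
    C.words.eps i (b :: w) = (C.tensor C.words).eps i (b, w) ∧
    C.words.phi i (b :: w) = (C.tensor C.words).phi i (b, w) ∧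
    C.words.e i (b :: w) = ((C.tensor C.words).e i (b, w)).map (fun p => p.1 :: p.2) ∧
    C.words.f i (b :: w) = ((C.tensor C.words).f i (b, w)).map (fun p => p.1 :: p.2) := by
  refine ⟨rfl, rfl, rfl, ?_, ?_⟩
  · change (if wordEps C i w ≤ C.phi i b then (C.e i b).map fun b' => b' :: w
      else (wordE C i w).map fun w' => b :: w') =
      Option.map (fun p => p.1 :: p.2)
        (if wordEps C i w ≤ C.phi i b then (C.e i b).map fun b' => (b', w)
          else (wordE C i w).map fun w' => (b, w'))
    split_ifs <;> simp [Function.comp_def]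
  · change (if wordEps C i w < C.phi i b then (C.f i b).map fun b' => b' :: w
      else (wordF C i w).map fun w' => b :: w') =
      Option.map (fun p => p.1 :: p.2)
        (if wordEps C i w < C.phi i b then (C.f i b).map fun b' => (b', w)
          else (wordF C i w).map fun w' => (b, w'))
    split_ifs <;> simp [Function.comp_def]

/-- `f_i^m b`. -/
def fPow {B : Type} (C : CrystalData B) (i : ℤ) : ℕ → B → Option B
  | 0, b => some b
  | m + 1, b => (fPow C i m b).bind (C.f i)

/-- For a word `i_1, …, i_r`, the set `{f_{i_1}^{m_1} ⋯ f_{i_r}^{m_r} h | m_1, …, m_r ≥ 0} ∖ {0}`. -/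
def demazure {B : Type} (C : CrystalData B) (h : B) : List ℤ → Set B
  | [] => {h}
  | i :: l => {b | ∃ b' ∈ demazure C h l, ∃ m : ℕ, C.fPow i m b' = some b}

/-- The connected component of `b` in the crystal graph. -/
def component {B : Type} (C : CrystalData B) (b : B) : Set B :=
  {b' | Relation.EqvGen (fun x y => ∃ i, C.f i x = some y) b b'}

end CrystalData

/-- The crystal `𝐁` of the natural representation:
`⋯ → -2 → -1 → 1 → 2 → ⋯`, with `wt k = ε_k`. -/
def natural : CrystalData NZ where
  wt := epsW
  eps i k := if k = hi i then 1 else 0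
  phi i k := if k = lo i then 1 else 0
  e i k := if k = hi i then some (lo i) else none
  f i k := if k = lo i then some (hi i) else none

/-! ### The Weyl group -/

/-- The simple reflection `s_i`, as a permutation of the non-zero integers. -/
def simpleRefl (i : ℤ) : Equiv.Perm NZ := Equiv.swap (lo i) (hi i)

/-- The Weyl group of `gl_∞`, acting on the non-zero integers. -/
def weylGroup : Subgroup (Equiv.Perm NZ) := Subgroup.closure (Set.range simpleRefl)

/-- The length of an element of the Weyl group. -/
def length (w : Equiv.Perm NZ) : ℕ :=
  sInf {r | ∃ l : List ℤ, l.length = r ∧ (l.map simpleRefl).prod = w}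

/-- `w = s_{i_1} ⋯ s_{i_r}` is a reduced expression. -/
def IsReducedExpr (w : Equiv.Perm NZ) (l : List ℤ) : Prop :=
  (l.map simpleRefl).prod = w ∧ l.length = length w

/-- The set `W^Λ` of those `w` in the Weyl group with `ℓ(w s_i) > ℓ(w)` for all `s_i` that
stabilize `Λ`. -/
def minimalReps (Λ : Weight) : Set (Equiv.Perm NZ) :=
  {w | w ∈ weylGroup ∧ ∀ i : ℤ, reflect i Λ = Λ → length w < length (w * simpleRefl i)}

/-- The negative integer `-(p + 1)`. -/
def neg (p : ℕ) : NZ := ⟨-((p : ℤ) + 1), by omega⟩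

/-- The positive integer `q + 1`. -/
def pos (q : ℕ) : NZ := ⟨(q : ℤ) + 1, by omega⟩

/-- The diagram `D(w)` of a permutation. -/
def permDiagram (w : Equiv.Perm NZ) : Set (NZ × NZ) :=
  {p | p.1 < w⁻¹ p.2 ∧ p.2 < w p.1}

/-- The shape `λ(w)`: part number `p` (counted from `0`) is the number of `j` with
`(-(p+1), j) ∈ D(w)`. -/
def permShape (w : Equiv.Perm NZ) (p : ℕ) : ℕ :=
  Set.ncard {j : NZ | (neg p, j) ∈ permDiagram w}

/-! ### The crystal of integral matrices -/

/-- Matrices with non-negative integral entries and finite support.  The entry at `(p, q)`, counted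
from `0`, is the entry `a_{-i^∨, j}` with `i = p + 1`, `j = q + 1`. -/
abbrev Mat := ℕ × ℕ →₀ ℕ

/-- The biword of `A` in which `(i, j)` precedes `(k, l)` iff `j < l`, or `j = l` and `i > k`.
A letter is the pair (column, row), positions counted from `0`. -/
def biwordByCol (A : Mat) : List (ℕ ×ₗ ℕᵒᵈ) :=
  ((Finsupp.toMultiset A).map fun c => toLex (c.2, OrderDual.toDual c.1)).sort

/-- The biword of `A` in which `(i, j)` precedes `(k, l)` iff `i < k`, or `i = k` and `j > l`.
A letter is the pair (row, column), positions counted from `0`. -/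
def biwordByRow (A : Mat) : List (ℕ ×ₗ ℕᵒᵈ) :=
  ((Finsupp.toMultiset A).map fun c => toLex (c.1, OrderDual.toDual c.2)).sort

/-- The matrix that counts the pairs (row, column) in a list. -/
def matOfList (l : List (ℕ × ℕ)) : Mat := Multiset.toFinsupp (l : Multiset (ℕ × ℕ))

/-- The position, counted from `0`, of the letter `±(p + 1)`. -/
def idx (k : NZ) : ℕ := (k : ℤ).natAbs - 1

/-- The word of rows of `biwordByCol A`; the letter `-(p+1)` stands for `-(p+1)^∨`. -/
def rowWord (A : Mat) : List NZ :=
  (biwordByCol A).map fun c => neg (OrderDual.ofDual (ofLex c).2)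

/-- The word of columns of `biwordByRow A`. -/
def colWord (A : Mat) : List NZ :=
  (biwordByRow A).map fun c => pos (OrderDual.ofDual (ofLex c).2)

/-- Replace the word of rows in `biwordByCol A`. -/
def replaceRows (A : Mat) (r : List NZ) : Mat :=
  matOfList (List.zip (r.map idx) ((biwordByCol A).map fun c => (ofLex c).1))

/-- Replace the word of columns in `biwordByRow A`. -/
def replaceCols (A : Mat) (l : List NZ) : Mat :=
  matOfList (List.zip ((biwordByRow A).map fun c => (ofLex c).1) (l.map idx))

/-- `wt A = ∑ a_{-i^∨, j} (-ε_{-i} + ε_j)`. -/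
def matWt (A : Mat) : Weight :=
  A.sum fun c a => (a : ℤ) • (epsW (pos c.2) - epsW (neg c.1))

/-- The `gl_∞`-crystal of matrices.  The operators with `i < 0` act on the word of rows, with letters
in the dual of `𝐁`, those with `i > 0` on the word of columns, with letters in `𝐁`, and those with
`i = 0` on the entry in the first row and first column. -/
def matCrystal : CrystalData Mat where
  wt := matWt
  eps i A :=
    if i < 0 then natural.dual.words.eps i (rowWord A)
    else if i = 0 then ((A (0, 0) : ℤ) : WithBot ℤ)
    else natural.words.eps i (colWord A)
  phi i A :=
    if i < 0 then natural.dual.words.phi i (rowWord A)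
    else if i = 0 then ((pairing (matWt A) 0 + (A (0, 0) : ℤ) : ℤ) : WithBot ℤ)
    else natural.words.phi i (colWord A)
  e i A :=
    if i < 0 then (natural.dual.words.e i (rowWord A)).map (replaceRows A)
    else if i = 0 then
      if A (0, 0) ≠ 0 then some (A - Finsupp.single (0, 0) 1) else none
    else (natural.words.e i (colWord A)).map (replaceCols A)
  f i A :=
    if i < 0 then (natural.dual.words.f i (rowWord A)).map (replaceRows A)
    else if i = 0 then some (A + Finsupp.single (0, 0) 1)
    else (natural.words.f i (colWord A)).map (replaceCols A)

/-! ### Semi-infinite words and the crystal of highest weight `nΛ_0` -/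

/-- Semi-infinite words `⋯ w_{-3} w_{-2} w_{-1}`: strictly increasing, with `w_i = i + c` for
`i ≪ 0`.  The letter `w_{-(k+1)}` is `toFun k`. -/
@[ext] structure SemiInf where
  toFun : ℕ → NZ
  anti : StrictAnti toFun
  tail : ∃ c : ℤ, ∃ N : ℕ, ∀ k ≥ N, (toFun k : ℤ) = -((k : ℤ) + 1) + c

namespace SemiInf

/-- The letter `k` occurs in `w`. -/
def Occurs (w : SemiInf) (k : NZ) : Prop := ∃ j, w.toFun j = k

/-- `m_k`: the multiplicity of the letter `k` in `w`, minus `1` if `k < 0`. -/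
def mult (w : SemiInf) (k : NZ) : ℤ :=
  (Set.ncard {j | w.toFun j = k} : ℤ) - if (k : ℤ) < 0 then 1 else 0

theorem mult_finite (w : SemiInf) : (Function.support w.mult).Finite := by
  obtain ⟨c, N, hN⟩ := w.tail
  have hfin : {x : ℤ | min (-((N : ℤ) + 1) + c) (-1) ≤ x ∧ x ≤ max (w.toFun 0 : ℤ) 0}.Finite :=
    Set.finite_Icc _ _
  refine (hfin.preimage (f := fun k : NZ => (k : ℤ)) Subtype.val_injective.injOn).subset ?_
  intro k hk
  by_contra hcon
  apply hk
  simp only [Set.mem_preimage, Set.mem_ofPred_eq, not_and_or, not_le] at hcon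
  rcases hcon with h | h
  · have h1 : (k : ℤ) < -((N : ℤ) + 1) + c := lt_of_lt_of_le h (min_le_left _ _)
    have h2 : (k : ℤ) < 0 := by have := lt_of_lt_of_le h (min_le_right _ _); omega
    have hset : {j | w.toFun j = k} = {(-(k : ℤ) - 1 + c).toNat} := by
      have hj : w.toFun (-(k : ℤ) - 1 + c).toNat = k := by
        apply Subtype.ext
        rw [hN _ (by omega)]
        omega
      ext j
      simp only [Set.mem_ofPred_eq, Set.mem_singleton_iff]
      exact ⟨fun h => w.anti.injective (h.trans hj.symm), fun h => h ▸ hj⟩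
    simp [mult, hset, h2]
  · have h1 : (w.toFun 0 : ℤ) < k := lt_of_le_of_lt (le_max_left _ _) h
    have h2 : ¬ (k : ℤ) < 0 := by have := lt_of_le_of_lt (le_max_right _ _) h; omega
    have hset : {j | w.toFun j = k} = ∅ := by
      ext j
      simp only [Set.mem_ofPred_eq, Set.mem_empty_iff_false, iff_false]
      intro hj
      have : w.toFun j ≤ w.toFun 0 := w.anti.antitone (Nat.zero_le j)
      rw [hj] at this
      exact absurd (Subtype.coe_le_coe.mpr this) (not_le.mpr h1)
    simp [mult, hset, h2]

/-- Replace the letter `a` by the neighbouring letter `b`, which does not occur. -/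
def replace (w : SemiInf) (a b : NZ) (hab : ∀ k : NZ, k ≠ a → k ≠ b → (k < a ↔ k < b))
    (hb : ¬ w.Occurs b) : SemiInf where
  toFun j := if w.toFun j = a then b else w.toFun j
  anti := by
    intro i j hij
    have h := w.anti hij
    have hi : w.toFun i ≠ b := fun h => hb ⟨i, h⟩
    have hj : w.toFun j ≠ b := fun h => hb ⟨j, h⟩
    dsimp only
    split_ifs with h1 h2 h2
    · rw [h1, h2] at h; exact absurd h (lt_irrefl _)
    · rw [h1] at h
      have := (hab _ h2 hi).not
      exact lt_of_le_of_ne (not_lt.mp (this.mp (not_lt.mpr h.le))) hi.symm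
    · rw [h2] at h
      exact (hab _ h1 hj).mp h
    · exact h
  tail := by
    obtain ⟨c, N, hN⟩ := w.tail
    refine ⟨c, max N (c - (a : ℤ)).toNat, fun k hk => ?_⟩
    have h1 := hN k (le_trans (le_max_left _ _) hk)
    have h2 := le_trans (le_max_right _ _) hk
    have h3 : w.toFun k ≠ a := by
      intro h
      rw [h] at h1
      omega
    rw [if_neg h3, h1]

/-- The word `H_{Λ_0} = ⋯ -3 -2 -1`. -/
def H : SemiInf where
  toFun := neg
  anti := by
    intro i j hij
    rw [← Subtype.coe_lt_coe]
    simp only [neg]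
    omega
  tail := ⟨0, 0, fun k _ => by simp [neg]⟩

end SemiInf

theorem lo_hi_adjacent (i : ℤ) (k : NZ) (h1 : k ≠ lo i) (h2 : k ≠ hi i) :
    k < lo i ↔ k < hi i := by
  obtain ⟨k, hk⟩ := k
  have h1' : k ≠ (lo i : ℤ) := fun h => h1 (Subtype.ext h)
  have h2' : k ≠ (hi i : ℤ) := fun h => h2 (Subtype.ext h)
  rw [← Subtype.coe_lt_coe, ← Subtype.coe_lt_coe]
  simp only [lo, hi] at *
  split_ifs at * <;> omega

open Classical in
/-- The crystal `ℱ` of semi-infinite words.  As a word is strictly increasing, the tensor product rule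
says: `f_i` replaces the letter `lo i` by `hi i` if `lo i` occurs and `hi i` does not, and is `0`
otherwise; `e_i` is the reverse. -/
def fock : CrystalData SemiInf where
  wt w := (Finsupp.ofSupportFinite w.mult w.mult_finite, 1)
  eps i w := if w.Occurs (hi i) ∧ ¬ w.Occurs (lo i) then 1 else 0
  phi i w := if w.Occurs (lo i) ∧ ¬ w.Occurs (hi i) then 1 else 0
  e i w :=
    if h : w.Occurs (hi i) ∧ ¬ w.Occurs (lo i) then
      some (w.replace (hi i) (lo i) (fun k h1 h2 => (lo_hi_adjacent i k h2 h1).symm) h.2)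
    else none
  f i w :=
    if h : w.Occurs (lo i) ∧ ¬ w.Occurs (hi i) then
      some (w.replace (lo i) (hi i) (lo_hi_adjacent i) h.2)
    else none

/-- `𝐁(Λ_0)`, the connected component of `H_{Λ_0}`. -/
def BLam0 : Set SemiInf := fock.component SemiInf.H

/-- `𝐁(nΛ_0)`: the semi-infinite semistandard tableaux `(w^{(1)}, …, w^{(n)})` with all `w^{(i)}` in
`𝐁(Λ_0)` and `w^{(i+1)}_k ≤ w^{(i)}_k`. -/
def BnLam0 (n : ℕ) : Set (List SemiInf) :=
  {v | v.length = n ∧ (∀ w ∈ v, w ∈ BLam0) ∧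
    v.IsChain fun w w' => ∀ k, w'.toFun k ≤ w.toFun k}

/-- The crystal on `𝐁(nΛ_0)`, in which `(w^{(1)}, …, w^{(n)})` is `w^{(1)} ⊗ ⋯ ⊗ w^{(n)}`. -/
def BnLam0Crystal (n : ℕ) : CrystalData (BnLam0 n) := fock.words.restrict (BnLam0 n)

/-- The highest weight element `H_{nΛ_0}`. -/
def Hn (n : ℕ) : BnLam0 n :=
  ⟨List.replicate n SemiInf.H, by simp, by
    intro w hw
    rw [List.eq_of_mem_replicate hw]
    exact Relation.EqvGen.refl _, by
    refine List.isChain_replicate_of_rel n ?_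
    intro k; exact le_rfl⟩

/-! ### Plane partitions -/

/-- Plane partitions, with positions counted from `0`. -/
@[ext] structure PlanePartition where
  entry : ℕ × ℕ →₀ ℕ
  row : ∀ i j, entry (i, j + 1) ≤ entry (i, j)
  col : ∀ i j, entry (i + 1, j) ≤ entry (i, j)

namespace PlanePartition

theorem antitone (π : PlanePartition) : Antitone π.entry := by
  rintro ⟨i, j⟩ ⟨i', j'⟩ ⟨hi, hj⟩
  have h1 : Antitone fun a => π.entry (a, j) := antitone_nat_of_succ_le fun a => π.col a j
  have h2 : Antitone fun b => π.entry (i', b) := antitone_nat_of_succ_le fun b => π.row i' b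
  exact (h2 hj).trans (h1 hi)

/-- The layer `λ^{(k+1)}`, the set of boxes whose entry is at least `k + 1`. -/
def layer (π : PlanePartition) (k : ℕ) : YoungDiagram where
  cells := π.entry.support.filter fun c => k < π.entry c
  isLowerSet := by
    intro a b hba ha
    simp only [Finset.coe_filter, Finsupp.mem_support_iff, Set.mem_ofPred_eq] at ha ⊢
    have := π.antitone hba
    omega

/-- The shape of a plane partition, which is its support. -/
def shape (π : PlanePartition) : YoungDiagram where
  cells := π.entry.support
  isLowerSet := by
    intro a b hba ha
    simp only [Finset.mem_coe, Finsupp.mem_support_iff] at ha ⊢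
    have := π.antitone hba
    omega

/-- The plane partitions whose shape is contained in `lam`. -/
def inside (lam : YoungDiagram) : Set PlanePartition := {π | π.shape ≤ lam}

/-- The plane partitions whose shape is contained in `lam` and whose entries are at most `n`. -/
def insideLE (lam : YoungDiagram) (n : ℕ) : Set PlanePartition :=
  {π | π.shape ≤ lam ∧ π.entry (0, 0) ≤ n}

end PlanePartition

/-- The bijection from `ℤ` to the non-zero integers that is the identity on the negative integers
and `m ↦ m + 1` on the others. -/
def skipZero (m : ℤ) : NZ := ⟨if m < 0 then m else m + 1, by split_ifs <;> omega⟩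

/-- The element of `𝐁(Λ_0)` that corresponds to a partition: `w_{-i}` is obtained from
`λ_i - i` by skipping `0`.  The empty partition corresponds to `H_{Λ_0}`, and applying `f_r` means
adding a box of residue `r`. -/
def ofPartition (μ : YoungDiagram) : SemiInf where
  toFun k := skipZero ((μ.rowLen k : ℤ) - ((k : ℤ) + 1))
  anti := by
    intro i j hij
    have := μ.rowLen_anti i j hij.le
    rw [← Subtype.coe_lt_coe]
    simp only [skipZero]
    split_ifs <;> omega
  tail := by
    refine ⟨0, μ.colLen 0, fun k hk => ?_⟩
    have h : μ.rowLen k = 0 := by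
      by_contra h
      have h1 : (k, 0) ∈ μ := YoungDiagram.mem_iff_lt_rowLen.mpr (Nat.pos_of_ne_zero h)
      have h2 := YoungDiagram.mem_iff_lt_colLen.mp h1
      omega
    simp only [skipZero, h]
    split_ifs <;> omega

/-- The first `n` layers of `π`, as an element of `𝐁(Λ_0)^{⊗ n} ⊗ T_{-nΛ_0}`. -/
def ofLayers (n : ℕ) (π : PlanePartition) : List SemiInf × Unit :=
  ((List.range n).map fun k => ofPartition (π.layer k), ())

/-- The crystal that contains `𝐁(Λ_0)^{⊗ n} ⊗ T_{-nΛ_0}`. -/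
def layerCrystal (n : ℕ) : CrystalData (List SemiInf × Unit) :=
  fock.words.tensor (CrystalData.T (-((n : ℤ) • Lam0)))

/-- A number of factors that is large enough for `π`: one more than its number of layers, so that
every `e_i π` and `f_i π` still has at most that many layers.  (Further empty layers change
nothing.) -/
def enough (π : PlanePartition) : ℕ := π.entry (0, 0) + 1

open Classical in
/-- The crystal of plane partitions, obtained by identifying `π` with its layers
`λ^{(1)} ⊗ ⋯ ⊗ λ^{(n)} ⊗ t_{-nΛ_0}` in `𝐁(Λ_0)^{⊗ n} ⊗ T_{-nΛ_0}`. -/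
def planeCrystal : CrystalData PlanePartition where
  wt π := (layerCrystal (enough π)).wt (ofLayers (enough π) π)
  eps i π := (layerCrystal (enough π)).eps i (ofLayers (enough π) π)
  phi i π := (layerCrystal (enough π)).phi i (ofLayers (enough π) π)
  e i π :=
    if h : ∃ π' : PlanePartition, π'.entry (0, 0) ≤ enough π ∧
      (layerCrystal (enough π)).e i (ofLayers (enough π) π) = some (ofLayers (enough π) π')
    then some h.choose else none
  f i π :=
    if h : ∃ π' : PlanePartition, π'.entry (0, 0) ≤ enough π ∧
      (layerCrystal (enough π)).f i (ofLayers (enough π) π) = some (ofLayers (enough π) π')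
    then some h.choose else none

end GlInf

end

noncomputable section

namespace GlInf

/-! All operators are controlled by signatures: a word in the signs + (for φ) and - (for ε), where a
+ cancels with a - to its right, and f acts on the leftmost surviving +. The proof translates the
signature of a plane partition into the signature of a matrix.

A plane partition is the family of its diagonals, and neighbouring diagonals interlace. The
signature of residue k of its layers depends only on the diagonals k-1, k, k+1. After cancellation
it has one block of - and + for each entry of diagonal k (`DiagonalWord`). Hence f_k adds 1 to one
explicit entry of that diagonal; this is the relation `Arrow`.

The diagonals of residue ≥ 0 and ≤ 0 form the first row and the first column of a growth diagram. A
local rule of RSK type (`inner`) computes the fourth corner of each square and records a number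
(`label`); the recorded numbers form the matrix `toMat π`. Take three consecutive sequences in
columns k, k+1, k+2 of row i of the diagram. By `stripEps_row` their signature has the same ε as the
block with A(i,k+1) signs - and A(i,k) signs +, followed by the signature of the same columns in row
i+1. By `acts_some_row` the operator either moves one unit inside that block and then disturbs
nothing below, or leaves the block alone and acts on the next row. Iterating over the rows gives
exactly the signature rule on the column word, so f_i commutes with `toMat` for i > 0. The local
rule is symmetric, so transposition gives i < 0. For i = 0, the carries of the corner square satisfy
the same recursion as the signature of the main diagonal, so f_0 adds 1 to the corner entry of the
matrix.

Bijectivity of `toMat` follows from the crystal graphs. Every non-empty plane partition and every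
non-zero matrix is the end of an arrow, and arrows increase `matDegree` by 1. Induction along arrows
then gives injectivity and surjectivity, and the result is `planeIso`.

For the Demazure subsets, a reduced expression of a minimal coset representative, read from the
right, builds λ(w) by adding one box of residue i for each letter i (`boxChain_of_isReducedExpr`).
If μ is μ' with a box of residue i added, then f_i preserves the plane partitions of shape inside μ.
Conversely, applying e_i to one of them until ε_i = 0 ends at a shape inside μ'. This argument
(`demazure_eq`) only needs a set of plane partitions closed under the e_i. It therefore applies to
all matrices through `planeIso`, and to 𝐁(nΛ_0), which is the set of plane partitions with at most n
layers.

The crystal axioms are checked on plane partitions and carried over by restriction and isomorphism.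
-/

theorem pairing_add (μ ν : Weight) (i : ℤ) : pairing (μ + ν) i = pairing μ i + pairing ν i := by
  simp only [pairing, Prod.fst_add, Finsupp.add_apply, Prod.snd_add]
  split_ifs <;> ring

theorem pairing_neg (μ : Weight) (i : ℤ) : pairing (-μ) i = -pairing μ i := by
  simp only [pairing, Prod.fst_neg, Finsupp.neg_apply, Prod.snd_neg]
  split_ifs <;> ring

theorem pairing_zero (i : ℤ) : pairing 0 i = 0 := by
  simp [pairing]

theorem pairing_sub (μ ν : Weight) (i : ℤ) : pairing (μ - ν) i = pairing μ i - pairing ν i := by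
  rw [sub_eq_add_neg, pairing_add, pairing_neg, sub_eq_add_neg]

theorem pairing_smul (c : ℤ) (μ : Weight) (i : ℤ) : pairing (c • μ) i = c * pairing μ i := by
  simp only [pairing, Prod.smul_fst, Finsupp.smul_apply, Prod.smul_snd, smul_eq_mul]
  split_ifs <;> ring

theorem lo_ne_hi (i : ℤ) : lo i ≠ hi i := by
  intro h
  have := congrArg Subtype.val h
  simp only [lo, hi] at this
  split_ifs at this <;> omega

/-! ### Signature rule for words over a seminormal crystal. -/

namespace CrystalData

variable {B : Type}

/-- At the index `i` the crystal `C` is seminormal: `ε_i` and `φ_i` are the natural numbers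
`ε` and `φ`, and the operators `e_i`, `f_i` vanish exactly where these vanish. -/
structure Seminormal (C : CrystalData B) (i : ℤ) (ε φ : B → ℕ) : Prop where
  eps_eq : ∀ b, C.eps i b = ((ε b : ℤ) : WithBot ℤ)
  phi_eq : ∀ b, C.phi i b = ((φ b : ℤ) : WithBot ℤ)
  pair : ∀ b, pairing (C.wt b) i = φ b - ε b
  f_some : ∀ b b', C.f i b = some b' →
    ε b' = ε b + 1 ∧ φ b = φ b' + 1 ∧ C.wt b' = C.wt b - simpleRoot i
  f_iff_e : ∀ b b', C.f i b = some b' ↔ C.e i b' = some b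
  e_none : ∀ b, C.e i b = none ↔ ε b = 0
  f_none : ∀ b, C.f i b = none ↔ φ b = 0

/-- `ε` of a word whose letters have the given `ε` and `φ`. -/
def natEps (ε φ : B → ℕ) : List B → ℕ
  | [] => 0
  | b :: w => ε b + (natEps ε φ w - φ b)

/-- `φ` of a word whose letters have the given `ε` and `φ`. -/
def natPhi (ε φ : B → ℕ) : List B → ℕ
  | [] => 0
  | b :: w => natPhi ε φ w + (φ b - natEps ε φ w)

theorem coe_max_int (a b : ℤ) : max (a : WithBot ℤ) (b : WithBot ℤ) = ((max a b : ℤ) : WithBot ℤ) :=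
  (WithBot.coe_max a b).symm

variable {C : CrystalData B} {i : ℤ} {ε φ : B → ℕ}

theorem Seminormal.word_values (h : C.Seminormal i ε φ) (w : List B) :
    wordEps C i w = ((natEps ε φ w : ℤ) : WithBot ℤ) ∧
    wordPhi C i w = ((natPhi ε φ w : ℤ) : WithBot ℤ) ∧
    pairing (wordWt C w) i = natPhi ε φ w - natEps ε φ w := by
  induction w with
  | nil => exact ⟨rfl, rfl, by simp [wordWt, natPhi, natEps, pairing_zero]⟩
  | cons b w ih =>
    obtain ⟨h1, h2, h3⟩ := ih
    refine ⟨?_, ?_, ?_⟩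
    · rw [wordEps, h1, h.eps_eq, h.pair, ← WithBot.coe_add, coe_max_int, natEps]
      congr 1; omega
    · rw [wordPhi, h2, h3, h.phi_eq, ← WithBot.coe_add, coe_max_int, natPhi]
      congr 1; omega
    · rw [wordWt, pairing_add, h3, h.pair, natEps, natPhi]
      omega

theorem Seminormal.wordF_cons (h : C.Seminormal i ε φ) (b : B) (w : List B) :
    wordF C i (b :: w) = if natEps ε φ w < φ b then (C.f i b).map fun b' => b' :: w
      else (wordF C i w).map fun w' => b :: w' := by
  rw [wordF, (h.word_values w).1, h.phi_eq]
  simp only [WithBot.coe_lt_coe, Nat.cast_lt]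

theorem Seminormal.wordE_cons (h : C.Seminormal i ε φ) (b : B) (w : List B) :
    wordE C i (b :: w) = if natEps ε φ w ≤ φ b then (C.e i b).map fun b' => b' :: w
      else (wordE C i w).map fun w' => b :: w' := by
  rw [wordE, (h.word_values w).1, h.phi_eq]
  simp only [WithBot.coe_le_coe, Nat.cast_le]

theorem Seminormal.word_none (h : C.Seminormal i ε φ) (w : List B) :
    (wordE C i w = none ↔ natEps ε φ w = 0) ∧ (wordF C i w = none ↔ natPhi ε φ w = 0) := by
  induction w with
  | nil => simp [wordE, wordF, natEps, natPhi]
  | cons b w ih =>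
    rw [h.wordE_cons, h.wordF_cons, natEps, natPhi]
    constructor
    · split_ifs with h1
      · rw [Option.map_eq_none_iff, h.e_none]; omega
      · rw [Option.map_eq_none_iff, ih.1]; omega
    · split_ifs with h1
      · rw [Option.map_eq_none_iff, h.f_none]; omega
      · rw [Option.map_eq_none_iff, ih.2]; omega

theorem Seminormal.wordF_some (h : C.Seminormal i ε φ) (w w' : List B)
    (hw : wordF C i w = some w') :
    natEps ε φ w' = natEps ε φ w + 1 ∧ natPhi ε φ w = natPhi ε φ w' + 1 ∧
      wordWt C w' = wordWt C w - simpleRoot i := by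
  induction w generalizing w' with
  | nil => simp [wordF] at hw
  | cons b w ih =>
    rw [h.wordF_cons] at hw
    split_ifs at hw with h1
    · obtain ⟨b', hb, rfl⟩ := Option.map_eq_some_iff.mp hw
      obtain ⟨h2, h3, h4⟩ := h.f_some b b' hb
      simp only [natEps, natPhi, wordWt, h4]
      refine ⟨by omega, by omega, by abel⟩
    · obtain ⟨v, hv, rfl⟩ := Option.map_eq_some_iff.mp hw
      obtain ⟨h2, h3, h4⟩ := ih v hv
      simp only [natEps, natPhi, wordWt, h4]
      refine ⟨by omega, by omega, by abel⟩

theorem Seminormal.wordF_iff_wordE (h : C.Seminormal i ε φ) (w w' : List B) :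
    wordF C i w = some w' ↔ wordE C i w' = some w := by
  constructor
  · intro hw
    induction w generalizing w' with
    | nil => simp [wordF] at hw
    | cons b w ih =>
      rw [h.wordF_cons] at hw
      split_ifs at hw with h1
      · obtain ⟨b', hb, rfl⟩ := Option.map_eq_some_iff.mp hw
        obtain ⟨h2, h3, -⟩ := h.f_some b b' hb
        rw [h.wordE_cons, if_pos (by omega), (h.f_iff_e b b').mp hb]; rfl
      · obtain ⟨v, hv, rfl⟩ := Option.map_eq_some_iff.mp hw
        obtain ⟨h2, -, -⟩ := h.wordF_some w v hv
        rw [h.wordE_cons, if_neg (by omega), ih v hv]; rfl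
  · intro hw
    induction w' generalizing w with
    | nil => simp [wordE] at hw
    | cons b w' ih =>
      rw [h.wordE_cons] at hw
      split_ifs at hw with h1
      · obtain ⟨b', hb, rfl⟩ := Option.map_eq_some_iff.mp hw
        have hf := (h.f_iff_e b' b).mpr hb
        obtain ⟨h2, h3, -⟩ := h.f_some b' b hf
        rw [h.wordF_cons, if_pos (by omega), hf]; rfl
      · obtain ⟨v, hv, rfl⟩ := Option.map_eq_some_iff.mp hw
        have hf := ih v hv
        obtain ⟨h2, -, -⟩ := h.wordF_some v w' hf
        rw [h.wordF_cons, if_neg (by omega), hf]; rfl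

/-- Words over a seminormal crystal are seminormal. -/
theorem Seminormal.words (h : C.Seminormal i ε φ) :
    C.words.Seminormal i (natEps ε φ) (natPhi ε φ) where
  eps_eq w := (h.word_values w).1
  phi_eq w := (h.word_values w).2.1
  pair w := (h.word_values w).2.2
  f_some := h.wordF_some
  f_iff_e := h.wordF_iff_wordE
  e_none w := (h.word_none w).1
  f_none w := (h.word_none w).2

/-- Cancellation of signs is associative: the surviving + of `u` meet the surviving - of `v`. The
truncated subtractions count what is left on either side. -/
theorem natEps_natPhi_append (u v : List B) :
    natEps ε φ (u ++ v) = natEps ε φ u + (natEps ε φ v - natPhi ε φ u) ∧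
    natPhi ε φ (u ++ v) = natPhi ε φ v + (natPhi ε φ u - natEps ε φ v) := by
  induction u with
  | nil => simp [natEps, natPhi]
  | cons b u ih =>
    simp only [List.cons_append, natEps, natPhi]
    omega

/-- Associativity of the tensor product rule: the recursive definition splits off one letter, and
this form lets words be split into arbitrary blocks. -/
theorem Seminormal.wordF_append (h : C.Seminormal i ε φ) (u v : List B) :
    wordF C i (u ++ v) = if natEps ε φ v < natPhi ε φ u then (wordF C i u).map (· ++ v)
      else (wordF C i v).map (u ++ ·) := by
  induction u with
  | nil => simp [natPhi]
  | cons b u ih =>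
    rw [List.cons_append, h.wordF_cons, h.wordF_cons, ih, (natEps_natPhi_append u v).1]
    rw [natPhi]
    by_cases h1 : natEps ε φ v < natPhi ε φ u
    · by_cases h2 : natEps ε φ u < φ b
      · rw [if_pos (by omega), if_pos (by omega), if_pos h2]
        simp [Function.comp_def]
      · rw [if_neg (by omega), if_pos h1, if_pos (by omega), if_neg h2]
        simp [Function.comp_def]
    · by_cases h2 : natEps ε φ v < natPhi ε φ u + (φ b - natEps ε φ u)
      · rw [if_pos (by omega), if_pos h2, if_pos (by omega)]
        simp [Function.comp_def]
      · rw [if_neg (by omega), if_neg h1, if_neg h2]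
        simp [Function.comp_def]

/-- `ε` of a word that is cut into blocks, from a recursion for `ε` of its tails. -/
theorem natEps_flatMap (u : ℕ → List B) (F : ℕ → ℕ) (n s : ℕ) (h0 : F (s + n) = 0)
    (hF : ∀ c, s ≤ c → c < s + n → F c = natEps ε φ (u c) + (F (c + 1) - natPhi ε φ (u c))) :
    natEps ε φ ((List.range' s n).flatMap u) = F s := by
  -- The function `F` prescribes ε of the tail starting at each block; only its recursion and its
  -- value 0 at the end are needed to identify it.
  induction n generalizing s with
  | zero => simpa [natEps] using h0.symm
  | succ n ih =>
    rw [List.range'_succ, List.flatMap_cons, (natEps_natPhi_append _ _).1,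
      ih (s + 1) (by rw [← h0]; congr 1; omega) fun c h1 h2 => hF c (by omega) (by omega),
      hF s le_rfl (by omega)]

theorem Seminormal.wordF_flatMap_none (h : C.Seminormal i ε φ) (u : ℕ → List B) (F : ℕ → ℕ)
    (n s : ℕ) (h0 : F (s + n) = 0)
    (hF : ∀ c, s ≤ c → c < s + n → F c = natEps ε φ (u c) + (F (c + 1) - natPhi ε φ (u c)))
    (hn : ∀ c, s ≤ c → c < s + n → natPhi ε φ (u c) ≤ F (c + 1)) :
    wordF C i ((List.range' s n).flatMap u) = none := by
  induction n generalizing s with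
  | zero => simp [wordF]
  | succ n ih =>
    have h0' : F (s + 1 + n) = 0 := by rw [← h0]; congr 1; omega
    rw [List.range'_succ, List.flatMap_cons, h.wordF_append,
      natEps_flatMap u F n (s + 1) h0' fun c h1 h2 => hF c (by omega) (by omega),
      if_neg (by have := hn s le_rfl (by omega); omega),
      ih (s + 1) h0' (fun c h1 h2 => hF c (by omega) (by omega))
        fun c h1 h2 => hn c (by omega) (by omega)]
    rfl

/-- `f_i` acts on the first block whose `φ_i` exceeds `ε_i` of the remaining word. -/
theorem Seminormal.wordF_flatMap_some (h : C.Seminormal i ε φ) (u : ℕ → List B) (F : ℕ → ℕ)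
    (n s : ℕ) (h0 : F (s + n) = 0)
    (hF : ∀ c, s ≤ c → c < s + n → F c = natEps ε φ (u c) + (F (c + 1) - natPhi ε φ (u c)))
    (c : ℕ) (hsc : s ≤ c) (hcn : c < s + n) (hc : F (c + 1) < natPhi ε φ (u c))
    (hlt : ∀ c', s ≤ c' → c' < c → natPhi ε φ (u c') ≤ F (c' + 1)) (v : List B)
    (hv : wordF C i (u c) = some v) :
    wordF C i ((List.range' s n).flatMap u) =
      some ((List.range' s n).flatMap (Function.update u c v)) := by
  induction n generalizing s with
  | zero => omega
  | succ n ih =>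
    have h0' : F (s + 1 + n) = 0 := by rw [← h0]; congr 1; omega
    have hF' : ∀ c, s + 1 ≤ c → c < s + 1 + n →
        F c = natEps ε φ (u c) + (F (c + 1) - natPhi ε φ (u c)) :=
      fun c h1 h2 => hF c (by omega) (by omega)
    rw [List.range'_succ, List.flatMap_cons, h.wordF_append,
      natEps_flatMap u F n (s + 1) h0' hF']
    rcases Nat.eq_or_lt_of_le hsc with rfl | hlt'
    · rw [if_pos hc, hv, List.flatMap_cons, Function.update_self]
      have : (List.range' (s + 1) n).flatMap (Function.update u s v) =
          (List.range' (s + 1) n).flatMap u := by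
        refine List.flatMap_congr fun a ha => ?_
        rw [Function.update_of_ne]
        have := List.mem_range'_1.mp ha
        omega
      rw [this]; rfl
    · rw [if_neg (by have := hlt s le_rfl hlt'; omega),
        ih (s + 1) h0' hF' (by omega) (by omega) fun c' h1 h2 => hlt c' (by omega) h2,
        List.flatMap_cons, Function.update_of_ne (by omega)]
      rfl

end CrystalData

end GlInf

end

/-! ### The local rule and its effect on signatures. -/

noncomputable section

namespace GlInf

/-- The eventual value of a sequence that is eventually constant. -/
def eventual (x : ℕ → ℕ) : ℕ := Filter.limsup x Filter.atTop

theorem eventual_eq {x : ℕ → ℕ} {T v : ℕ} (h : ∀ n, T ≤ n → x n = v) : eventual x = v := by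
  have h1 : x =ᶠ[Filter.atTop] fun _ => v :=
    Filter.eventually_atTop.mpr ⟨T, fun n hn => h n hn⟩
  rw [eventual, Filter.limsup_congr h1, Filter.limsup_const]

/-- The sequence `mu` interlaces `lam`: `lam 0 ≥ mu 0 ≥ lam 1 ≥ mu 1 ≥ ⋯`. -/
def Interlace (lam mu : ℕ → ℕ) : Prop := ∀ t, mu t ≤ lam t ∧ lam (t + 1) ≤ mu t

/-- The carry in the local rule that removes `lam`, with neighbours `al` and `mu`. -/
def carry (lam al mu : ℕ → ℕ) : ℕ → ℕ
  | 0 => lam 0 - mu 0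
  | t + 1 => lam (t + 1) - mu (t + 1) + (carry lam al mu t - (al t - lam (t + 1)))

/-- The sequence that the local rule puts in the place of `lam`. -/
def inner (lam al mu : ℕ → ℕ) (t : ℕ) : ℕ :=
  lam (t + 1) + (al t - lam (t + 1) - carry lam al mu t)

/-- The number that the local rule records. -/
def label (lam al mu : ℕ → ℕ) : ℕ := eventual (carry lam al mu)

/-- `ε` of the signature word with blocks `-^{mu t - be t} +^{lam t - mu t}`, for `t` decreasing,
restricted to the blocks before a given one. -/
def stripEps (lam mu be : ℕ → ℕ) : ℕ → ℕ
  | 0 => 0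
  | t + 1 => mu t - be t + (stripEps lam mu be t - (lam t - mu t))

/-- The lowering operator acts on `mu t`. -/
def ActsAt (lam mu be : ℕ → ℕ) (t : ℕ) : Prop :=
  stripEps lam mu be t < lam t - mu t ∧ ∀ t', t < t' → lam t' - mu t' ≤ stripEps lam mu be t'

/-- Increase the term at `t` by one. -/
def bump (mu : ℕ → ℕ) (t : ℕ) : ℕ → ℕ := fun n => if n = t then mu n + 1 else mu n

variable {lam al mu be : ℕ → ℕ} {T : ℕ}

theorem Interlace.eq_zero (h : Interlace lam mu) (hT : ∀ n, T ≤ n → lam n = 0) (n : ℕ)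
    (hn : T ≤ n) : mu n = 0 := by
  have := (h n).1
  have := hT n hn
  omega

/-- The quantity d_t = carry + mu obeys d_0 = lam_0 and d_{t+1} = lam_{t+1} + max(0, d_t + lam_{t+1}
- mu_t - al_t), which is symmetric in al and mu. This is the source of all symmetry of the growth
diagram. -/
theorem carry_add_comm (hm : Interlace lam mu) (ha : Interlace lam al) (t : ℕ) :
    carry lam al mu t + mu t = carry lam mu al t + al t := by
  induction t with
  | zero => have := hm 0; have := ha 0; simp only [carry]; omega
  | succ t ih =>
    have := hm t; have := ha t; have := hm (t + 1); have := ha (t + 1)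
    simp only [carry]
    omega

/-- With d_t = carry + mu, the inner term is max(lam_{t+1}, al_t + mu_t - d_t). -/
theorem inner_comm (hm : Interlace lam mu) (ha : Interlace lam al) :
    inner lam al mu = inner lam mu al := by
  funext t
  have := carry_add_comm hm ha t
  have := hm t; have := ha t
  simp only [inner]
  omega

/-- Beyond the support there is nothing to add to the carry and no room to absorb it, so the
eventual value in `label` is attained at T. -/
theorem carry_const (ha : Interlace lam al) (hT : ∀ n, T ≤ n → lam n = 0) (n : ℕ) (hn : T ≤ n) :
    carry lam al mu n = carry lam al mu T := by
  induction n, hn using Nat.le_induction with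
  | base => rfl
  | succ n hn ih =>
    have := ha.eq_zero hT n hn
    have := hT (n + 1) (by omega)
    simp only [carry]
    omega

theorem label_eq (ha : Interlace lam al) (hT : ∀ n, T ≤ n → lam n = 0) :
    label lam al mu = carry lam al mu T :=
  eventual_eq (carry_const ha hT)

theorem label_comm (hm : Interlace lam mu) (ha : Interlace lam al)
    (hT : ∀ n, T ≤ n → lam n = 0) : label lam al mu = label lam mu al := by
  have := carry_add_comm hm ha T
  rw [label_eq ha hT, label_eq hm hT]
  have := hm.eq_zero hT T le_rfl
  have := ha.eq_zero hT T le_rfl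
  omega

theorem interlace_inner_left (ha : Interlace lam al) :
    Interlace al (inner lam al mu) := by
  intro t
  have := ha t; have := ha (t + 1)
  simp only [inner]
  omega

theorem interlace_inner_right (hm : Interlace lam mu) (ha : Interlace lam al) :
    Interlace mu (inner lam al mu) := by
  rw [inner_comm hm ha]
  exact interlace_inner_left hm

theorem stripEps_const (hm : Interlace lam mu) (hT : ∀ n, T ≤ n → lam n = 0) (n : ℕ)
    (hn : T ≤ n) : stripEps lam mu be n = stripEps lam mu be T := by
  induction n, hn using Nat.le_induction with
  | base => rfl
  | succ n hn ih =>
    have := hm.eq_zero hT n hn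
    have := hT n hn
    simp only [stripEps]
    omega

theorem stripEps_eventual (hm : Interlace lam mu) (hT : ∀ n, T ≤ n → lam n = 0) :
    eventual (stripEps lam mu be) = stripEps lam mu be T :=
  eventual_eq (stripEps_const hm hT)

/-- Inductive step of `stripEps_carry`, in coordinates that eliminate the interlacing inequalities:
a = lam_{t+1} - mu_{t+1} and u = al_t - lam_{t+1}, while x, y are the carries of two adjacent
squares and E is ε of the inner strip. -/
theorem stripStep_eps (a u x y E : ℕ) :
    y + (E - x) - a = y - (a + (u - x)) +
      (a + (u - x) - (a + (u - x) - y) + (E - (u - (u - x))) - (a + (x - u))) := by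
  rcases Nat.le_total u x with h1 | h1
  · obtain ⟨q, rfl⟩ := Nat.exists_eq_add_of_le h1
    rw [Nat.sub_eq_zero_of_le h1, Nat.add_zero, Nat.sub_zero, Nat.add_sub_cancel_left]
    rcases Nat.le_total a y with h2 | h2 <;> omega
  · obtain ⟨q, rfl⟩ := Nat.exists_eq_add_of_le h1
    rw [Nat.sub_eq_zero_of_le h1, Nat.add_zero, Nat.add_sub_cancel_left, Nat.add_sub_cancel]
    rcases Nat.le_total (a + q) y with h2 | h2 <;> omega

/-- The truncated form of `stripEps_row`, which can be proved by induction on t: the carries of the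
two adjacent squares play the role of the labels. The index shift occurs because term t of the inner
sequences is computed from term t+1 of `lam`. -/
theorem stripEps_carry (hm : Interlace lam mu) (ha : Interlace lam al) (t : ℕ) :
    stripEps lam mu be (t + 1) = carry mu (inner lam al mu) be t +
      (stripEps al (inner lam al mu) (inner mu (inner lam al mu) be) t - carry lam al mu t) := by
  induction t with
  | zero => simp [stripEps, carry]
  | succ t ih =>
    obtain ⟨a, hma⟩ := Nat.exists_eq_add_of_le (hm (t + 1)).1
    obtain ⟨u, hau⟩ := Nat.exists_eq_add_of_le (ha t).2
    have key := stripStep_eps a u (carry lam al mu t) (carry mu (inner lam al mu) be t)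
      (stripEps al (inner lam al mu) (inner mu (inner lam al mu) be) t)
    rw [stripEps, ih]
    simp only [stripEps, carry]
    have hg : inner mu (inner lam al mu) be t = mu (t + 1) +
      (inner lam al mu t - mu (t + 1) - carry mu (inner lam al mu) be t) := rfl
    have hk : inner lam al mu t = mu (t + 1) + (a + (u - carry lam al mu t)) := by
      change lam (t + 1) + (al t - lam (t + 1) - carry lam al mu t) = _
      rw [hau, hma, Nat.add_sub_cancel_left, Nat.add_assoc]
    rw [hg, hk, hau, hma]
    simp only [Nat.add_sub_cancel_left, Nat.add_sub_add_left, Nat.add_assoc] at key ⊢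
    rw [key]

/-- One row of the signature rule: `ε` of the strip is that of the block `-^s +^r` followed by the
strip of the inner sequences. -/
theorem stripEps_row (hm : Interlace lam mu) (ha : Interlace lam al)
    (hT : ∀ n, T ≤ n → lam n = 0) :
    eventual (stripEps lam mu be) = label mu (inner lam al mu) be +
      (eventual (stripEps al (inner lam al mu) (inner mu (inner lam al mu) be)) -
        label lam al mu) := by
  have hal := ha.eq_zero hT
  have hmu := hm.eq_zero hT
  rw [stripEps_eventual (T := T + 1) hm fun n hn => hT n (by omega), stripEps_carry hm ha,
    stripEps_eventual (interlace_inner_left ha) hal, label_eq ha hT,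
    label_eq (interlace_inner_right hm ha) hmu]

/-- If every + of the strip cancels, then the carry never exceeds ε of the inner strip. At a finite
index this says that the inner strip has no surviving +; in the limit it says the same for the block
of labels. -/
theorem acts_none_row (hm : Interlace lam mu) (ha : Interlace lam al)
    (hT : ∀ n, T ≤ n → lam n = 0) (hn : ∀ t, lam t - mu t ≤ stripEps lam mu be t) :
    label lam al mu ≤ eventual (stripEps al (inner lam al mu) (inner mu (inner lam al mu) be)) ∧
    ∀ t, al t - inner lam al mu t ≤
      stripEps al (inner lam al mu) (inner mu (inner lam al mu) be) t := by
  have key : ∀ t, carry lam al mu t ≤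
      stripEps al (inner lam al mu) (inner mu (inner lam al mu) be) t := by
    intro t
    induction t with
    | zero => simpa [carry, stripEps] using hn 0
    | succ t ih =>
      have h1 := stripEps_carry (be := be) hm ha t
      have h2 := hn (t + 1)
      have := hm t; have := ha t
      have := hm (t + 1); have := ha (t + 1)
      simp only [stripEps, carry]
      generalize stripEps al (inner lam al mu) (inner mu (inner lam al mu) be) t = E at *
      have hg : inner mu (inner lam al mu) be t = mu (t + 1) +
        (inner lam al mu t - mu (t + 1) - carry mu (inner lam al mu) be t) := rfl
      rw [hg]
      generalize carry mu (inner lam al mu) be t = y at *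
      have hk : inner lam al mu t = lam (t + 1) + (al t - lam (t + 1) - carry lam al mu t) := rfl
      rw [hk]
      generalize carry lam al mu t = x at *
      omega
  refine ⟨?_, fun t => ?_⟩
  · rw [stripEps_eventual (interlace_inner_left ha) (ha.eq_zero hT), label_eq ha hT]
    exact key T
  · have := key t
    have := ha t
    simp only [inner] at *
    omega

/-- This and the next three lemmas are the arithmetic of `acts_some_carry`. The coordinates are m =
mu_{n+1}, m + a = lam_{n+1}, m + a + u = al_n, β = be_{n+1}; x and y are carries and E is ε of the
inner strip. Here the added unit enters: the first carry loses one and the second gains one. -/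
theorem stripStep_at {m a b β u x y E : ℕ} (hm : m = β + b) (h : y + (E - x) < a) :
    (m + 1) + (m + a + (u - x) - (m + 1) - y) = m + (m + a + (u - x) - m - y) ∧
    m + a - (m + 1) + (x - u) + 1 = m + a - m + (x - u) ∧
    m + 1 - β + (y - (m + a + (u - x) - (m + 1))) = m - β + (y - (m + a + (u - x) - m)) + 1 ∧
    m + a + (u - x) - (m + (m + a + (u - x) - m - y)) + (E - (m + a + u - (m + a + (u - x)))) <
      m + a - m + (x - u) := by
  subst hm
  rcases Nat.le_total u x with h1 | h1
  · obtain ⟨q, rfl⟩ := Nat.exists_eq_add_of_le h1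
    refine ⟨by omega, by omega, by omega, by omega⟩
  · obtain ⟨q, rfl⟩ := Nat.exists_eq_add_of_le h1
    refine ⟨by omega, by omega, by omega, by omega⟩

/-- The unit is still in transit: both the old carry x+1 and the new carry x use up all the room u,
so the inner sequence does not notice the change. -/
theorem stripStep_before {m a b β u x y E : ℕ} (hm : m = β + b) (h : a ≤ y + (E - (x + 1))) (hE : E < x + 1) (hu : u ≤ x) :
    m + a + (u - x) = m + a + (u - (x + 1)) ∧
    m + (m + a + (u - x) - m - (y + 1)) = m + (m + a + (u - (x + 1)) - m - y) ∧
    m + a - m + (x - u) + 1 = m + a - m + (x + 1 - u) ∧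
    m - β + (y + 1 - (m + a + (u - x) - m)) = m - β + (y - (m + a + (u - (x + 1)) - m)) + 1 ∧
    m + a + (u - (x + 1)) - (m + (m + a + (u - (x + 1)) - m - y)) +
      (E - (m + a + u - (m + a + (u - (x + 1))))) < m + a - m + (x + 1 - u) := by
  subst hm
  obtain ⟨q, rfl⟩ := Nat.exists_eq_add_of_le hu
  refine ⟨by omega, by omega, by omega, by omega, by omega⟩

/-- The new carry x leaves one more unit of room than the old carry x+1, so the inner term grows by
one and the carries agree again from there on. -/
theorem stripStep_turn {m a b β u x y E : ℕ} (hm : m = β + b) (h : a ≤ y + (E - (x + 1))) (hE : E < x + 1) (hu : x < u) :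
    m + a + (u - x) = m + a + (u - (x + 1)) + 1 ∧
    m + (m + a + (u - x) - m - (y + 1)) = m + (m + a + (u - (x + 1)) - m - y) ∧
    m + a - m + (x - u) = m + a - m + (x + 1 - u) ∧
    m - β + (y + 1 - (m + a + (u - x) - m)) = m - β + (y - (m + a + (u - (x + 1)) - m)) ∧
    m + a - m + (x + 1 - u) ≤ m + a + (u - (x + 1)) - (m + (m + a + (u - (x + 1)) - m - y)) +
      (E - (m + a + u - (m + a + (u - (x + 1))))) ∧
    E < m + a + u - (m + a + (u - (x + 1))) := by
  subst hm
  obtain ⟨q, rfl⟩ := Nat.exists_eq_add_of_lt hu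
  refine ⟨by omega, by omega, by omega, by omega, by omega, by omega⟩

/-- Once the unit has been absorbed, the later + of the inner strip all cancel, so the absorbing
index is the one on which the operator acts. -/
theorem stripStep_after {m a u x y E : ℕ} (h : a ≤ y + (E - x)) (hE : x ≤ E) :
    m + a - m + (x - u) ≤ m + a + (u - x) - (m + (m + a + (u - x) - m - y)) +
      (E - (m + a + u - (m + a + (u - x)))) ∧
    m + a + u - (m + a + (u - x)) ≤ E := by
  rcases Nat.le_total u x with h1 | h1
  · obtain ⟨q, rfl⟩ := Nat.exists_eq_add_of_le h1
    refine ⟨by omega, by omega⟩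
  · obtain ⟨q, rfl⟩ := Nat.exists_eq_add_of_le h1
    refine ⟨by omega, by omega⟩

/-- The state after n steps: before index t nothing has changed. From t on, either the unit is in
transit, with shifted carries and a surviving + in the carry, or it has been absorbed by a term j of
the inner sequence, at which the inner operator acts. The sequence beyond the second square never
changes. -/
theorem acts_some_carry (hm : Interlace lam mu) (ha : Interlace lam al) (hb : Interlace mu be)
    (t : ℕ) (ht : ActsAt lam mu be t) (n : ℕ) :
    (∀ j, j < n → inner (bump mu t) (inner lam al (bump mu t)) be j =
      inner mu (inner lam al mu) be j) ∧
    (if n < t then carry lam al (bump mu t) n = carry lam al mu n ∧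
        carry (bump mu t) (inner lam al (bump mu t)) be n = carry mu (inner lam al mu) be n ∧
        ∀ j, j < n → inner lam al (bump mu t) j = inner lam al mu j
    else
      (carry lam al (bump mu t) n + 1 = carry lam al mu n ∧
        carry (bump mu t) (inner lam al (bump mu t)) be n =
          carry mu (inner lam al mu) be n + 1 ∧
        stripEps al (inner lam al mu) (inner mu (inner lam al mu) be) n < carry lam al mu n ∧
        ∀ j, j < n → inner lam al (bump mu t) j = inner lam al mu j) ∨
      (carry lam al (bump mu t) n = carry lam al mu n ∧
        carry (bump mu t) (inner lam al (bump mu t)) be n = carry mu (inner lam al mu) be n ∧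
        carry lam al mu n ≤ stripEps al (inner lam al mu) (inner mu (inner lam al mu) be) n ∧
        ∃ j, j < n ∧
          stripEps al (inner lam al mu) (inner mu (inner lam al mu) be) j <
            al j - inner lam al mu j ∧
          (∀ j', j < j' → j' < n → al j' - inner lam al mu j' ≤
            stripEps al (inner lam al mu) (inner mu (inner lam al mu) be) j') ∧
          ∀ j', j' < n → inner lam al (bump mu t) j' = bump (inner lam al mu) j j')) := by
  induction n with
  | zero =>
    refine ⟨fun j hj => absurd hj (by omega), ?_⟩
    have h0 := hm 0
    have h1 := hb 0
    split_ifs with h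
    · simp [carry, bump, show (0 : ℕ) ≠ t by omega]
    · obtain rfl : t = 0 := by omega
      have h2 := ht.1
      simp only [stripEps] at h2
      left
      simp only [carry, bump, if_true, stripEps]
      refine ⟨by omega, by omega, by omega, fun j hj => absurd hj (by omega)⟩
  | succ n ih =>
    obtain ⟨ihg, ih⟩ := ih
    have e1 := stripEps_carry (be := be) hm ha n
    obtain ⟨a, hma⟩ := Nat.exists_eq_add_of_le (hm (n + 1)).1
    obtain ⟨u, hau⟩ := Nat.exists_eq_add_of_le (ha n).2
    obtain ⟨b, hbb⟩ := Nat.exists_eq_add_of_le (hb (n + 1)).1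
    have hu : al n - lam (n + 1) = u := by omega
    have hacts : t < n + 1 → a ≤ stripEps lam mu be (n + 1) := fun h => by
      have := ht.2 (n + 1) h
      omega
    have hat : n + 1 = t → stripEps lam mu be (n + 1) < a := by
      rintro rfl
      have := ht.1
      omega
    rw [e1] at hacts hat
    clear e1
    set mu' := bump mu t with hmu'
    set kap := inner lam al mu with hkap
    set kap' := inner lam al mu' with hkap'
    set ga := inner mu kap be with hga
    set ga' := inner mu' kap' be with hga'
    have dk : kap n = mu (n + 1) + a + (u - carry lam al mu n) := by
      change lam (n + 1) + (al n - lam (n + 1) - carry lam al mu n) = _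
      rw [hu, hma]
    have dk' : kap' n = mu (n + 1) + a + (u - carry lam al mu' n) := by
      change lam (n + 1) + (al n - lam (n + 1) - carry lam al mu' n) = _
      rw [hu, hma]
    have dg : ga n = mu (n + 1) + (kap n - mu (n + 1) - carry mu kap be n) := rfl
    have dg' : ga' n = mu' (n + 1) + (kap' n - mu' (n + 1) - carry mu' kap' be n) := rfl
    have dx : carry lam al mu (n + 1) = mu (n + 1) + a - mu (n + 1) + (carry lam al mu n - u) := by
      change lam (n + 1) - mu (n + 1) + (carry lam al mu n - (al n - lam (n + 1))) = _
      rw [hu, hma]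
    have dx' : carry lam al mu' (n + 1) =
        mu (n + 1) + a - mu' (n + 1) + (carry lam al mu' n - u) := by
      change lam (n + 1) - mu' (n + 1) + (carry lam al mu' n - (al n - lam (n + 1))) = _
      rw [hu, hma]
    have dy : carry mu kap be (n + 1) =
        mu (n + 1) - be (n + 1) + (carry mu kap be n - (kap n - mu (n + 1))) := rfl
    have dy' : carry mu' kap' be (n + 1) =
        mu' (n + 1) - be (n + 1) + (carry mu' kap' be n - (kap' n - mu' (n + 1))) := rfl
    have dE : stripEps al kap ga (n + 1) = kap n - ga n +
        (stripEps al kap ga n - (mu (n + 1) + a + u - kap n)) := by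
      rw [← hma, ← hau]; rfl
    have dal : al n - kap n = mu (n + 1) + a + u - kap n := by rw [← hma, ← hau]
    have extend : ∀ {p q : ℕ → ℕ}, (∀ j, j < n → p j = q j) → p n = q n →
        ∀ j, j < n + 1 → p j = q j := by
      intro p q h1 h2 j hj
      rcases Nat.lt_succ_iff_lt_or_eq.mp hj with h | rfl
      · exact h1 j h
      · exact h2
    clear_value kap kap' ga ga'
    by_cases h1 : n + 1 < t
    · have dm : mu' (n + 1) = mu (n + 1) := by simp [hmu', bump, show n + 1 ≠ t by omega]
      rw [if_pos (by omega)] at ih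
      rw [if_pos h1]
      obtain ⟨ix, iy, ik⟩ := ih
      have hk : kap' n = kap n := by rw [dk, dk', ix]
      exact ⟨extend ihg (by rw [dg, dg', dm, hk, iy]), by rw [dx, dx', dm, ix],
        by rw [dy, dy', dm, hk, iy], extend ik hk⟩
    · rw [if_neg h1]
      by_cases h2 : n + 1 = t
      · have dm : mu' (n + 1) = mu (n + 1) + 1 := by simp [hmu', bump, h2]
        rw [if_pos (by omega)] at ih
        obtain ⟨ix, iy, ik⟩ := ih
        have hk : kap' n = kap n := by rw [dk, dk', ix]
        obtain ⟨s1, s2, s3, s4⟩ := stripStep_at (u := u) hbb (hat h2)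
        exact ⟨extend ihg (by rw [dg, dg', dm, hk, iy, dk, s1]),
          Or.inl ⟨by rw [dx, dx', dm, ix, s2], by rw [dy, dy', dm, hk, iy, dk, s3],
            by rw [dE, dx, dg, dk]; exact s4, extend ik hk⟩⟩
      · have dm : mu' (n + 1) = mu (n + 1) := by simp [hmu', bump, h2]
        rw [if_neg (by omega)] at ih
        have h3 := hacts (by omega)
        rcases ih with ⟨ix, iy, ie, ik⟩ | ⟨ix, iy, ie, j, hj, hj1, hj2, ik⟩
        · rw [← ix] at h3 ie dk dx
          rcases Nat.lt_or_ge (carry lam al mu' n) u with h4 | h4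
          · obtain ⟨s1, s2, s3, s4, s5, s6⟩ := stripStep_turn hbb h3 ie h4
            refine ⟨extend ihg (by rw [dg, dg', dm, iy, dk, dk', s2]),
              Or.inr ⟨by rw [dx, dx', dm, s3], by rw [dy, dy', dm, iy, dk, dk', s4],
              by rw [dE, dx, dg, dk]; exact s5, n, by omega, by rw [dal, dk]; exact s6,
              fun j' h5 h6 => by omega, ?_⟩⟩
            refine extend (fun j hj => ?_) (by simp [bump, dk, dk', s1])
            rw [ik j hj]; simp [bump, show j ≠ n by omega]
          · obtain ⟨s1, s2, s3, s4, s5⟩ := stripStep_before hbb h3 ie h4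
            exact ⟨extend ihg (by rw [dg, dg', dm, iy, dk, dk', s2]),
              Or.inl ⟨by rw [dx, dx', dm, s3], by rw [dy, dy', dm, iy, dk, dk', s4],
              by rw [dE, dx, dg, dk]; exact s5, extend ik (by rw [dk, dk', s1])⟩⟩
        · have hk : kap' n = kap n := by rw [dk, dk', ix]
          obtain ⟨s1, s2⟩ := stripStep_after (u := u) h3 ie
          refine ⟨extend ihg (by rw [dg, dg', dm, hk, iy]), Or.inr ⟨by rw [dx, dx', dm, ix],
            by rw [dy, dy', dm, hk, iy], by rw [dE, dx, dg, dk]; exact s1, j, by omega,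
            hj1, fun j' h5 h6 => ?_, ?_⟩⟩
          · rcases Nat.lt_succ_iff_lt_or_eq.mp h6 with h | rfl
            · exact hj2 j' h5 h
            · rw [dal, dk]; exact s2
          · refine extend ik ?_
            rw [hk]; simp [bump, show n ≠ j by omega]

/-- One row of the signature rule for the lowering operator. -/
theorem acts_some_row (hm : Interlace lam mu) (ha : Interlace lam al) (hb : Interlace mu be)
    (hT : ∀ n, T ≤ n → lam n = 0) (t : ℕ) (ht : ActsAt lam mu be t) :
    inner (bump mu t) (inner lam al (bump mu t)) be = inner mu (inner lam al mu) be ∧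
    ((eventual (stripEps al (inner lam al mu) (inner mu (inner lam al mu) be)) <
        label lam al mu ∧
      inner lam al (bump mu t) = inner lam al mu ∧
      label lam al (bump mu t) + 1 = label lam al mu ∧
      label (bump mu t) (inner lam al (bump mu t)) be = label mu (inner lam al mu) be + 1) ∨
    (label lam al mu ≤
        eventual (stripEps al (inner lam al mu) (inner mu (inner lam al mu) be)) ∧
      (∃ j, ActsAt al (inner lam al mu) (inner mu (inner lam al mu) be) j ∧
        inner lam al (bump mu t) = bump (inner lam al mu) j) ∧
      label lam al (bump mu t) = label lam al mu ∧
      label (bump mu t) (inner lam al (bump mu t)) be = label mu (inner lam al mu) be)) := by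
  have key := acts_some_carry hm ha hb t ht
  -- At t the operator needs lam_t - mu_t > 0, so the action lies within the support, and at index T
  -- the invariant is past its first stage.
  have htT : t < T := by
    by_contra h
    have := hT t (by omega)
    have := ht.1
    omega
  have hal := ha.eq_zero hT
  have hmu := hm.eq_zero hT
  have hmu' : ∀ n, T ≤ n → bump mu t n = 0 := fun n hn => by
    simp [bump, show n ≠ t by omega, hmu n hn]
  have hm' : Interlace lam (bump mu t) := by
    intro n
    have := hm n
    have := ht.1
    simp only [bump]
    split_ifs with h
    · subst h; omega
    · exact hm n
  have hk' : Interlace (bump mu t) (inner lam al (bump mu t)) := interlace_inner_right hm' ha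
  have hk := interlace_inner_left (mu := mu) ha
  rw [label_eq ha hT, label_eq ha hT, label_eq hk' hmu',
    label_eq (interlace_inner_right hm ha) hmu, stripEps_eventual hk hal]
  refine ⟨funext fun j => (key (j + 1)).1 j (by omega), ?_⟩
  have hz : ∀ (mu : ℕ → ℕ) j, T ≤ j → inner lam al mu j = 0 := by
    intro mu j hj
    simp [inner, hal j hj, hT (j + 1) (by omega)]
  have h2 := (key T).2
  rw [if_neg (by omega)] at h2
  -- A unit still in transit at T has reached the labels; an absorbed unit has become the action on
  -- the inner strip.
  rcases h2 with ⟨ix, iy, ie, ik⟩ | ⟨ix, iy, ie, j, hj, hj1, hj2, ik⟩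
  · refine Or.inl ⟨ie, funext fun j => ?_, ix, iy⟩
    rcases lt_or_ge j T with h | h
    · exact ik j h
    · rw [hz _ j h, hz _ j h]
  · refine Or.inr ⟨ie, ⟨j, ⟨hj1, fun j' h1 => ?_⟩, funext fun j' => ?_⟩, ix, iy⟩
    · rcases lt_or_ge j' T with h | h
      · exact hj2 j' h1 h
      · rw [hal j' h]; omega
    · rcases lt_or_ge j' T with h | h
      · exact ik j' h
      · rw [hz _ j' h]; simp [bump, show j' ≠ j by omega, hz _ j' h]

/-- Adding a box to the central strip increases the recorded number and changes nothing else. -/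
theorem label_bump (hm : Interlace lam mu) (ha : Interlace lam al)
    (hT : ∀ n, T ≤ n → lam n = 0) (t : ℕ)
    (ht : ∀ s, t = s + 1 → carry lam al mu s < al s - lam (s + 1))
    (ht' : ∀ s, t ≤ s → al s - lam (s + 1) ≤ carry lam al mu s) :
    inner (bump lam t) al mu = inner lam al mu ∧
    label (bump lam t) al mu = label lam al mu + 1 := by
  -- At t the new box takes one unit of room that the carry did not need; afterwards the carry
  -- exceeds the available room, so the extra unit is never absorbed and arrives in the label.
  have key : ∀ n, carry (bump lam t) al mu n = carry lam al mu n + if n < t then 0 else 1 := by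
    intro n
    induction n with
    | zero =>
      have := hm 0
      simp only [carry, bump]
      split_ifs <;> omega
    | succ n ih =>
      have h1 := hm (n + 1)
      have h2 := ha n
      simp only [carry, bump]
      rcases lt_trichotomy (n + 1) t with h | h | h
      · rw [if_neg (by omega), ih, if_pos (by omega), if_pos h]; omega
      · have := ht n h.symm
        rw [if_pos h, ih, if_pos (by omega), if_neg (by omega)]; omega
      · have := ht' n (by omega)
        rw [if_neg (by omega), ih, if_neg (by omega), if_neg (by omega)]; omega
  constructor
  · funext n
    have h2 := ha n
    simp only [inner, key, bump]
    rcases lt_trichotomy (n + 1) t with h | h | h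
    · rw [if_neg (by omega), if_pos (by omega)]; omega
    · have := ht n h.symm
      rw [if_pos h, if_pos (by omega)]; omega
    · have := ht' n (by omega)
      rw [if_neg (by omega), if_neg (by omega)]; omega
  · have h1 : ∀ n, T + t ≤ n → carry (bump lam t) al mu n = carry lam al mu T + 1 := by
      intro n hn
      rw [key, if_neg (by omega), carry_const ha hT n (by omega)]
    rw [label_eq ha hT]
    exact eventual_eq h1

end GlInf

end

/-! ### Growth diagrams and the matrices they record. -/

noncomputable section

namespace GlInf

/-- The growth diagram with given first row and first column. -/
def growth (top left : ℕ → ℕ → ℕ) : ℕ → ℕ → ℕ → ℕ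
  | 0, j => top j
  | i + 1, 0 => left (i + 1)
  | i + 1, j + 1 => inner (growth top left i j) (growth top left (i + 1) j)
      (growth top left i (j + 1))

/-- The matrix recorded by a growth diagram. -/
def growthLabel (top left : ℕ → ℕ → ℕ) (i j : ℕ) : ℕ :=
  label (growth top left i j) (growth top left (i + 1) j) (growth top left i (j + 1))

/-- The boundary of a growth diagram all of whose terms vanish from the index `T` on. -/
structure IsBoundary (top left : ℕ → ℕ → ℕ) (T : ℕ) : Prop where
  corner : top 0 = left 0
  top_interlace : ∀ j, Interlace (top j) (top (j + 1))
  left_interlace : ∀ i, Interlace (left i) (left (i + 1))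
  corner_zero : ∀ n, T ≤ n → top 0 n = 0
  top_zero : ∀ j, T ≤ j → ∀ n, top j n = 0
  left_zero : ∀ i, T ≤ i → ∀ n, left i n = 0

variable {top left top' left' : ℕ → ℕ → ℕ} {T : ℕ}

theorem growth_zero_row (j : ℕ) : growth top left 0 j = top j := by rw [growth]

theorem growth_zero_col (h : top 0 = left 0) (i : ℕ) : growth top left i 0 = left i := by
  cases i with
  | zero => rw [growth, h]
  | succ i => rw [growth]

theorem growth_succ (i j : ℕ) : growth top left (i + 1) (j + 1) =
    inner (growth top left i j) (growth top left (i + 1) j) (growth top left i (j + 1)) := by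
  rw [growth]

namespace IsBoundary

theorem swap (h : IsBoundary top left T) : IsBoundary left top T where
  corner := h.corner.symm
  top_interlace := h.left_interlace
  left_interlace := h.top_interlace
  corner_zero := by rw [← h.corner]; exact h.corner_zero
  top_zero := h.left_zero
  left_zero := h.top_zero

theorem interlace (h : IsBoundary top left T) (i : ℕ) :
    (∀ j, Interlace (growth top left i j) (growth top left i (j + 1))) ∧
    ∀ j, Interlace (growth top left i j) (growth top left (i + 1) j) := by
  have step : ∀ i, (∀ j, Interlace (growth top left i j) (growth top left i (j + 1))) →
      ∀ j, Interlace (growth top left i j) (growth top left (i + 1) j) := by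
    intro i hi j
    induction j with
    | zero =>
      rw [growth_zero_col h.corner, growth_zero_col h.corner]
      exact h.left_interlace i
    | succ j ih =>
      rw [growth_succ]
      exact interlace_inner_right (hi j) ih
  induction i with
  | zero =>
    have h0 : ∀ j, Interlace (growth top left 0 j) (growth top left 0 (j + 1)) := by
      intro j
      rw [growth_zero_row, growth_zero_row]
      exact h.top_interlace j
    exact ⟨h0, step 0 h0⟩
  | succ i ih =>
    have h1 : ∀ j, Interlace (growth top left (i + 1) j) (growth top left (i + 1) (j + 1)) := by
      intro j
      rw [growth_succ]
      exact interlace_inner_left (ih.2 j)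
    exact ⟨h1, step _ h1⟩

/-- Symmetry of the local rule propagates through the diagram. It reduces operators of negative
index to those of positive index. -/
theorem growth_swap (h : IsBoundary top left T) (i j : ℕ) :
    growth left top j i = growth top left i j := by
  induction i generalizing j with
  | zero => rw [growth_zero_row, growth_zero_col h.corner.symm]
  | succ i ihi =>
    induction j with
    | zero => rw [growth_zero_row, growth_zero_col h.corner]
    | succ j ihj =>
      rw [growth_succ, growth_succ, ihi j, ihj, ihi (j + 1),
        inner_comm ((h.interlace i).2 j) ((h.interlace i).1 j)]

theorem le_first (h : IsBoundary top left T) (i j n : ℕ) :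
    growth top left i j n ≤ top j n ∧ growth top left i j n ≤ left i n := by
  have key : ∀ {top left : ℕ → ℕ → ℕ}, IsBoundary top left T → ∀ i j n,
      growth top left i j n ≤ top j n := by
    intro top left h i j n
    induction i with
    | zero => rw [growth_zero_row]
    | succ i ih => exact (((h.interlace i).2 j) n).1.trans ih
  refine ⟨key h i j n, ?_⟩
  rw [← h.growth_swap]
  exact key h.swap j i n

theorem top_le (h : IsBoundary top left T) (j n : ℕ) : top j n ≤ top 0 n := by
  induction j with
  | zero => exact le_rfl
  | succ j ih => exact (h.top_interlace j n).1.trans ih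

theorem growth_eq_zero (h : IsBoundary top left T) (i j n : ℕ) (hn : T ≤ n ∨ T ≤ i ∨ T ≤ j) :
    growth top left i j n = 0 := by
  have h1 := h.le_first i j n
  have h2 := h.top_le j n
  rcases hn with hn | hn | hn
  · have := h.corner_zero n hn; omega
  · have := h.left_zero i hn n; omega
  · have := h.top_zero j hn n; omega

theorem growthLabel_eq_zero (h : IsBoundary top left T) (i j : ℕ) (hn : T ≤ i ∨ T ≤ j) :
    growthLabel top left i j = 0 := by
  rw [growthLabel, label_eq (T := 0) ((h.interlace i).2 j)
    fun n _ => h.growth_eq_zero i j n (Or.inr hn), carry, h.growth_eq_zero i j 0 (Or.inr hn),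
    Nat.zero_sub]

theorem growthLabel_swap (h : IsBoundary top left T) (i j : ℕ) :
    growthLabel left top j i = growthLabel top left i j := by
  rw [growthLabel, growthLabel, h.growth_swap, h.growth_swap, h.growth_swap,
    label_comm ((h.interlace i).2 j) ((h.interlace i).1 j)
      fun n hn => h.growth_eq_zero i j n (Or.inl hn)]

/-- `ε` of the tails of the column word, in terms of the growth diagram. -/
theorem strip_eq (h : IsBoundary top left T) (i k : ℕ) :
    eventual (stripEps (growth top left i k) (growth top left i (k + 1))
      (growth top left i (k + 2))) =
    growthLabel top left i (k + 1) + (eventual (stripEps (growth top left (i + 1) k)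
      (growth top left (i + 1) (k + 1)) (growth top left (i + 1) (k + 2))) -
        growthLabel top left i k) := by
  rw [stripEps_row (al := growth top left (i + 1) k) ((h.interlace i).1 k) ((h.interlace i).2 k)
    fun n hn => h.growth_eq_zero i k n (Or.inl hn), ← growth_succ, ← growth_succ]
  rfl

theorem strip_zero (h : IsBoundary top left T) (i k : ℕ) (hi : T ≤ i) :
    eventual (stripEps (growth top left i k) (growth top left i (k + 1))
      (growth top left i (k + 2))) = 0 := by
  rw [stripEps_eventual (T := 0) ((h.interlace i).1 k)
    fun n _ => h.growth_eq_zero i k n (Or.inr (Or.inl hi)), stripEps]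

theorem strip_none (h : IsBoundary top left T) (k : ℕ)
    (hn : ∀ t, top k t - top (k + 1) t ≤ stripEps (top k) (top (k + 1)) (top (k + 2)) t) (i : ℕ) :
    growthLabel top left i k ≤ eventual (stripEps (growth top left (i + 1) k)
      (growth top left (i + 1) (k + 1)) (growth top left (i + 1) (k + 2))) := by
  -- The absence of a surviving + passes from each row of the diagram to the next.
  have key : ∀ i, ∀ t, growth top left i k t - growth top left i (k + 1) t ≤
      stripEps (growth top left i k) (growth top left i (k + 1)) (growth top left i (k + 2)) t := by
    intro i
    induction i with
    | zero => simpa only [growth_zero_row] using hn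
    | succ i ih =>
      have := (acts_none_row (al := growth top left (i + 1) k) ((h.interlace i).1 k)
        ((h.interlace i).2 k)
        (fun n hn => h.growth_eq_zero i k n (Or.inl hn)) ih).2
      rwa [← growth_succ, ← growth_succ] at this
  have := (acts_none_row (al := growth top left (i + 1) k) ((h.interlace i).1 k)
    ((h.interlace i).2 k) (fun n hn => h.growth_eq_zero i k n (Or.inl hn)) (key i)).1
  rwa [← growth_succ, ← growth_succ] at this

end IsBoundary

theorem growth_row_congr (i : ℕ) (hl : left' (i + 1) = left (i + 1))
    (h : ∀ j, growth top' left' i j = growth top left i j) (j : ℕ) :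
    growth top' left' (i + 1) j = growth top left (i + 1) j := by
  induction j with
  | zero => rw [growth, growth, hl]
  | succ j ih => rw [growth_succ, growth_succ, h, h, ih]

/-- The effect of a lowering operator with positive index on the recorded matrix. -/
theorem IsBoundary.strip_some (h : IsBoundary top left T) (k t : ℕ)
    (ht : ActsAt (top k) (top (k + 1)) (top (k + 2)) t)
    (htop : ∀ j, j ≠ k + 1 → top' j = top j) (htop' : top' (k + 1) = bump (top (k + 1)) t) :
    ∃ i₀, growthLabel top left i₀ k > eventual (stripEps (growth top left (i₀ + 1) k)
        (growth top left (i₀ + 1) (k + 1)) (growth top left (i₀ + 1) (k + 2))) ∧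
      (∀ i, i < i₀ → growthLabel top left i k ≤ eventual (stripEps (growth top left (i + 1) k)
        (growth top left (i + 1) (k + 1)) (growth top left (i + 1) (k + 2)))) ∧
      growthLabel top' left i₀ k + 1 = growthLabel top left i₀ k ∧
      growthLabel top' left i₀ (k + 1) = growthLabel top left i₀ (k + 1) + 1 ∧
      ∀ i j, ¬ (i = i₀ ∧ (j = k ∨ j = k + 1)) →
        growthLabel top' left i j = growthLabel top left i j := by
  -- One row of the diagram: if only column k+1 differs, and by a bump at the acting index, then
  -- either the next row is restored completely and two labels change, or the labels stay and the
  -- same situation recurs one row lower.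
  have step : ∀ i, (∃ t, ActsAt (growth top left i k) (growth top left i (k + 1))
        (growth top left i (k + 2)) t ∧
        growth top' left i (k + 1) = bump (growth top left i (k + 1)) t) →
      (∀ j, j ≠ k + 1 → growth top' left i j = growth top left i j) →
      (eventual (stripEps (growth top left (i + 1) k) (growth top left (i + 1) (k + 1))
          (growth top left (i + 1) (k + 2))) < growthLabel top left i k ∧
        (∀ j, growth top' left (i + 1) j = growth top left (i + 1) j) ∧
        growthLabel top' left i k + 1 = growthLabel top left i k ∧
        growthLabel top' left i (k + 1) = growthLabel top left i (k + 1) + 1 ∧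
        ∀ j, ¬ (j = k ∨ j = k + 1) → growthLabel top' left i j = growthLabel top left i j) ∨
      (growthLabel top left i k ≤ eventual (stripEps (growth top left (i + 1) k)
          (growth top left (i + 1) (k + 1)) (growth top left (i + 1) (k + 2))) ∧
        (∃ t, ActsAt (growth top left (i + 1) k) (growth top left (i + 1) (k + 1))
          (growth top left (i + 1) (k + 2)) t ∧
          growth top' left (i + 1) (k + 1) = bump (growth top left (i + 1) (k + 1)) t) ∧
        (∀ j, j ≠ k + 1 → growth top' left (i + 1) j = growth top left (i + 1) j) ∧
        ∀ j, growthLabel top' left i j = growthLabel top left i j) := by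
    rintro i ⟨t, h1, h2⟩ h3
    have low : ∀ j, j ≤ k → growth top' left (i + 1) j = growth top left (i + 1) j := by
      intro j hj
      induction j with
      | zero => rw [growth, growth]
      | succ j ih =>
        rw [growth_succ, growth_succ, ih (by omega), h3 j (by omega), h3 (j + 1) (by omega)]
    have key := acts_some_row ((h.interlace i).1 k) ((h.interlace i).2 k)
      ((h.interlace i).1 (k + 1)) (fun n hn => h.growth_eq_zero i k n (Or.inl hn)) t h1
    rw [← h2, ← low k le_rfl, ← h3 k (by omega), ← growth_succ, low k le_rfl, h3 k (by omega),
      ← growth_succ, ← h3 (k + 2) (by omega), ← growth_succ, h3 (k + 2) (by omega),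
      ← growth_succ] at key
    obtain ⟨k1, k2⟩ := key
    have high : ∀ j, k + 2 ≤ j → growth top' left (i + 1) j = growth top left (i + 1) j := by
      intro j hj
      induction j, hj using Nat.le_induction with
      | base => exact k1
      | succ j hj ih =>
        rw [growth_succ, growth_succ, ih, h3 j (by omega), h3 (j + 1) (by omega)]
    have lab : ∀ j, ¬ (j = k ∨ j = k + 1) →
        growthLabel top' left i j = growthLabel top left i j := by
      intro j hj
      rw [growthLabel, growthLabel, h3 j (by omega), h3 (j + 1) (by omega)]
      rcases lt_or_ge j (k + 1) with h4 | h4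
      · rw [low j (by omega)]
      · rw [high j (by omega)]
    have e1 : label (growth top left i k) (growth top left (i + 1) k)
        (growth top' left i (k + 1)) = growthLabel top' left i k := by
      rw [growthLabel, h3 k (by omega), low k le_rfl]
    have e2 : label (growth top' left i (k + 1)) (growth top' left (i + 1) (k + 1))
        (growth top left i (k + 2)) = growthLabel top' left i (k + 1) := by
      rw [growthLabel, h3 (k + 2) (by omega)]
    rw [e1, e2] at k2
    rcases k2 with ⟨a1, a2, a3, a4⟩ | ⟨a1, ⟨t', a2, a3⟩, a4, a5⟩
    · refine Or.inl ⟨a1, fun j => ?_, a3, a4, lab⟩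
      rcases lt_trichotomy j (k + 1) with h4 | rfl | h4
      · exact low j (by omega)
      · exact a2
      · exact high j (by omega)
    · refine Or.inr ⟨a1, ⟨t', a2, a3⟩, fun j hj => ?_, fun j => ?_⟩
      · rcases lt_or_ge j (k + 1) with h4 | h4
        · exact low j (by omega)
        · exact high j (by omega)
      · by_cases hj : j = k ∨ j = k + 1
        · rcases hj with rfl | rfl
          · exact a4
          · exact a5
        · exact lab j hj
  have main : ∀ n, ((∃ t, ActsAt (growth top left n k) (growth top left n (k + 1))
        (growth top left n (k + 2)) t ∧
        growth top' left n (k + 1) = bump (growth top left n (k + 1)) t) ∧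
      (∀ j, j ≠ k + 1 → growth top' left n j = growth top left n j) ∧
      ∀ i, i < n → growthLabel top left i k ≤ eventual (stripEps (growth top left (i + 1) k)
          (growth top left (i + 1) (k + 1)) (growth top left (i + 1) (k + 2))) ∧
        ∀ j, growthLabel top' left i j = growthLabel top left i j) ∨
      ∃ i₀, i₀ < n ∧ (∀ j, growth top' left n j = growth top left n j) ∧
        growthLabel top left i₀ k > eventual (stripEps (growth top left (i₀ + 1) k)
        (growth top left (i₀ + 1) (k + 1)) (growth top left (i₀ + 1) (k + 2))) ∧
      (∀ i, i < i₀ → growthLabel top left i k ≤ eventual (stripEps (growth top left (i + 1) k)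
        (growth top left (i + 1) (k + 1)) (growth top left (i + 1) (k + 2)))) ∧
      growthLabel top' left i₀ k + 1 = growthLabel top left i₀ k ∧
      growthLabel top' left i₀ (k + 1) = growthLabel top left i₀ (k + 1) + 1 ∧
      ∀ i j, i < n → ¬ (i = i₀ ∧ (j = k ∨ j = k + 1)) →
        growthLabel top' left i j = growthLabel top left i j := by
    intro n
    induction n with
    | zero =>
      refine Or.inl ⟨⟨t, ?_, ?_⟩, fun j hj => ?_, fun i hi => absurd hi (by omega)⟩
      · simpa only [growth_zero_row] using ht
      · rw [growth_zero_row, growth_zero_row, htop']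
      · rw [growth_zero_row, growth_zero_row, htop j hj]
    | succ n ih =>
      rcases ih with ⟨ha, hD, hr⟩ | ⟨i₀, hi₀, hD, c1, c2, c3, c4, c5⟩
      · rcases step n ha hD with ⟨b1, b2, b3, b4, b5⟩ | ⟨b1, b2, b3, b4⟩
        · refine Or.inr ⟨n, by omega, b2, b1, fun i hi => (hr i hi).1, b3, b4,
            fun i j hi hij => ?_⟩
          rcases Nat.lt_succ_iff_lt_or_eq.mp hi with h1 | rfl
          · exact (hr i h1).2 j
          · exact b5 j fun h2 => hij ⟨rfl, h2⟩
        · refine Or.inl ⟨b2, b3, fun i hi => ?_⟩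
          rcases Nat.lt_succ_iff_lt_or_eq.mp hi with h1 | rfl
          · exact hr i h1
          · exact ⟨b1, b4⟩
      · have hD' := growth_row_congr (left' := left) n rfl hD
        refine Or.inr ⟨i₀, by omega, hD', c1, c2, c3, c4, fun i j hi hij => ?_⟩
        rcases Nat.lt_succ_iff_lt_or_eq.mp hi with h1 | rfl
        · exact c5 i j h1 hij
        · rw [growthLabel, growthLabel, hD, hD, hD']
  -- Row T of the diagram vanishes, so no action is possible there and the unit must have been
  -- deposited in an earlier row i₀.
  rcases main T with ⟨⟨t, ha, -⟩, -⟩ | ⟨i₀, hi₀, hD, c1, c2, c3, c4, c5⟩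
  · have := ha.1
    rw [h.growth_eq_zero T k t (Or.inr (Or.inl le_rfl))] at this
    omega
  · refine ⟨i₀, c1, c2, c3, c4, fun i j hij => ?_⟩
    rcases lt_or_ge i T with h1 | h1
    · exact c5 i j h1 hij
    · have hrow : ∀ j, growth top' left i j = growth top left i j := by
        induction i, h1 using Nat.le_induction with
        | base => exact hD
        | succ i hi ih => exact growth_row_congr i rfl (ih (by omega))
      rw [growthLabel, growthLabel, hrow, hrow, growth_row_congr i rfl hrow]

/-- The effect of the lowering operator `f_0` on the recorded matrix. -/
theorem IsBoundary.corner_some (h : IsBoundary top left T) (t : ℕ)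
    (ht : ∀ s, t = s + 1 → carry (top 0) (left 1) (top 1) s < left 1 s - top 0 (s + 1))
    (ht' : ∀ s, t ≤ s → left 1 s - top 0 (s + 1) ≤ carry (top 0) (left 1) (top 1) s)
    (htop : ∀ j, j ≠ 0 → top' j = top j) (hleft : ∀ i, i ≠ 0 → left' i = left i)
    (htop' : top' 0 = bump (top 0) t) (i j : ℕ) :
    growthLabel top' left' i j = growthLabel top left i j + if i = 0 ∧ j = 0 then 1 else 0 := by
  have hm : Interlace (top 0) (top 1) := h.top_interlace 0
  have ha : Interlace (top 0) (left 1) := by rw [h.corner]; exact h.left_interlace 0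
  have key := label_bump hm ha h.corner_zero t ht ht'
  -- The added box is seen only by the corner square, whose inner sequence is unaffected; hence row
  -- 1, and with it everything below, agrees.
  have h1 : ∀ j, growth top' left' 1 j = growth top left 1 j := by
    intro j
    induction j with
    | zero => rw [growth, growth, hleft 1 one_ne_zero]
    | succ j ih =>
      rw [growth_succ, growth_succ, ih]
      simp only [growth_zero_row]
      rcases Nat.eq_zero_or_pos j with rfl | hj
      · rw [htop', htop _ (by omega), growth, zero_add, key.1]
      · rw [htop _ (by omega), htop _ (by omega)]
  have h2 : ∀ i, 1 ≤ i → ∀ j, growth top' left' i j = growth top left i j := by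
    intro i hi
    induction i, hi using Nat.le_induction with
    | base => exact h1
    | succ i hi ih => exact growth_row_congr i (hleft _ (by omega)) ih
  rcases Nat.eq_zero_or_pos i with rfl | hi
  · simp only [growthLabel, growth_zero_row, zero_add, true_and]
    rw [h1]
    rcases Nat.eq_zero_or_pos j with rfl | hj
    · rw [htop', htop _ (by omega), growth, if_pos rfl, key.2]
    · rw [htop _ (by omega), htop _ (by omega), if_neg (by omega), add_zero]
  · rw [growthLabel, growthLabel, h2 i hi, h2 i hi, h2 (i + 1) (by omega), if_neg (by omega),
      add_zero]

end GlInf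

end

/-! ### The words of a matrix and their signatures. -/

noncomputable section

namespace GlInf

open CrystalData

theorem natural_seminormal (i : ℤ) :
    natural.Seminormal i (fun k => if k = hi i then 1 else 0) (fun k => if k = lo i then 1 else 0)
    where
  eps_eq b := by simp only [natural]; split_ifs <;> rfl
  phi_eq b := by simp only [natural]; split_ifs <;> rfl
  pair b := by
    have := lo_ne_hi i
    simp only [natural, pairing, epsW, Finsupp.single_apply]
    split_ifs <;> simp_all
  f_some b b' h := by
    have := lo_ne_hi i
    simp only [natural] at h ⊢
    split_ifs at h with h1
    · obtain rfl : hi i = b' := by simpa using h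
      subst h1
      simp [this, this.symm, simpleRoot]
  f_iff_e b b' := by
    simp only [natural]
    split_ifs with h1 h2 h2 <;> simp_all [eq_comm]
  e_none b := by simp only [natural]; split_ifs <;> simp
  f_none b := by simp only [natural]; split_ifs <;> simp

theorem CrystalData.Seminormal.dual {B : Type} {C : CrystalData B} {i : ℤ} {ε φ : B → ℕ}
    (h : C.Seminormal i ε φ) : C.dual.Seminormal i φ ε where
  eps_eq := h.phi_eq
  phi_eq := h.eps_eq
  pair b := by
    have := h.pair b
    simp only [CrystalData.dual, pairing_neg]
    omega
  f_some b b' hb := by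
    obtain ⟨h1, h2, h3⟩ := h.f_some b' b ((h.f_iff_e b' b).mpr hb)
    refine ⟨h2, h1, ?_⟩
    simp only [CrystalData.dual, h3]
    abel
  f_iff_e b b' := (h.f_iff_e b' b).symm
  e_none := h.f_none
  f_none := h.e_none

/-- The word `(n-1)^{g (n-1)} ⋯ 1^{g 1} 0^{g 0}`. -/
def decWord (g : ℕ → ℕ) : ℕ → List ℕ
  | 0 => []
  | n + 1 => List.replicate (g n) n ++ decWord g n

theorem lt_of_mem_decWord {g : ℕ → ℕ} {n j : ℕ} (h : j ∈ decWord g n) : j < n := by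
  induction n with
  | zero => simp [decWord] at h
  | succ n ih =>
    rcases List.mem_append.mp h with h | h
    · rw [List.eq_of_mem_replicate h]; omega
    · have := ih h; omega

theorem decWord_pairwise (g : ℕ → ℕ) (n : ℕ) : (decWord g n).Pairwise (· ≥ ·) := by
  induction n with
  | zero => exact List.Pairwise.nil
  | succ n ih =>
    refine List.pairwise_append.mpr ⟨List.pairwise_replicate.mpr (Or.inr le_rfl), ih, ?_⟩
    intro a ha b hb
    rw [List.eq_of_mem_replicate ha]
    exact (lt_of_mem_decWord hb).le

theorem count_decWord (g : ℕ → ℕ) (n j : ℕ) :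
    (decWord g n).count j = if j < n then g j else 0 := by
  induction n with
  | zero => simp [decWord]
  | succ n ih =>
    rw [decWord, List.count_append, List.count_replicate, ih]
    by_cases h : n = j
    · subst h; simp
    · have : (n == j) = false := by simpa using h
      rw [this]
      simp only [Bool.false_eq_true, if_false, zero_add]
      split_ifs <;> omega

theorem decWord_congr {g g' : ℕ → ℕ} (n : ℕ) (h : ∀ j, j < n → g j = g' j) :
    decWord g n = decWord g' n := by
  induction n with
  | zero => rfl
  | succ n ih => rw [decWord, decWord, ih fun j hj => h j (by omega), h n (by omega)]

/-- The biword of a matrix, row by row. -/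
def rowCells (A : Mat) (N i : ℕ) : List (ℕ ×ₗ ℕᵒᵈ) :=
  (decWord (fun j => A (i, j)) N).map fun j => toLex (i, OrderDual.toDual j)

theorem count_rowCells [BEq (ℕ ×ₗ ℕᵒᵈ)] [LawfulBEq (ℕ ×ₗ ℕᵒᵈ)] (A : Mat) (N i : ℕ) (c : ℕ × ℕ) :
    (rowCells A N i).count (toLex (c.1, OrderDual.toDual c.2)) =
      if i = c.1 ∧ c.2 < N then A c else 0 := by
  by_cases h : i = c.1
  · subst h
    have hinj : Function.Injective fun j : ℕ => toLex (c.1, OrderDual.toDual j) := by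
      intro a b hab
      simpa using hab
    rw [rowCells, List.count_map_of_injective _ _ hinj, count_decWord]
    simp
  · rw [if_neg (by tauto), List.count_eq_zero]
    intro hmem
    obtain ⟨j, -, hj⟩ := List.mem_map.mp hmem
    have h2 := congrArg ofLex hj
    simp only [ofLex_toLex, Prod.mk.injEq] at h2
    exact h h2.1

/-- Both lists are sorted for the same order and contain each position equally often. This replaces
the abstract sort by an explicit concatenation of row blocks, to which the block signature rule
applies. -/
theorem biwordByRow_eq (A : Mat) (N : ℕ) (hN : ∀ i j, N ≤ i ∨ N ≤ j → A (i, j) = 0) :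
    biwordByRow A = (List.range' 0 N).flatMap (rowCells A N) := by
  refine List.Perm.eq_of_pairwise' (r := (· ≤ ·)) (Multiset.pairwise_sort _ _) ?_ ?_
  · refine List.pairwise_flatMap.mpr ⟨fun i _ => ?_, ?_⟩
    · refine List.pairwise_map.mpr ((decWord_pairwise _ N).imp ?_)
      intro a b hab
      exact Prod.Lex.toLex_le_toLex.mpr (Or.inr ⟨rfl, hab⟩)
    · refine (List.pairwise_lt_range' (s := 0) (n := N)).imp ?_
      intro a b hab x hx y hy
      obtain ⟨j, -, rfl⟩ := List.mem_map.mp hx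
      obtain ⟨j', -, rfl⟩ := List.mem_map.mp hy
      exact Prod.Lex.toLex_le_toLex.mpr (Or.inl hab)
  · refine Multiset.coe_eq_coe.mp (Multiset.ext.mpr fun x => ?_)
    obtain ⟨⟨p, q⟩, rfl⟩ : ∃ c : ℕ × ℕ, x = toLex (c.1, OrderDual.toDual c.2) :=
      ⟨((ofLex x).1, OrderDual.ofDual (ofLex x).2), rfl⟩
    have h1 : Multiset.count (toLex (p, OrderDual.toDual q)) ↑(biwordByRow A) = A (p, q) := by
      have hinj : Function.Injective fun c : ℕ × ℕ => toLex (c.1, OrderDual.toDual c.2) := by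
        intro a b hab
        have := congrArg ofLex hab
        simp only [ofLex_toLex, Prod.mk.injEq] at this
        exact Prod.ext this.1 (by simpa using this.2)
      rw [biwordByRow, Multiset.sort_eq]
      exact (Multiset.count_map_eq_count' _ _ hinj (p, q)).trans (Finsupp.count_toMultiset A _)
    have h2 : ∀ n s, ((List.range' s n).map fun i => if i = p ∧ q < N then A (p, q) else 0).sum =
        if s ≤ p ∧ p < s + n ∧ q < N then A (p, q) else 0 := by
      intro n
      induction n with
      | zero => intro s; rw [if_neg (by omega)]; rfl
      | succ n ih =>
        intro s
        rw [List.range'_succ, List.map_cons, List.sum_cons, ih]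
        split_ifs <;> omega
    rw [h1, Multiset.coe_count, @List.count_flatMap _ _ instBEqOfDecidableEq]
    refine Eq.trans ?_ (congrArg List.sum (List.map_congr_left fun i _ =>
      @count_rowCells instBEqOfDecidableEq inferInstance A N i (p, q))).symm
    rw [h2]
    split_ifs with h3
    · rfl
    · exact hN p q (by omega)

/-- The word of second components of the biword. -/
def lexWord (ι : ℕ → NZ) (A : Mat) : List NZ :=
  (biwordByRow A).map fun c => ι (OrderDual.ofDual (ofLex c).2)

theorem lexWord_eq (ι : ℕ → NZ) (A : Mat) (N : ℕ) (hN : ∀ i j, N ≤ i ∨ N ≤ j → A (i, j) = 0) :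
    lexWord ι A = (List.range' 0 N).flatMap fun i => (decWord (fun j => A (i, j)) N).map ι := by
  rw [lexWord, biwordByRow_eq A N hN, List.map_flatMap]
  refine List.flatMap_congr fun i _ => ?_
  rw [rowCells, List.map_map]
  rfl

theorem biwordByRow_fst_eq (A : Mat) (N : ℕ) (hN : ∀ i j, N ≤ i ∨ N ≤ j → A (i, j) = 0) :
    (biwordByRow A).map (fun c => (ofLex c).1) = (List.range' 0 N).flatMap fun i =>
      List.replicate (decWord (fun j => A (i, j)) N).length i := by
  rw [biwordByRow_eq A N hN, List.map_flatMap]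
  refine List.flatMap_congr fun i _ => ?_
  rw [rowCells, List.map_map]
  exact List.map_const' ..

theorem exists_bound (A : Mat) : ∃ N, ∀ i j, N ≤ i ∨ N ≤ j → A (i, j) = 0 := by
  refine ⟨(A.support.sup fun c => max c.1 c.2) + 1, fun i j h => ?_⟩
  by_contra h1
  have h2 : max i j ≤ A.support.sup fun c => max c.1 c.2 :=
    Finset.le_sup (f := fun c : ℕ × ℕ => max c.1 c.2) (Finsupp.mem_support_iff.mpr h1)
  omega

/-- The letters `ι k` and `ι (k + 1)` are joined by an `i`-arrow, and no other letter `ι j` is the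
end of such an arrow. -/
structure LetterArrow (C : CrystalData NZ) (ε φ : NZ → ℕ) (ι : ℕ → NZ) (i : ℤ) (k : ℕ) : Prop
    where
  semi : C.Seminormal i ε φ
  eps : ∀ j, ε (ι j) = if j = k + 1 then 1 else 0
  phi : ∀ j, φ (ι j) = if j = k then 1 else 0
  f : C.f i (ι k) = some (ι (k + 1))

section LetterArrow

variable {C : CrystalData NZ} {ε φ : NZ → ℕ} {ι : ℕ → NZ} {i : ℤ} {k : ℕ}

theorem LetterArrow.replicate_values (h : LetterArrow C ε φ ι i k) (m j : ℕ) (w : List NZ) :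
    natEps ε φ (List.replicate m (ι j) ++ w) =
      (if j = k + 1 then m else 0) + (natEps ε φ w - if j = k then m else 0) ∧
    natPhi ε φ (List.replicate m (ι j) ++ w) =
      natPhi ε φ w + ((if j = k then m else 0) - natEps ε φ w) := by
  induction m with
  | zero => simp
  | succ m ih =>
    rw [List.replicate_succ, List.cons_append, natEps, natPhi, h.eps, h.phi, ih.1, ih.2]
    split_ifs <;> omega

/-- In a decreasing block the letters k+1 (signs -) precede the letters k (signs +), so nothing
cancels inside a block. -/
theorem LetterArrow.decWord_values (h : LetterArrow C ε φ ι i k) (g : ℕ → ℕ) (n : ℕ) :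
    natEps ε φ ((decWord g n).map ι) = (if k + 2 ≤ n then g (k + 1) else 0) ∧
    natPhi ε φ ((decWord g n).map ι) = (if k + 1 ≤ n then g k else 0) := by
  induction n with
  | zero => simp [decWord, natEps, natPhi]
  | succ n ih =>
    rw [decWord, List.map_append, List.map_replicate, (h.replicate_values _ _ _).1,
      (h.replicate_values _ _ _).2, ih.1, ih.2]
    rcases lt_trichotomy n k with h1 | h1 | h1
    · rw [if_neg (by omega), if_neg (by omega), if_neg (by omega), if_neg (by omega),
        if_neg (by omega), if_neg (by omega)]
      simp
    · subst h1; simp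
    · rcases Nat.eq_or_lt_of_le (Nat.succ_le_of_lt h1) with h2 | h2
      · subst h2; simp
      · rw [if_neg (show n ≠ k + 1 by omega), if_neg (show n ≠ k by omega),
          if_pos (show k + 2 ≤ n by omega), if_pos (show k + 1 ≤ n by omega),
          if_pos (show k + 2 ≤ n + 1 by omega), if_pos (show k + 1 ≤ n + 1 by omega)]
        simp

/-- The operator changes the first letter k of the block. It becomes the last of the run of letters
k+1, so the block stays decreasing and is again the block of a matrix row. -/
theorem LetterArrow.wordF_decWord (h : LetterArrow C ε φ ι i k) (g g' : ℕ → ℕ) (n : ℕ)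
    (hn : k + 2 ≤ n) (hk : g' k + 1 = g k) (hk' : g' (k + 1) = g (k + 1) + 1)
    (hg : ∀ j, j ≠ k → j ≠ k + 1 → g' j = g j) :
    wordF C i ((decWord g n).map ι) = some ((decWord g' n).map ι) := by
  induction n, hn using Nat.le_induction with
  | base =>
    simp only [decWord, List.map_append, List.map_replicate]
    rw [h.semi.wordF_append, if_neg, ← hk, List.replicate_succ, List.cons_append,
      h.semi.wordF_cons, if_pos, h.f, hk', List.replicate_succ',
      decWord_congr k fun j hj => hg j (by omega) (by omega)]
    · simp
    · rw [(h.replicate_values _ _ _).1, (h.decWord_values _ _).1, h.phi]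
      simp
    · have := (h.replicate_values (g (k + 1)) (k + 1) []).2
      rw [List.append_nil] at this
      rw [this]
      simp [natPhi]
  | succ n hn ih =>
    rw [decWord, List.map_append, List.map_replicate, h.semi.wordF_append, if_neg, ih, decWord,
      List.map_append, List.map_replicate, hg n (by omega) (by omega)]
    · rfl
    · have := (h.replicate_values (g n) n []).2
      rw [List.append_nil] at this
      rw [this, if_neg (by omega)]
      simp [natPhi]

theorem LetterArrow.natEps_lexWord (h : LetterArrow C ε φ ι i k) (A : Mat) (F : ℕ → ℕ) (T : ℕ)
    (hF : ∀ r, F r = A (r, k + 1) + (F (r + 1) - A (r, k))) (hT : ∀ r, T ≤ r → F r = 0) :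
    natEps ε φ (lexWord ι A) = F 0 := by
  obtain ⟨N, hN⟩ := exists_bound A
  -- The bound exceeds the support of A, the index T from which F vanishes, and both letters k and
  -- k+1.
  rw [lexWord_eq ι A (N + T + k + 2) fun i j hij => hN i j (by omega)]
  refine natEps_flatMap _ F _ 0 (hT _ (by omega)) fun c _ _ => ?_
  rw [(h.decWord_values _ _).1, (h.decWord_values _ _).2, if_pos (by omega), if_pos (by omega)]
  exact hF c

theorem LetterArrow.wordF_lexWord_none (h : LetterArrow C ε φ ι i k) (A : Mat) (F : ℕ → ℕ) (T : ℕ)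
    (hF : ∀ r, F r = A (r, k + 1) + (F (r + 1) - A (r, k))) (hT : ∀ r, T ≤ r → F r = 0)
    (hn : ∀ r, A (r, k) ≤ F (r + 1)) : wordF C i (lexWord ι A) = none := by
  obtain ⟨N, hN⟩ := exists_bound A
  rw [lexWord_eq ι A (N + T + k + 2) fun i j hij => hN i j (by omega)]
  refine h.semi.wordF_flatMap_none _ F _ 0 (hT _ (by omega)) (fun c _ _ => ?_) fun c _ _ => ?_
  · rw [(h.decWord_values _ _).1, (h.decWord_values _ _).2, if_pos (by omega), if_pos (by omega)]
    exact hF c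
  · rw [(h.decWord_values _ _).2, if_pos (by omega)]
    exact hn c

/-- The second conclusion says that the other line of the biword is untouched; it is what allows A'
to be recovered from its word together with the biword of A. -/
theorem LetterArrow.wordF_lexWord_some (h : LetterArrow C ε φ ι i k) (A A' : Mat) (F : ℕ → ℕ)
    (T : ℕ) (hF : ∀ r, F r = A (r, k + 1) + (F (r + 1) - A (r, k))) (hT : ∀ r, T ≤ r → F r = 0)
    (r₀ : ℕ) (hr₀ : F (r₀ + 1) < A (r₀, k)) (hlt : ∀ r, r < r₀ → A (r, k) ≤ F (r + 1))
    (hk : A' (r₀, k) + 1 = A (r₀, k)) (hk' : A' (r₀, k + 1) = A (r₀, k + 1) + 1)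
    (hA : ∀ r j, ¬ (r = r₀ ∧ (j = k ∨ j = k + 1)) → A' (r, j) = A (r, j)) :
    wordF C i (lexWord ι A) = some (lexWord ι A') ∧
    (biwordByRow A').map (fun c => (ofLex c).1) = (biwordByRow A).map fun c => (ofLex c).1 := by
  obtain ⟨N, hN⟩ := exists_bound A
  obtain ⟨N', hN'⟩ := exists_bound A'
  have b1 : ∀ i j, N + N' + T + r₀ + k + 2 ≤ i ∨ N + N' + T + r₀ + k + 2 ≤ j → A (i, j) = 0 :=
    fun i j hij => hN i j (by omega)
  have b2 : ∀ i j, N + N' + T + r₀ + k + 2 ≤ i ∨ N + N' + T + r₀ + k + 2 ≤ j → A' (i, j) = 0 :=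
    fun i j hij => hN' i j (by omega)
  have hblock := h.wordF_decWord (fun j => A (r₀, j)) (fun j => A' (r₀, j))
    (N + N' + T + r₀ + k + 2) (by omega) hk hk' fun j h1 h2 => hA r₀ j (by tauto)
  have hother : ∀ r, r ≠ r₀ → (fun j => A' (r, j)) = fun j => A (r, j) := fun r hr =>
    funext fun j => hA r j (by tauto)
  constructor
  · rw [lexWord_eq ι A _ b1, lexWord_eq ι A' _ b2]
    rw [h.semi.wordF_flatMap_some _ F (N + N' + T + r₀ + k + 2) 0 (hT _ (by omega)) ?_ r₀
      (by omega) (by omega) ?_ ?_ _ hblock]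
    · congr 1
      refine List.flatMap_congr fun r _ => ?_
      by_cases hr : r = r₀
      · subst hr; rw [Function.update_self]
      · rw [Function.update_of_ne hr, hother r hr]
    · intro c _ _
      rw [(h.decWord_values _ _).1, (h.decWord_values _ _).2, if_pos (by omega),
        if_pos (by omega)]
      exact hF c
    · rw [(h.decWord_values _ _).2, if_pos (by omega)]
      exact hr₀
    · intro c _ hc
      rw [(h.decWord_values _ _).2, if_pos (by omega)]
      exact hlt c hc
  · rw [biwordByRow_fst_eq A _ b1, biwordByRow_fst_eq A' _ b2]
    refine List.flatMap_congr fun r _ => ?_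
    by_cases hr : r = r₀
    · subst hr
      -- Row r₀ keeps its sum because the operator preserves the length of a word.
      have hlen : ∀ (w w' : List NZ), wordF C i w = some w' → w'.length = w.length := by
        intro w
        induction w with
        | nil => intro w' hw; simp [wordF] at hw
        | cons b w ih =>
          intro w' hw
          rw [h.semi.wordF_cons] at hw
          split_ifs at hw
          · obtain ⟨b', -, rfl⟩ := Option.map_eq_some_iff.mp hw
            simp
          · obtain ⟨v, hv, rfl⟩ := Option.map_eq_some_iff.mp hw
            simp [ih v hv]
      have := hlen _ _ hblock
      rw [List.length_map, List.length_map] at this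
      rw [this]
    · rw [hother r hr]

end LetterArrow

theorem zip_biword (A : Mat) (ι : ℕ → NZ) (hι : ∀ j, idx (ι j) = j) :
    matOfList (List.zip ((biwordByRow A).map fun c => (ofLex c).1) ((lexWord ι A).map idx)) = A := by
  have h1 : List.zip ((biwordByRow A).map fun c => (ofLex c).1) ((lexWord ι A).map idx) =
      (biwordByRow A).map fun c => ((ofLex c).1, OrderDual.ofDual (ofLex c).2) := by
    rw [lexWord, List.map_map, ← List.zip_map']
    congr 1
    refine List.map_congr_left fun c _ => ?_
    exact hι _
  rw [matOfList, h1, ← Multiset.map_coe, biwordByRow, Multiset.sort_eq, Multiset.map_map]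
  rw [Multiset.toFinsupp_eq_iff]
  exact Multiset.map_id' _

/-- The transposed matrix. -/
def transposeMat (A : Mat) : Mat := A.mapDomain Prod.swap

theorem transposeMat_apply (A : Mat) (i j : ℕ) : transposeMat A (i, j) = A (j, i) :=
  Finsupp.mapDomain_apply Prod.swap_injective A (j, i)

theorem biwordByCol_eq (A : Mat) : biwordByCol A = biwordByRow (transposeMat A) := by
  rw [biwordByCol, biwordByRow, transposeMat, ← Finsupp.toMultiset_map, Multiset.map_map]
  rfl

theorem colWord_eq (A : Mat) : colWord A = lexWord pos A := rfl

theorem rowWord_eq (A : Mat) : rowWord A = lexWord neg (transposeMat A) := by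
  rw [rowWord, biwordByCol_eq, lexWord]

theorem idx_pos (j : ℕ) : idx (pos j) = j := by simp only [idx, pos]; omega

theorem idx_neg (j : ℕ) : idx (neg j) = j := by simp only [idx, neg]; omega

theorem replaceCols_eq (A A' : Mat) (h : (biwordByRow A').map (fun c => (ofLex c).1) =
    (biwordByRow A).map fun c => (ofLex c).1) : replaceCols A (colWord A') = A' := by
  rw [replaceCols, ← h, colWord_eq, zip_biword A' pos idx_pos]

/-- Reduces to `zip_biword` for the transposed matrix; swapping the two lines of the biword is
transposition. -/
theorem replaceRows_eq (A A' : Mat)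
    (h : (biwordByRow (transposeMat A')).map (fun c => (ofLex c).1) =
      (biwordByRow (transposeMat A)).map fun c => (ofLex c).1) :
    replaceRows A (rowWord A') = A' := by
  have key := zip_biword (transposeMat A') neg idx_neg
  rw [matOfList, Multiset.toFinsupp_eq_iff] at key
  rw [replaceRows, biwordByCol_eq, ← h, rowWord_eq, matOfList, Multiset.toFinsupp_eq_iff,
    ← List.zip_swap, ← Multiset.map_coe, key, Finsupp.toMultiset_map]
  congr 1
  ext ⟨i, j⟩
  change transposeMat (transposeMat A') (i, j) = A' (i, j)
  rw [transposeMat_apply, transposeMat_apply]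

theorem pos_letterArrow (k : ℕ) : LetterArrow natural (fun b => if b = hi (k + 1) then 1 else 0)
    (fun b => if b = lo (k + 1) then 1 else 0) pos (k + 1) k := by
  have h1 : lo ((k : ℤ) + 1) = pos k := by
    refine Subtype.ext ?_
    simp only [lo, pos]; rw [if_neg (by omega)]
  have h2 : hi ((k : ℤ) + 1) = pos (k + 1) := by
    refine Subtype.ext ?_
    simp only [hi, pos]; rw [if_neg (by omega)]; push_cast; rfl
  have h3 : ∀ a b : ℕ, pos a = pos b ↔ a = b := by
    intro a b
    rw [← Subtype.coe_inj]; simp only [pos]; omega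
  refine ⟨natural_seminormal _, fun j => ?_, fun j => ?_, ?_⟩
  · simp only [h2, h3]
  · simp only [h1, h3]
  · simp only [natural, h1, h2, if_true]

theorem neg_letterArrow (k : ℕ) : LetterArrow natural.dual
    (fun b => if b = lo (-(k + 1)) then 1 else 0)
    (fun b => if b = hi (-(k + 1)) then 1 else 0) neg (-(k + 1)) k := by
  have h1 : hi (-((k : ℤ) + 1)) = neg k := by
    refine Subtype.ext ?_
    simp only [hi, neg]; rw [if_pos (by omega)]
  have h2 : lo (-((k : ℤ) + 1)) = neg (k + 1) := by
    refine Subtype.ext ?_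
    simp only [lo, neg]; rw [if_pos (by omega)]; push_cast; ring
  have h3 : ∀ a b : ℕ, neg a = neg b ↔ a = b := by
    intro a b
    rw [← Subtype.coe_inj]; simp only [neg]; omega
  refine ⟨(natural_seminormal _).dual, fun j => ?_, fun j => ?_, ?_⟩
  · simp only [h2, h3]
  · simp only [h1, h3]
  · simp only [CrystalData.dual, natural, h1, h2, if_true]

end GlInf

end

/-! ### Signatures of semi-infinite words and of partitions. -/

noncomputable section

namespace GlInf

open CrystalData

namespace SemiInf

theorem occurs_unique (w : SemiInf) {i j : ℕ} (h : w.toFun i = w.toFun j) : i = j :=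
  w.anti.injective h

open Classical in
theorem mult_eq (w : SemiInf) (k : NZ) :
    w.mult k = (if w.Occurs k then 1 else 0) - if (k : ℤ) < 0 then 1 else 0 := by
  rw [mult]
  congr 1
  split_ifs with h
  · obtain ⟨j, hj⟩ := h
    have : {j | w.toFun j = k} = {j} := by
      ext j'
      exact ⟨fun h => w.occurs_unique (h.trans hj.symm), fun h => h ▸ hj⟩
    rw [this, Set.ncard_singleton]; rfl
  · have : {j | w.toFun j = k} = ∅ := by
      ext j
      exact ⟨fun hj => h ⟨j, hj⟩, fun h => h.elim⟩
    rw [this, Set.ncard_empty]; rfl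

theorem occurs_replace (w : SemiInf) (a b : NZ)
    (hab : ∀ k : NZ, k ≠ a → k ≠ b → (k < a ↔ k < b)) (hb : ¬ w.Occurs b) (ha : w.Occurs a)
    (hne : a ≠ b) (k : NZ) : (w.replace a b hab hb).Occurs k ↔ k = b ∨ k ≠ a ∧ w.Occurs k := by
  constructor
  · rintro ⟨j, hj⟩
    simp only [replace] at hj
    split_ifs at hj with h
    · exact Or.inl hj.symm
    · exact Or.inr ⟨fun h1 => h (hj.trans h1), j, hj⟩
  · rintro (rfl | ⟨h1, j, hj⟩)
    · obtain ⟨j, hj⟩ := ha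
      exact ⟨j, by simp [replace, hj]⟩
    · exact ⟨j, by simp [replace, hj, h1]⟩

end SemiInf

open Classical in
theorem fock_seminormal (i : ℤ) :
    fock.Seminormal i (fun w => if w.Occurs (hi i) ∧ ¬ w.Occurs (lo i) then 1 else 0)
      (fun w => if w.Occurs (lo i) ∧ ¬ w.Occurs (hi i) then 1 else 0) where
  eps_eq w := by simp only [fock]; split_ifs <;> rfl
  phi_eq w := by simp only [fock]; split_ifs <;> rfl
  pair w := by
    have h1 : ((lo i : NZ) : ℤ) < 0 ↔ i ≤ 0 := by simp only [lo]; split_ifs <;> omega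
    have h2 : ((hi i : NZ) : ℤ) < 0 ↔ i < 0 := by simp only [hi]; split_ifs <;> omega
    simp only [fock, pairing, Finsupp.ofSupportFinite_coe, SemiInf.mult_eq, h1, h2]
    by_cases a1 : w.Occurs (lo i) <;> by_cases a2 : w.Occurs (hi i) <;>
      simp only [a1, a2, not_true, not_false_eq_true, and_true, and_false, if_true, if_false] <;>
      split_ifs <;> push_cast <;> omega
  f_some w w' h := by
    simp only [fock] at h
    split_ifs at h with h1
    obtain rfl := Option.some.inj h
    have hocc := w.occurs_replace (lo i) (hi i) (lo_hi_adjacent i) h1.2 h1.1 (lo_ne_hi i)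
    have h2 := (hocc (hi i)).mpr (Or.inl rfl)
    have h3 : ¬ (w.replace (lo i) (hi i) (lo_hi_adjacent i) h1.2).Occurs (lo i) := by
      rw [hocc]
      rintro (h | h)
      · exact lo_ne_hi i h
      · exact h.1 rfl
    refine ⟨?_, ?_, ?_⟩
    · rw [if_pos ⟨h2, h3⟩, if_neg fun h => h1.2 h.1]
    · rw [if_pos h1, if_neg fun h => h3 h.1]
    · refine Prod.ext ?_ rfl
      ext k
      simp only [fock, Prod.fst_sub, Finsupp.sub_apply, Finsupp.ofSupportFinite_coe,
        SemiInf.mult_eq, hocc, simpleRoot, epsW, Finsupp.single_apply]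
      by_cases k1 : k = lo i
      · subst k1
        simp [lo_ne_hi, (lo_ne_hi i).symm, h1.1]
      · by_cases k2 : k = hi i
        · subst k2
          simp [lo_ne_hi, (lo_ne_hi i).symm, h1.2]
          ring
        · simp [k1, k2, Ne.symm k1, Ne.symm k2]
  f_iff_e w w' := by
    -- Replacing a by b can be undone by replacing b by a; stated for arbitrary a, b so that it
    -- serves both directions.
    have key : ∀ (w w' : SemiInf) (a b : NZ) (h1 : ∀ k : NZ, k ≠ a → k ≠ b → (k < a ↔ k < b))
        (h2 : ∀ k : NZ, k ≠ b → k ≠ a → (k < b ↔ k < a)), a ≠ b →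
        (h : w.Occurs a ∧ ¬ w.Occurs b) → w' = w.replace a b h1 h.2 →
        ∃ h' : w'.Occurs b ∧ ¬ w'.Occurs a, w = w'.replace b a h2 h'.2 := by
      rintro w w' a b h1 h2 hne h rfl
      have hocc := w.occurs_replace a b h1 h.2 h.1 hne
      have h' : (w.replace a b h1 h.2).Occurs b ∧ ¬ (w.replace a b h1 h.2).Occurs a := by
        rw [hocc, hocc]
        refine ⟨Or.inl rfl, ?_⟩
        rintro (h | h)
        · exact hne h
        · exact h.1 rfl
      refine ⟨h', SemiInf.ext (funext fun j => ?_)⟩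
      have h4 : w.toFun j ≠ b := fun h4 => h.2 ⟨j, h4⟩
      by_cases h3 : w.toFun j = a
      · simp [SemiInf.replace, h3]
      · simp [SemiInf.replace, h3, h4]
    simp only [fock]
    constructor
    · intro h
      split_ifs at h with h1
      obtain ⟨h2, h3⟩ := key w w' _ _ (lo_hi_adjacent i)
        (fun k h1 h2 => (lo_hi_adjacent i k h2 h1).symm) (lo_ne_hi i) h1 (Option.some.inj h).symm
      rw [dif_pos h2, ← h3]
    · intro h
      split_ifs at h with h1
      obtain ⟨h2, h3⟩ := key w' w _ _ (fun k h1 h2 => (lo_hi_adjacent i k h2 h1).symm)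
        (lo_hi_adjacent i) (lo_ne_hi i).symm h1 (Option.some.inj h).symm
      rw [dif_pos h2, ← h3]
  e_none w := by simp only [fock]; split_ifs <;> simp
  f_none w := by simp only [fock]; split_ifs <;> simp

/-! ### Partitions as semi-infinite words -/

theorem skipZero_injective : Function.Injective skipZero := by
  intro a b h
  have := congrArg Subtype.val h
  simp only [skipZero] at this
  split_ifs at this <;> omega

theorem lo_eq (i : ℤ) : lo i = skipZero (i - 1) := by
  refine Subtype.ext ?_
  simp only [lo, skipZero]
  split_ifs <;> omega

theorem hi_eq (i : ℤ) : hi i = skipZero i := by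
  refine Subtype.ext ?_
  simp only [hi, skipZero]

theorem occurs_lo_iff (μ : YoungDiagram) (i : ℤ) :
    (ofPartition μ).Occurs (lo i) ↔ ∃ r : ℕ, (μ.rowLen r : ℤ) = r + i := by
  rw [lo_eq]
  refine exists_congr fun r => ?_
  simp only [ofPartition, skipZero_injective.eq_iff]
  omega

theorem occurs_hi_iff (μ : YoungDiagram) (i : ℤ) :
    (ofPartition μ).Occurs (hi i) ↔ ∃ r : ℕ, (μ.rowLen r : ℤ) = r + 1 + i := by
  rw [hi_eq]
  refine exists_congr fun r => ?_
  simp only [ofPartition, skipZero_injective.eq_iff]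
  omega

theorem ofPartition_injective : Function.Injective ofPartition := by
  intro μ ν h
  ext ⟨i, j⟩
  have h1 := congrArg (fun w => w.toFun i) h
  simp only [ofPartition] at h1
  have h2 := skipZero_injective h1
  rw [YoungDiagram.mem_cells, YoungDiagram.mem_cells, YoungDiagram.mem_iff_lt_rowLen,
    YoungDiagram.mem_iff_lt_rowLen]
  omega

/-- The letters `lo i`, `hi i` of a partition in terms of the first cell outside of the partition
on the diagonal of residue `i`. -/
theorem occurs_iff_of_diagonal (μ : YoungDiagram) (i : ℤ) (a b : ℕ) (hab : (b : ℤ) = a + i)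
    (hnot : (a, b) ∉ μ) (hprev : ∀ a' b', a = a' + 1 → b = b' + 1 → (a', b') ∈ μ) :
    ((ofPartition μ).Occurs (lo i) ↔ ∀ b', b = b' + 1 → (a, b') ∈ μ) ∧
    ((ofPartition μ).Occurs (hi i) ↔ ¬ ∀ a', a = a' + 1 → (a', b) ∈ μ) := by
  simp only [YoungDiagram.mem_iff_lt_rowLen, not_lt] at *
  constructor
  · rw [occurs_lo_iff]
    constructor
    · rintro ⟨r, hr⟩ b' rfl
      rcases lt_trichotomy r a with h | rfl | h
      · obtain ⟨a', rfl⟩ : ∃ a', a = a' + 1 := ⟨a - 1, by omega⟩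
        have h1 := hprev a' b' rfl rfl
        have h2 := μ.rowLen_anti r a' (by omega)
        omega
      · omega
      · have h2 := μ.rowLen_anti a r h.le
        omega
    · intro h
      refine ⟨a, ?_⟩
      rcases Nat.eq_zero_or_pos b with rfl | hb
      · omega
      · have := h (b - 1) (by omega)
        omega
  · rw [occurs_hi_iff]
    constructor
    · rintro ⟨r, hr⟩ h
      rcases Nat.lt_or_ge r a with h1 | h1
      · obtain ⟨a', rfl⟩ : ∃ a', a = a' + 1 := ⟨a - 1, by omega⟩
        have h2 := h a' rfl
        have h3 := μ.rowLen_anti r a' (by omega)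
        rcases Nat.eq_or_lt_of_le (Nat.le_of_lt_succ h1) with rfl | h4
        · omega
        · omega
      · have h2 := μ.rowLen_anti a r h1
        omega
    · intro h
      push Not at h
      obtain ⟨a', rfl, h1⟩ := h
      refine ⟨a', ?_⟩
      rcases Nat.eq_zero_or_pos b with rfl | hb
      · omega
      · have := hprev a' (b - 1) rfl (by omega)
        omega

/-- Applying `f_i` to a partition adds a box of residue `i`. -/
theorem fock_f_ofPartition (μ μ' : YoungDiagram) (i : ℤ) (a b : ℕ) (hab : (b : ℤ) = a + i)
    (hnot : (a, b) ∉ μ) (hμ : ∀ c, c ∈ μ' ↔ c = (a, b) ∨ c ∈ μ) :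
    fock.f i (ofPartition μ) = some (ofPartition μ') := by
  have hrow : ∀ r, μ'.rowLen r = if r = a then b + 1 else μ.rowLen r := by
    intro r
    refine eq_of_forall_lt_iff fun j => ?_
    have h1 := hμ (r, j)
    rw [YoungDiagram.mem_iff_lt_rowLen, YoungDiagram.mem_iff_lt_rowLen, Prod.mk.injEq] at h1
    have h2 := hμ (a, b)
    rw [YoungDiagram.mem_iff_lt_rowLen] at h2
    have h3 : b < μ'.rowLen a := h2.mpr (Or.inl rfl)
    rw [YoungDiagram.mem_iff_lt_rowLen] at hnot
    rw [h1]
    split_ifs with h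
    · subst h
      have h4 := hμ (r, j)
      rw [YoungDiagram.mem_iff_lt_rowLen, YoungDiagram.mem_iff_lt_rowLen, Prod.mk.injEq] at h4
      omega
    · tauto
  -- Since `μ'` is a Young diagram containing (a,b), the cell to the left of (a,b) lies in it and
  -- hence already in `μ`; so row a of `μ` ends exactly before b.
  have hra : μ.rowLen a = b := by
    rw [YoungDiagram.mem_iff_lt_rowLen] at hnot
    by_contra hne
    have h1 : (a, b - 1) ∈ μ' := by
      rw [YoungDiagram.mem_iff_lt_rowLen, hrow, if_pos rfl]; omega
    rcases (hμ _).mp h1 with h2 | h2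
    · rw [Prod.mk.injEq] at h2; omega
    · rw [YoungDiagram.mem_iff_lt_rowLen] at h2; omega
  have hcond : (ofPartition μ).Occurs (lo i) ∧ ¬ (ofPartition μ).Occurs (hi i) := by
    rw [occurs_lo_iff, occurs_hi_iff]
    refine ⟨⟨a, by omega⟩, ?_⟩
    rintro ⟨r, hr⟩
    rcases Nat.lt_or_ge r a with h1 | h1
    · have h2 := μ'.rowLen_anti r a h1.le
      rw [hrow, hrow, if_pos rfl, if_neg (by omega)] at h2
      omega
    · have h2 := μ.rowLen_anti a r h1
      omega
  simp only [fock]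
  rw [dif_pos hcond]
  congr 1
  refine SemiInf.ext (funext fun r => ?_)
  simp only [SemiInf.replace, ofPartition, lo_eq, hi_eq, skipZero_injective.eq_iff, hrow]
  by_cases h : r = a
  · subst h
    rw [if_pos (by omega), if_pos rfl]
    congr 1
    push_cast
    omega
  · rw [if_neg h, if_neg]
    intro h1
    rcases Nat.lt_or_ge r a with h2 | h2
    · have h3 := μ'.rowLen_anti r a h2.le
      rw [hrow, hrow, if_pos rfl, if_neg h] at h3
      omega
    · have h3 := μ.rowLen_anti a r h2
      omega

theorem ofPartition_bot : ofPartition ⊥ = SemiInf.H := by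
  refine SemiInf.ext (funext fun r => Subtype.ext ?_)
  have h : (⊥ : YoungDiagram).rowLen r = 0 := by
    by_contra h
    exact YoungDiagram.notMem_bot (r, 0)
      (YoungDiagram.mem_iff_lt_rowLen.mpr (Nat.pos_of_ne_zero h))
  simp only [ofPartition, SemiInf.H, skipZero, neg, h]
  split_ifs <;> omega

theorem fock_wt_H : fock.wt SemiInf.H = Lam0 := by
  refine Prod.ext ?_ rfl
  ext k
  have hocc : SemiInf.H.Occurs k ↔ (k : ℤ) < 0 := by
    constructor
    · rintro ⟨j, rfl⟩
      simp only [SemiInf.H, neg]; omega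
    · intro h
      refine ⟨(-(k : ℤ) - 1).toNat, Subtype.ext ?_⟩
      simp only [SemiInf.H, neg]; omega
  classical
  simp only [fock, Finsupp.ofSupportFinite_coe, SemiInf.mult_eq, hocc, Lam0, sub_self,
    Finsupp.coe_zero, Pi.zero_apply]

end GlInf

end

noncomputable section

namespace GlInf

open CrystalData

/-! ### The signature of a diagonal -/

/-- A word with letters of types `+`, `-`, `0`, in which the type of the letter number `c` is read off
from the interval of the sequence `m` that contains `c`; `e` and `p` count the letters `-` and
`+`, and `F` is `ε` of the tails. -/
structure DiagonalWord (m P Q : ℕ → ℕ) (N : ℕ) (e p F : ℕ → ℕ) : Prop where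
  le_P : ∀ t, m t ≤ P t
  P_zero : P 0 ≤ N
  P_le : ∀ t, P (t + 1) ≤ m t
  le_Q : ∀ t, m (t + 1) ≤ Q t
  Q_le : ∀ t, Q t ≤ m t
  finite : ∃ T, m T = 0
  F_end : F N = 0
  F_step : ∀ c, c < N → F c = e c + (F (c + 1) - p c)
  first : ∀ c, m 0 ≤ c → c < N → p c = (if c < P 0 then 1 else 0) ∧ e c = 0
  other : ∀ t c, m (t + 1) ≤ c → c < m t →
    p c = (if c < P (t + 1) ∧ c < Q t then 1 else 0) ∧
    e c = (if P (t + 1) ≤ c ∧ Q t ≤ c then 1 else 0)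

namespace DiagonalWord

variable {m P Q e p F : ℕ → ℕ} {N : ℕ}

theorem m_le (h : DiagonalWord m P Q N e p F) (t : ℕ) : m t ≤ N := by
  induction t with
  | zero => exact (h.le_P 0).trans h.P_zero
  | succ t ih => exact ((h.le_Q t).trans (h.Q_le t)).trans ih

theorem F_first (h : DiagonalWord m P Q N e p F) (c : ℕ) (hc : m 0 ≤ c) (hcN : c ≤ N) :
    F c = 0 := by
  induction hcN using Nat.decreasingInduction with
  | self => exact h.F_end
  | of_succ c hlt ih =>
    have h1 := h.first c hc hlt
    rw [h.F_step c hlt, h1.2, ih (by omega)]; omega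

/-- The letters with m (t+1) ≤ c < m t read + up to min(P (t+1), Q t), then 0, then - from max(P
(t+1), Q t). The strip has P (t+1) - m (t+1) signs + and m t - Q t signs - there; any surplus is an
equal number of both, which cancels. Going through the intervals from the end of the word gives ε of
every tail. -/
theorem F_formula (h : DiagonalWord m P Q N e p F) (t : ℕ) :
    F (m t) = stripEps P m Q t - (P t - m t) ∧
    ∀ c, m (t + 1) ≤ c → c ≤ m t →
      F c = stripEps P m Q (t + 1) - (max (P (t + 1)) c - min c (Q t)) := by
  have step : ∀ t, F (m t) = stripEps P m Q t - (P t - m t) → ∀ c, m (t + 1) ≤ c → c ≤ m t →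
      F c = stripEps P m Q (t + 1) - (max (P (t + 1)) c - min c (Q t)) := by
    intro t ht c hc hct
    have a1 := h.le_P (t + 1)
    have a2 := h.P_le t
    have a3 := h.le_Q t
    have a4 := h.Q_le t
    have a5 := h.m_le t
    have hE : stripEps P m Q (t + 1) = m t - Q t + (stripEps P m Q t - (P t - m t)) := rfl
    induction hct using Nat.decreasingInduction with
    | self => rw [ht, max_eq_right a2, min_eq_right a4]; omega
    | of_succ c hlt ih =>
      have h1 := h.other t c hc hlt
      rw [h.F_step c (by omega), h1.1, h1.2, ih (by omega)]
      rcases Nat.lt_or_ge c (P (t + 1)) with b1 | b1 <;>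
        rcases Nat.lt_or_ge c (Q t) with b2 | b2
      · rw [if_neg (by omega), if_pos ⟨b1, b2⟩, max_eq_left (by omega), max_eq_left (by omega),
          min_eq_left (by omega), min_eq_left (by omega)]
        omega
      · rw [if_neg (by omega), if_neg (by omega), max_eq_left (by omega), max_eq_left (by omega),
          min_eq_right (by omega), min_eq_right (by omega)]
        omega
      · rw [if_neg (by omega), if_neg (by omega), max_eq_right (by omega),
          max_eq_right (by omega), min_eq_left (by omega), min_eq_left (by omega)]
        omega
      · rw [if_pos ⟨b1, b2⟩, if_neg (by omega), max_eq_right (by omega),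
          max_eq_right (by omega), min_eq_right (by omega), min_eq_right (by omega)]
        omega
  have main : F (m t) = stripEps P m Q t - (P t - m t) := by
    induction t with
    | zero =>
      rw [h.F_first _ le_rfl (h.m_le 0), stripEps]; omega
    | succ t ih =>
      have a1 := h.le_P (t + 1)
      have a3 := h.le_Q t
      have a4 := h.Q_le t
      rw [step t ih _ le_rfl (by omega), max_eq_left (by omega), min_eq_left (by omega)]
  exact ⟨main, step t main⟩

/-- If the strip has no surviving + in the blocks from `t₀` on, then the individual letters
belonging to these blocks have none either. -/
theorem pass (h : DiagonalWord m P Q N e p F) (t₀ c : ℕ) (hc : c < N)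
    (hact : ∀ t, t₀ ≤ t → P t - m t ≤ stripEps P m Q t) (ht₀ : ∀ t, t < t₀ → c < m t) :
    p c ≤ F (c + 1) := by
  classical
  obtain ⟨T, hT⟩ := h.finite
  -- The least such t locates the interval of the sequence m that contains c.
  have hex : ∃ t, m t ≤ c := ⟨T, by omega⟩
  have h1 := Nat.find_spec hex
  have h2 : ∀ t, t < Nat.find hex → c < m t := fun t ht => not_le.mp (Nat.find_min hex ht)
  have h3 : t₀ ≤ Nat.find hex := by
    by_contra hlt
    have := ht₀ _ (not_le.mp hlt)
    omega
  generalize Nat.find hex = s at *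
  have h4 := hact s h3
  cases s with
  | zero =>
    rw [(h.first c h1 hc).1]
    simp only [stripEps] at h4
    have := h.le_P 0
    rw [if_neg (by omega)]
    omega
  | succ s =>
    have h5 := h2 s (by omega)
    rw [(h.other s c h1 h5).1]
    split_ifs with h6
    · rw [(h.F_formula s).2 (c + 1) (by omega) (by omega), max_eq_left (by omega),
        min_eq_left (by omega)]
      omega
    · omega

/-- Raising the entry m t by one means adding its cell to the layer whose number, counted from 0, is
m t. This is the letter on which the signature rule acts. -/
theorem acts (h : DiagonalWord m P Q N e p F) (t : ℕ) (ht : ActsAt P m Q t) :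
    m t < N ∧ p (m t) = 1 ∧ F (m t + 1) = 0 ∧ ∀ c, c < m t → p c ≤ F (c + 1) := by
  have h1 := ht.1
  have hlt : m t < N := by
    cases t with
    | zero => have := h.P_zero; omega
    | succ t => have := h.P_le t; have := h.m_le t; omega
  have hmono : ∀ s t, s ≤ t → m t ≤ m s := by
    intro s t hst
    induction t, hst using Nat.le_induction with
    | base => exact le_rfl
    | succ t _ ih => exact ((h.le_Q t).trans (h.Q_le t)).trans ih
  refine ⟨hlt, ?_, ?_, fun c hc => h.pass (t + 1) c (by omega) (fun s hs => ht.2 s hs) ?_⟩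
  · cases t with
    | zero => rw [(h.first _ le_rfl hlt).1, if_pos (by omega)]
    | succ t =>
      simp only [stripEps] at h1
      have := h.P_le t; have := h.Q_le t; have := h.le_Q t
      rw [(h.other t _ le_rfl (by omega)).1, if_pos (by omega)]
  · cases t with
    | zero => exact h.F_first _ (by omega) hlt
    | succ t =>
      have h2 := h1
      simp only [stripEps] at h2
      have := h.P_le t; have := h.Q_le t; have := h.le_Q t
      rw [(h.F_formula t).2 _ (by omega) (by omega), max_eq_left (by omega),
        min_eq_left (by omega)]
      omega
  · intro s hs
    have := hmono s t (by omega)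
    omega

theorem F_zero (h : DiagonalWord m P Q N e p F) : F 0 = eventual (stripEps P m Q) := by
  obtain ⟨T, hT⟩ := h.finite
  have hz : ∀ n, T ≤ n → m n = 0 := by
    intro n hn
    induction n, hn using Nat.le_induction with
    | base => exact hT
    | succ n _ ih => have := h.le_Q n; have := h.Q_le n; omega
  have hc : ∀ n, T + 1 ≤ n → stripEps P m Q n = stripEps P m Q (T + 1) := by
    intro n hn
    induction n, hn using Nat.le_induction with
    | base => rfl
    | succ n hn ih =>
      obtain ⟨n', rfl⟩ : ∃ n', n = n' + 1 := ⟨n - 1, by omega⟩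
      have h1 := hz (n' + 1) (by omega)
      have h2 := hz n' (by omega)
      have h3 := h.P_le n'
      rw [stripEps, ih, h1]
      omega
  rw [eventual_eq hc]
  have := hz (T + 1) (by omega)
  have h3 := h.P_le T
  have h4 := (h.F_formula (T + 1)).1
  rw [this] at h4
  rw [h4]
  omega

end DiagonalWord

/-- The term P 0 is irrelevant because the strip starts with ε = 0. Hence the number N of layers,
which enters only as P 0 on the main diagonal, does not influence ε. -/
theorem stripEps_congr {P P' m Q : ℕ → ℕ} (h : ∀ t, P (t + 1) = P' (t + 1)) : stripEps P m Q = stripEps P' m Q := by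
  funext t
  induction t with
  | zero => rfl
  | succ t ih =>
    rw [stripEps, stripEps, ih]
    cases t with
    | zero => simp [stripEps]
    | succ t => rw [h]

/-! ### The diagonals of a plane partition -/

namespace PlanePartition

/-- The cells of residue `k`. -/
def cell : ℤ → ℕ → ℕ × ℕ
  | .ofNat k, t => (t, t + k)
  | .negSucc k, t => (t + k + 1, t)

/-- The entries on the diagonal of residue `k`. -/
def diag (k : ℤ) (π : PlanePartition) (t : ℕ) : ℕ := π.entry (cell k t)

/-- The entries on the diagonal next to that of residue `k`, towards the main diagonal; the main
diagonal has the neighbour of residue `-1`, with a first entry equal to `N`. -/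
def diagIn (N : ℕ) : ℤ → PlanePartition → ℕ → ℕ
  | .ofNat 0, _, 0 => N
  | .ofNat 0, π, t + 1 => π.entry (t + 1, t)
  | .ofNat (k + 1), π, t => π.entry (t, t + k)
  | .negSucc k, π, t => π.entry (t + k, t)

/-- The entries on the diagonal next to that of residue `k`, away from the main diagonal. -/
def diagOut : ℤ → PlanePartition → ℕ → ℕ
  | .ofNat k, π, t => π.entry (t, t + k + 1)
  | .negSucc k, π, t => π.entry (t + k + 2, t)

/-- The word of layers. -/
def layerWord (N : ℕ) (π : PlanePartition) : List SemiInf :=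
  (List.range' 0 N).flatMap fun c => [ofPartition (π.layer c)]

theorem ofLayers_eq (N : ℕ) (π : PlanePartition) : ofLayers N π = (layerWord N π, ()) := by
  rw [ofLayers, layerWord, List.range_eq_range', List.map_eq_flatMap]

theorem mem_layer (π : PlanePartition) (c : ℕ) (x : ℕ × ℕ) : x ∈ π.layer c ↔ c < π.entry x := by
  rw [← YoungDiagram.mem_cells]
  simp only [layer, Finset.mem_filter, Finsupp.mem_support_iff]
  omega

theorem mem_shape (π : PlanePartition) (x : ℕ × ℕ) : x ∈ π.shape ↔ π.entry x ≠ 0 := by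
  rw [← YoungDiagram.mem_cells]
  simp only [shape, Finsupp.mem_support_iff]

theorem entry_le (π : PlanePartition) (x : ℕ × ℕ) : π.entry x ≤ π.entry (0, 0) :=
  π.antitone ⟨Nat.zero_le _, Nat.zero_le _⟩

theorem exists_bound (π : PlanePartition) : ∃ T, ∀ i j, T ≤ i ∨ T ≤ j → π.entry (i, j) = 0 :=
  GlInf.exists_bound π.entry

theorem layer_occurs (π : PlanePartition) (c : ℕ) (k : ℤ) (a b : ℕ) (hab : (b : ℤ) = a + k)
    (hnot : π.entry (a, b) ≤ c)
    (hprev : ∀ a' b', a = a' + 1 → b = b' + 1 → c < π.entry (a', b')) :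
    ((ofPartition (π.layer c)).Occurs (lo k) ↔ ∀ b', b = b' + 1 → c < π.entry (a, b')) ∧
    ((ofPartition (π.layer c)).Occurs (hi k) ↔ ¬ ∀ a', a = a' + 1 → c < π.entry (a', b)) := by
  have := occurs_iff_of_diagonal (π.layer c) k a b hab (by rw [mem_layer]; omega)
    (fun a' b' h1 h2 => (mem_layer ..).mpr (hprev a' b' h1 h2))
  simpa only [mem_layer] using this

open Classical in
/-- `ε_k` of a semi-infinite word. -/
def fockEps (k : ℤ) (w : SemiInf) : ℕ := if w.Occurs (hi k) ∧ ¬ w.Occurs (lo k) then 1 else 0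

open Classical in
/-- `φ_k` of a semi-infinite word. -/
def fockPhi (k : ℤ) (w : SemiInf) : ℕ := if w.Occurs (lo k) ∧ ¬ w.Occurs (hi k) then 1 else 0

theorem fock_semi (k : ℤ) : fock.Seminormal k (fockEps k) (fockPhi k) := fock_seminormal k

theorem layer_values (π : PlanePartition) (c : ℕ) (k : ℤ) {A B : Prop} [Decidable A] [Decidable B]
    (h : ((ofPartition (π.layer c)).Occurs (lo k) ↔ A) ∧
      ((ofPartition (π.layer c)).Occurs (hi k) ↔ ¬ B)) :
    fockPhi k (ofPartition (π.layer c)) = (if A ∧ B then 1 else 0) ∧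
    fockEps k (ofPartition (π.layer c)) = (if ¬ A ∧ ¬ B then 1 else 0) := by
  classical
  rw [fockPhi, fockEps, h.1, h.2]
  by_cases hA : A <;> by_cases hB : B <;> simp [hA, hB]

/-- `ε_k` of the tails of the word of layers. -/
def tailEps (k : ℤ) (N : ℕ) (π : PlanePartition) (c : ℕ) : ℕ :=
  natEps (fockEps k) (fockPhi k) ((List.range' c (N - c)).flatMap
    fun c => [ofPartition (π.layer c)])

theorem tailEps_step (k : ℤ) (N : ℕ) (π : PlanePartition) (c : ℕ) (hc : c < N) :
    tailEps k N π c = fockEps k (ofPartition (π.layer c)) +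
      (tailEps k N π (c + 1) - fockPhi k (ofPartition (π.layer c))) := by
  rw [tailEps, tailEps, show N - c = N - (c + 1) + 1 by omega, List.range'_succ,
    List.flatMap_cons, List.singleton_append, natEps]

/-- For m (t+1) ≤ c < m t, the first cell of residue k outside layer c is number t+1 of the
diagonal. Its two predecessors have entries P (t+1) and Q t, and the sign of the layer depends on
which of them belong to it. For c ≥ m 0 the cell is number 0, where a missing predecessor counts as
present. -/
theorem diagonalWord (k : ℤ) (N : ℕ) (π : PlanePartition) (hN : π.entry (0, 0) ≤ N) :
    DiagonalWord (diag k π) (diagIn N k π) (diagOut k π) N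
      (fun c => fockEps k (ofPartition (π.layer c)))
      (fun c => fockPhi k (ofPartition (π.layer c))) (tailEps k N π) := by
  obtain ⟨T, hT⟩ := π.exists_bound
  have anti : ∀ a b a' b', a ≤ a' → b ≤ b' → π.entry (a', b') ≤ π.entry (a, b) :=
    fun a b a' b' h1 h2 => π.antitone ⟨h1, h2⟩
  have hend : tailEps k N π N = 0 := by simp [tailEps, natEps]
  match k with
  | .ofNat 0 =>
    refine ⟨?_, ?_, ?_, ?_, ?_, ⟨T, hT _ _ (by omega)⟩, hend,
      fun c hc => tailEps_step _ N π c hc, ?_, ?_⟩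
    · rintro (_ | t)
      · simpa [diagIn, diag, cell] using hN
      · exact anti _ _ _ _ (by omega) (by omega)
    · simp [diagIn]
    · intro t; exact anti _ _ _ _ (by omega) (by omega)
    · intro t; exact anti _ _ _ _ (by omega) (by omega)
    · intro t; exact anti _ _ _ _ (by omega) (by omega)
    · intro c hc hcN
      have h1 := π.layer_values c (.ofNat 0) (A := True) (B := True) (by
        have := π.layer_occurs c (.ofNat 0) 0 0 (by simp) hc (fun a' b' h => by omega)
        simpa using this)
      rw [h1.1, h1.2]
      simp [diagIn, hcN]
    · intro t c hc hct
      have h1 := π.layer_values c (.ofNat 0) (A := c < π.entry (t + 1, t))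
        (B := c < π.entry (t, t + 1)) (by
        have := π.layer_occurs c (.ofNat 0) (t + 1) (t + 1) (by simp) hc (fun a' b' h1 h2 => by
          obtain rfl : t = a' := by omega
          obtain rfl : t = b' := by omega
          exact hct)
        simpa using this)
      rw [h1.1, h1.2]
      simp [diagIn, diagOut]
  | .ofNat (k + 1) =>
    refine ⟨?_, ?_, ?_, ?_, ?_, ⟨T, hT _ _ (by omega)⟩, hend,
      fun c hc => tailEps_step _ N π c hc, ?_, ?_⟩
    · intro t; exact anti _ _ _ _ (by omega) (by omega)
    · exact (π.entry_le _).trans hN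
    · intro t; exact anti _ _ _ _ (by omega) (by omega)
    · intro t; exact anti _ _ _ _ (by omega) (by omega)
    · intro t; exact anti _ _ _ _ (by omega) (by omega)
    · intro c hc hcN
      have h1 := π.layer_values c (.ofNat (k + 1)) (A := c < π.entry (0, k)) (B := True) (by
        have := π.layer_occurs c (.ofNat (k + 1)) 0 (0 + (k + 1)) (by simp) hc
          (fun a' b' h => by omega)
        simpa using this)
      rw [h1.1, h1.2]
      simp [diagIn]
    · intro t c hc hct
      have h1 := π.layer_values c (.ofNat (k + 1)) (A := c < π.entry (t + 1, t + 1 + k))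
        (B := c < π.entry (t, t + (k + 1) + 1)) (by
        have := π.layer_occurs c (.ofNat (k + 1)) (t + 1) (t + 1 + (k + 1)) (by simp) hc
          (fun a' b' h1 h2 => by
            obtain rfl : t = a' := by omega
            obtain rfl : b' = t + (k + 1) := by omega
            exact hct)
        rw [show t + (k + 1) + 1 = t + 1 + (k + 1) by omega]
        simpa [← add_assoc] using this)
      rw [h1.1, h1.2]
      simp only [diagIn, diagOut]
      constructor <;> (refine if_congr ?_ rfl rfl; omega)
  | .negSucc k =>
    refine ⟨?_, ?_, ?_, ?_, ?_, ⟨T, hT _ _ (by omega)⟩, hend,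
      fun c hc => tailEps_step _ N π c hc, ?_, ?_⟩
    · intro t; exact anti _ _ _ _ (by omega) (by omega)
    · exact (π.entry_le _).trans hN
    · intro t; exact anti _ _ _ _ (by omega) (by omega)
    · intro t; exact anti _ _ _ _ (by omega) (by omega)
    · intro t; exact anti _ _ _ _ (by omega) (by omega)
    · intro c hc hcN
      have h1 := π.layer_values c (.negSucc k) (A := True) (B := c < π.entry (k, 0)) (by
        have := π.layer_occurs c (.negSucc k) (0 + k + 1) 0 (by rw [Int.negSucc_eq]; simp) hc
          (fun a' b' _ h => by omega)
        simpa using this)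
      rw [h1.1, h1.2]
      simp [diagIn]
    · intro t c hc hct
      have h1 := π.layer_values c (.negSucc k) (A := c < π.entry (t + k + 2, t))
        (B := c < π.entry (t + 1 + k, t + 1)) (by
        have := π.layer_occurs c (.negSucc k) (t + 1 + k + 1) (t + 1)
          (by rw [Int.negSucc_eq]; push_cast; ring) hc
          (fun a' b' h1 h2 => by
            obtain rfl : t = b' := by omega
            obtain rfl : a' = t + k + 1 := by omega
            exact hct)
        rw [show t + k + 2 = t + 1 + k + 1 by omega]
        simpa using this)
      rw [h1.1, h1.2]
      simp only [diagIn, diagOut]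
      constructor <;> (refine if_congr ?_ rfl rfl; omega)

end PlanePartition

end GlInf

end

/-! ### The entry changed by a raising or lowering operator. -/

noncomputable section

namespace GlInf

open CrystalData

/-- The leftmost surviving + lies in the block with the greatest index that has any, since blocks
are read with decreasing index. -/
theorem exists_actsAt {P m Q : ℕ → ℕ} {T t : ℕ} (hT : ∀ s, T ≤ s → P s - m s = 0)
    (ht : stripEps P m Q t < P t - m t) : ∃ s, ActsAt P m Q s := by
  classical
  have hle : t ≤ T := by
    by_contra h
    have := hT t (by omega)
    omega
  refine ⟨Nat.findGreatest (fun s => stripEps P m Q s < P s - m s) T,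
    Nat.findGreatest_spec (P := fun s => stripEps P m Q s < P s - m s) hle ht, fun s hs => ?_⟩
  rcases Nat.lt_or_ge T s with h | h
  · have := hT s h.le
    omega
  · exact not_lt.mp (Nat.findGreatest_is_greatest
      (P := fun s => stripEps P m Q s < P s - m s) hs h)

/-- If `ε > 0` then the raising operator acts. -/
theorem exists_actsAt_pred {P m Q : ℕ → ℕ} {T : ℕ} (hP : ∀ s, m s ≤ P s)
    (hQ : ∀ s, m (s + 1) ≤ Q s) (hT : ∀ s, T ≤ s → P s - m s = 0)
    (hE : ∀ s, T ≤ s → 0 < stripEps P m Q s) :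
    ∃ t, Q t < m t ∧ P (t + 1) < m t ∧
      ∀ m', (∀ s, m s = m' s + if s = t then 1 else 0) → ActsAt P m' Q t := by
  classical
  -- In block t all - from the right are cancelled, and in no later block are they. So the rightmost
  -- surviving - lies in block t, and this entry is the one to be lowered.
  set t := Nat.findGreatest (fun s => stripEps P m Q s ≤ P s - m s) T
  have h1 : stripEps P m Q t ≤ P t - m t :=
    Nat.findGreatest_spec (P := fun s => stripEps P m Q s ≤ P s - m s) (Nat.zero_le T)
      (Nat.zero_le _)
  have h2 : ∀ s, t < s → P s - m s < stripEps P m Q s := by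
    intro s hs
    rcases Nat.lt_or_ge T s with h | h
    · have := hT s h.le
      have := hE s h.le
      omega
    · exact not_le.mp (Nat.findGreatest_is_greatest
        (P := fun s => stripEps P m Q s ≤ P s - m s) hs h)
  clear_value t
  have h3 := h2 (t + 1) (by omega)
  have a1 := hP t
  have a2 := hQ t
  have a3 := hP (t + 1)
  rw [stripEps] at h3
  refine ⟨t, by omega, by omega, fun m' hm' => ?_⟩
  have e1 : ∀ s, s ≤ t → stripEps P m' Q s = stripEps P m Q s := by
    intro s hs
    induction s with
    | zero => rfl
    | succ s ih =>
      have := hm' s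
      rw [if_neg (by omega)] at this
      rw [stripEps, stripEps, ih (by omega), this, add_zero]
  have hmt := hm' t
  rw [if_pos rfl] at hmt
  have e2 : ∀ s, t + 1 ≤ s → stripEps P m' Q s + 1 = stripEps P m Q s := by
    intro s hs
    induction s, hs using Nat.le_induction with
    | base => rw [stripEps, stripEps, e1 t le_rfl]; omega
    | succ s hs ih =>
      have b1 := hm' s
      rw [if_neg (by omega)] at b1
      have b2 := h2 s hs
      rw [stripEps, stripEps]
      omega
  refine ⟨by rw [e1 t le_rfl]; omega, fun s hs => ?_⟩
  have b1 := hm' s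
  rw [if_neg (by omega)] at b1
  have b2 := h2 s hs
  have b3 := e2 s hs
  omega

namespace PlanePartition

/-! ### The crystal graph on plane partitions -/

theorem diagIn_eq (N N' : ℕ) (k : ℤ) (π : PlanePartition) (t : ℕ) (h : k ≠ 0 ∨ t ≠ 0) :
    diagIn N k π t = diagIn N' k π t := by
  match k, t with
  | .ofNat 0, 0 => simp at h
  | .ofNat 0, t + 1 => rfl
  | .ofNat (k + 1), t => rfl
  | .negSucc k, t => rfl

/-- `ε_k` of the signature of the residue `k`, restricted to the first diagonal entries. -/
def strip (k : ℤ) (π : PlanePartition) : ℕ → ℕ :=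
  stripEps (diagIn (π.entry (0, 0) + 1) k π) (diag k π) (diagOut k π)

theorem strip_eq (N : ℕ) (k : ℤ) (π : PlanePartition) :
    stripEps (diagIn N k π) (diag k π) (diagOut k π) = strip k π :=
  stripEps_congr fun t => diagIn_eq _ _ k π _ (Or.inr (Nat.succ_ne_zero t))

/-- The lowering operator with index `k` acts on the diagonal entry number `t`. -/
def Acts (k : ℤ) (π : PlanePartition) (t : ℕ) : Prop :=
  ActsAt (diagIn (π.entry (0, 0) + 1) k π) (diag k π) (diagOut k π) t

/-- The number of layers matters only for the corner entry, where N has to leave room for one more.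
-/
theorem acts_iff (N : ℕ) (k : ℤ) (π : PlanePartition) (t : ℕ)
    (hN : k = 0 → t = 0 → π.entry (0, 0) < N) :
    ActsAt (diagIn N k π) (diag k π) (diagOut k π) t ↔ Acts k π t := by
  rw [Acts, ActsAt, ActsAt, strip_eq, ← strip]
  refine and_congr ?_ (forall_congr' fun s => forall_congr' fun hs => ?_)
  · by_cases h : k ≠ 0 ∨ t ≠ 0
    · rw [diagIn_eq _ _ k π t h]
    · obtain ⟨rfl, rfl⟩ : k = 0 ∧ t = 0 := by tauto
      have := hN rfl rfl
      change 0 < N - π.entry (0, 0) ↔ 0 < π.entry (0, 0) + 1 - π.entry (0, 0)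
      omega
  · rw [diagIn_eq _ _ k π s (Or.inr (by omega))]

/-- `ε_k` of a plane partition. -/
def planeEps (k : ℤ) (π : PlanePartition) : ℕ := eventual (strip k π)

/-- The arrows of the crystal graph. -/
def Arrow (k : ℤ) (π π' : PlanePartition) : Prop :=
  ∃ t, Acts k π t ∧ ∀ c, π'.entry c = π.entry c + if c = cell k t then 1 else 0

theorem natEps_layerWord (k : ℤ) (N : ℕ) (π : PlanePartition) (hN : π.entry (0, 0) ≤ N) :
    natEps (fockEps k) (fockPhi k) (layerWord N π) = planeEps k π := by
  rw [planeEps, ← strip_eq N, ← (diagonalWord k N π hN).F_zero]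
  rfl

theorem mem_cell_diagonal (k : ℤ) (t : ℕ) : ((cell k t).2 : ℤ) = (cell k t).1 + k := by
  match k with
  | .ofNat k => simp [cell]
  | .negSucc k => simp only [cell, Int.negSucc_eq]; push_cast; ring

theorem cell_eq_zero (k : ℤ) (t : ℕ) : cell k t = (0, 0) ↔ k = 0 ∧ t = 0 := by
  match k with
  | .ofNat k => simp [cell]; omega
  | .negSucc k => simp [cell]

theorem layer_congr {π π' : PlanePartition} {c : ℕ}
    (h : ∀ x, c < π'.entry x ↔ c < π.entry x) : π'.layer c = π.layer c := by
  refine YoungDiagram.ext (Finset.ext fun x => ?_)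
  rw [YoungDiagram.mem_cells, YoungDiagram.mem_cells, mem_layer, mem_layer, h]

theorem layerWord_injective {N : ℕ} {π π' : PlanePartition} (hπ : π.entry (0, 0) ≤ N)
    (hπ' : π'.entry (0, 0) ≤ N) (h : layerWord N π = layerWord N π') : π = π' := by
  have h1 : ∀ c, c < N → π.layer c = π'.layer c := by
    intro c hc
    rw [layerWord, layerWord, ← List.map_eq_flatMap, ← List.map_eq_flatMap,
      List.map_inj_left] at h
    exact ofPartition_injective (h c (by simp [hc]))
  refine PlanePartition.ext (Finsupp.ext fun x => ?_)
  refine eq_of_forall_lt_iff fun c => ?_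
  rcases Nat.lt_or_ge c N with hc | hc
  · rw [← mem_layer, ← mem_layer, h1 c hc]
  · have := π.entry_le x
    have := π'.entry_le x
    omega

theorem Arrow.entry_le_entry {k : ℤ} {π π' : PlanePartition} (h : Arrow k π π') (x : ℕ × ℕ) :
    π.entry x ≤ π'.entry x := by
  obtain ⟨t, -, h⟩ := h
  rw [h x]; omega

theorem Arrow.entry_le_succ {k : ℤ} {π π' : PlanePartition} (h : Arrow k π π') (x : ℕ × ℕ) :
    π'.entry x ≤ π.entry x + 1 := by
  obtain ⟨t, -, h⟩ := h
  rw [h x]; split_ifs <;> omega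

/-- The two words differ only in the layer numbered by the old entry, which gains the cell; by
`DiagonalWord.acts` this is the letter selected by the tensor product rule. -/
theorem Arrow.wordF {k : ℤ} {N : ℕ} {π π' : PlanePartition} (h : Arrow k π π')
    (hN : π'.entry (0, 0) ≤ N) : wordF fock k (layerWord N π) = some (layerWord N π') := by
  have hle := (h.entry_le_entry (0, 0)).trans hN
  obtain ⟨t, hact, hentry⟩ := h
  have hact' := (acts_iff N k π t fun h1 h2 => by
    have := hentry (0, 0)
    rw [if_pos ((cell_eq_zero k t).mpr ⟨h1, h2⟩).symm] at this
    omega).mpr hact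
  have hD := diagonalWord k N π hle
  obtain ⟨b1, b2, b3, b4⟩ := hD.acts t hact'
  have hphi : fockPhi k (ofPartition (π.layer (diag k π t))) = 1 := b2
  have hval : ∀ c, natEps (fockEps k) (fockPhi k) [ofPartition (π.layer c)] =
      fockEps k (ofPartition (π.layer c)) ∧
      natPhi (fockEps k) (fockPhi k) [ofPartition (π.layer c)] =
      fockPhi k (ofPartition (π.layer c)) := by
    intro c; simp [natEps, natPhi]
  have key := (fock_semi k).wordF_flatMap_some (fun c => [ofPartition (π.layer c)])
    (tailEps k N π) N 0 (by rw [zero_add]; exact hD.F_end)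
    (fun c _ hc => by
      rw [(hval c).1, (hval c).2]; exact hD.F_step c (by omega))
    (diag k π t) (Nat.zero_le _) (by omega)
    (by rw [(hval _).2, b3, hphi]; exact Nat.one_pos)
    (fun c _ hc => by rw [(hval c).2]; exact b4 c hc)
    [ofPartition (π'.layer (diag k π t))] (by
      rw [(fock_semi k).wordF_cons, if_pos (by rw [hphi, natEps]; exact Nat.one_pos),
        fock_f_ofPartition _ (π'.layer (diag k π t)) k _ _ (mem_cell_diagonal k t)]
      · rfl
      · rw [mem_layer]; exact lt_irrefl _
      · intro c
        rw [mem_layer, mem_layer, hentry]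
        by_cases h : c = cell k t
        · subst h; simp [diag]
        · simp [h])
  rw [layerWord, key, layerWord]
  congr 1
  refine List.flatMap_congr fun c hc => ?_
  by_cases h : c = diag k π t
  · subst h; rw [Function.update_self]
  · rw [Function.update_of_ne h]
    congr 2
    refine (layer_congr fun x => ?_).symm
    rw [hentry]
    split_ifs with h1
    · subst h1; simp only [diag] at h; omega
    · rfl

theorem diag_zero (k : ℤ) (π : PlanePartition) : ∃ T, 0 < T ∧ ∀ t, T ≤ t →
    diag k π t = 0 ∧ diagOut k π t = 0 ∧ ∀ N, diagIn N k π t = 0 := by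
  obtain ⟨T, hT⟩ := π.exists_bound
  refine ⟨T + 1, by omega, fun t ht => ?_⟩
  match k, t with
  | .ofNat 0, 0 => omega
  | .ofNat 0, t + 1 => exact ⟨hT _ _ (by omega), hT _ _ (by omega), fun N => hT _ _ (by omega)⟩
  | .ofNat (k + 1), t =>
    exact ⟨hT _ _ (by omega), hT _ _ (by omega), fun N => hT _ _ (by omega)⟩
  | .negSucc k, t => exact ⟨hT _ _ (by omega), hT _ _ (by omega), fun N => hT _ _ (by omega)⟩

theorem strip_const (k : ℤ) (π : PlanePartition) : ∃ T, 0 < T ∧ ∀ t, T ≤ t →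
    strip k π t = planeEps k π ∧ ∀ N, diagIn N k π t - diag k π t = 0 := by
  obtain ⟨T, h0, hT⟩ := diag_zero k π
  have hc : ∀ t, T ≤ t → strip k π t = strip k π T := by
    intro t ht
    induction t, ht using Nat.le_induction with
    | base => rfl
    | succ t ht ih =>
      rw [← ih]
      obtain ⟨h1, h2, h3⟩ := hT t ht
      rw [strip, stripEps, h1, h2, h3]
      omega
  refine ⟨T, h0, fun t ht => ⟨?_, fun N => by rw [(hT t ht).2.2 N]; omega⟩⟩
  rw [planeEps, eventual_eq hc, hc t ht]

/-- The neighbours of a cell. -/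
theorem diag_neighbours (k : ℤ) (π : PlanePartition) (N t i j : ℕ) :
    ((i, j + 1) = cell k t → π.entry (i, j) = diagIn N k π t ∨
      ∃ s, t = s + 1 ∧ π.entry (i, j) = diagOut k π s) ∧
    ((i + 1, j) = cell k t → π.entry (i, j) = diagIn N k π t ∨
      ∃ s, t = s + 1 ∧ π.entry (i, j) = diagOut k π s) ∧
    ((i, j) = cell k t → π.entry (i, j + 1) = diagOut k π t ∨
      π.entry (i, j + 1) = diagIn N k π (t + 1)) ∧
    ((i, j) = cell k t → π.entry (i + 1, j) = diagOut k π t ∨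
      π.entry (i + 1, j) = diagIn N k π (t + 1)) := by
  match k, t with
  | .ofNat 0, 0 =>
    simp only [cell, Prod.mk.injEq]
    refine ⟨by omega, by omega, ?_, ?_⟩
    · rintro ⟨rfl, rfl⟩; exact Or.inl rfl
    · rintro ⟨rfl, rfl⟩; exact Or.inr rfl
  | .ofNat 0, t + 1 =>
    simp only [cell, Prod.mk.injEq]
    refine ⟨?_, ?_, ?_, ?_⟩
    · rintro ⟨rfl, h⟩; obtain rfl : j = t := by omega
      exact Or.inl rfl
    · rintro ⟨h, rfl⟩; obtain rfl : i = t := by omega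
      exact Or.inr ⟨i, rfl, rfl⟩
    · rintro ⟨rfl, rfl⟩; exact Or.inl rfl
    · rintro ⟨rfl, rfl⟩; exact Or.inr rfl
  | .ofNat (k + 1), t =>
    simp only [cell, Prod.mk.injEq]
    refine ⟨?_, ?_, ?_, ?_⟩
    · rintro ⟨rfl, h⟩; obtain rfl : j = i + k := by omega
      exact Or.inl rfl
    · rintro ⟨rfl, rfl⟩
      refine Or.inr ⟨i, rfl, ?_⟩
      rw [diagOut]; congr 2; omega
    · rintro ⟨rfl, rfl⟩; exact Or.inl rfl
    · rintro ⟨rfl, rfl⟩; refine Or.inr ?_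
      rw [diagIn]; congr 2; omega
  | .negSucc k, t =>
    simp only [cell, Prod.mk.injEq]
    refine ⟨?_, ?_, ?_, ?_⟩
    · rintro ⟨rfl, rfl⟩
      refine Or.inr ⟨j, rfl, ?_⟩
      rw [diagOut]; congr 2; omega
    · rintro ⟨h, rfl⟩; obtain rfl : i = j + k := by omega
      exact Or.inl rfl
    · rintro ⟨rfl, rfl⟩; refine Or.inr ?_
      rw [diagIn]; congr 2; omega
    · rintro ⟨rfl, rfl⟩; exact Or.inl rfl

/-- The acting inequality forces both preceding neighbours to be strictly larger than the entry, so
the result is again a plane partition. -/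
theorem Acts.exists_arrow {k : ℤ} {π : PlanePartition} {t : ℕ} (h : Acts k π t) :
    ∃ π' : PlanePartition, Arrow k π π' ∧
      ∀ c, π'.entry c = π.entry c + if c = cell k t then 1 else 0 := by
  have hD := diagonalWord k (π.entry (0, 0) + 1) π (by omega)
  have hE := h.1
  have h1 : diag k π t < diagIn (π.entry (0, 0) + 1) k π t := by omega
  -- The strip before t contains at least m s - Q s signs -, while block t has at most m s - m t
  -- signs +. As the latter are more numerous, m t < Q s.
  have h2 : ∀ s, t = s + 1 → diag k π t < diagOut k π s := by
    rintro s rfl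
    rw [stripEps] at hE
    have := hD.le_Q s
    have := hD.P_le s
    omega
  have hentry : ∀ c, (π.entry + Finsupp.single (cell k t) 1 : ℕ × ℕ →₀ ℕ) c =
      π.entry c + if c = cell k t then 1 else 0 := by
    intro c
    rw [Finsupp.add_apply, Finsupp.single_apply]
    simp only [eq_comm]
  refine ⟨⟨π.entry + Finsupp.single (cell k t) 1, fun i j => ?_, fun i j => ?_⟩,
    ⟨t, h, hentry⟩, hentry⟩
  · rw [hentry, hentry]
    have := π.row i j
    by_cases hc : (i, j + 1) = cell k t
    · have h3 := (diag_neighbours k π (π.entry (0, 0) + 1) t i j).1 hc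
      have h4 : diag k π t = π.entry (i, j + 1) := by rw [diag, hc]
      rw [if_pos hc]
      rcases h3 with h3 | ⟨s, hs, h3⟩
      · omega
      · have := h2 s hs; omega
    · rw [if_neg hc]; omega
  · rw [hentry, hentry]
    have := π.col i j
    by_cases hc : (i + 1, j) = cell k t
    · have h3 := (diag_neighbours k π (π.entry (0, 0) + 1) t i j).2.1 hc
      have h4 : diag k π t = π.entry (i + 1, j) := by rw [diag, hc]
      rw [if_pos hc]
      rcases h3 with h3 | ⟨s, hs, h3⟩
      · omega
      · have := h2 s hs; omega
    · rw [if_neg hc]; omega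

theorem cell_injective (k : ℤ) : Function.Injective (cell k) := by
  intro s t h
  match k with
  | .ofNat k => simp only [cell, Prod.mk.injEq] at h; exact h.1
  | .negSucc k => simp only [cell, Prod.mk.injEq] at h; exact h.2

theorem diagIn_congr {π π' : PlanePartition} {k : ℤ} (N : ℕ)
    (h : ∀ c : ℕ × ℕ, (c.2 : ℤ) ≠ c.1 + k → π'.entry c = π.entry c) :
    diagIn N k π' = diagIn N k π ∧ diagOut k π' = diagOut k π := by
  constructor
  · funext t
    match k, t with
    | .ofNat 0, 0 => rfl
    | .ofNat 0, t + 1 => exact h _ (by simp)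
    | .ofNat (k + 1), t => exact h _ (by simp)
    | .negSucc k, t => exact h _ (by simp [Int.negSucc_eq]; omega)
  · funext t
    match k with
    | .ofNat k => exact h _ (by simp)
    | .negSucc k => exact h _ (by simp [Int.negSucc_eq]; omega)

theorem exists_arrow_of_pos {k : ℤ} {π : PlanePartition} (h : 0 < planeEps k π) :
    ∃ π', Arrow k π' π := by
  obtain ⟨T, -, hT⟩ := strip_const k π
  have hD := diagonalWord k (π.entry (0, 0) + 1) π (by omega)
  obtain ⟨t, h1, h2, h3⟩ := exists_actsAt_pred (Q := diagOut k π) hD.le_P hD.le_Q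
    (fun s hs => (hT s hs).2 _) (fun s hs => by have := (hT s hs).1; rw [strip] at this; omega)
  have hpos : 0 < π.entry (cell k t) := by
    change 0 < diag k π t
    omega
  have hentry : ∀ c, π.entry c = (π.entry - Finsupp.single (cell k t) 1 : ℕ × ℕ →₀ ℕ) c +
      if c = cell k t then 1 else 0 := by
    intro c
    rw [Finsupp.tsub_apply, Finsupp.single_apply]
    by_cases hc : c = cell k t
    · subst hc; simp only [if_true]; omega
    · rw [if_neg (fun h => hc h.symm), if_neg hc]; omega
  have row' : ∀ i j, (π.entry - Finsupp.single (cell k t) 1 : ℕ × ℕ →₀ ℕ) (i, j + 1) ≤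
      (π.entry - Finsupp.single (cell k t) 1 : ℕ × ℕ →₀ ℕ) (i, j) := by
    intro i j
    have a1 := hentry (i, j)
    have a2 := hentry (i, j + 1)
    have a3 := π.row i j
    by_cases hc : (i, j) = cell k t
    · have h4 := (diag_neighbours k π (π.entry (0, 0) + 1) t i j).2.2.1 hc
      have h5 : diag k π t = π.entry (i, j) := by rw [diag, hc]
      rw [if_pos hc] at a1
      omega
    · rw [if_neg hc] at a1
      omega
  have col' : ∀ i j, (π.entry - Finsupp.single (cell k t) 1 : ℕ × ℕ →₀ ℕ) (i + 1, j) ≤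
      (π.entry - Finsupp.single (cell k t) 1 : ℕ × ℕ →₀ ℕ) (i, j) := by
    intro i j
    have a1 := hentry (i, j)
    have a2 := hentry (i + 1, j)
    have a3 := π.col i j
    by_cases hc : (i, j) = cell k t
    · have h4 := (diag_neighbours k π (π.entry (0, 0) + 1) t i j).2.2.2 hc
      have h5 : diag k π t = π.entry (i, j) := by rw [diag, hc]
      rw [if_pos hc] at a1
      omega
    · rw [if_neg hc] at a1
      omega
  let π' : PlanePartition := ⟨π.entry - Finsupp.single (cell k t) 1, row', col'⟩
  have hentry' : ∀ c, π.entry c = π'.entry c + if c = cell k t then 1 else 0 := hentry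
  refine ⟨π', t, ?_, hentry'⟩
  have hcongr := diagIn_congr (π := π) (π' := π') (k := k) (π.entry (0, 0) + 1) fun c hc => by
    rw [hentry' c, if_neg, add_zero]
    rintro rfl
    exact hc (mem_cell_diagonal k t)
  rw [← acts_iff (π.entry (0, 0) + 1) k π' t fun _ _ => by have := hentry' (0, 0); omega,
    hcongr.1, hcongr.2]
  refine h3 _ fun s => ?_
  rw [diag, diag, hentry']
  simp only [(cell_injective k).eq_iff]

end PlanePartition

end GlInf

end

/-! ### The crystal of plane partitions in terms of arrows. -/

noncomputable section

namespace GlInf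

open CrystalData PlanePartition

/-! ### The tensor product with a one-element crystal -/

/-- As ε of t_μ is -∞, both operators act on the left factor; for f this needs φ to be finite,
because the comparison is strict. -/
theorem tensor_T {B : Type} (C : CrystalData B) (μ : Weight) (i : ℤ) (b : B) (u : Unit) {x : ℤ}
    (hphi : C.phi i b = (x : WithBot ℤ)) :
    (C.tensor (T μ)).eps i (b, u) = C.eps i b ∧
    (C.tensor (T μ)).phi i (b, u) = C.phi i b + ((pairing μ i : ℤ) : WithBot ℤ) ∧
    (C.tensor (T μ)).e i (b, u) = (C.e i b).map (fun b => (b, u)) ∧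
    (C.tensor (T μ)).f i (b, u) = (C.f i b).map (fun b => (b, u)) := by
  refine ⟨?_, ?_, ?_, ?_⟩
  · simp [tensor, T]
  · simp [tensor, T]
  · simp [tensor, T]
  · simp [tensor, T, hphi]

theorem layerCrystal_values (n : ℕ) (i : ℤ) (v : List SemiInf) (u : Unit) :
    (layerCrystal n).wt (v, u) = wordWt fock v - (n : ℤ) • Lam0 ∧
    (layerCrystal n).eps i (v, u) = ((natEps (fockEps i) (fockPhi i) v : ℤ) : WithBot ℤ) ∧
    (layerCrystal n).phi i (v, u) =
      ((pairing (wordWt fock v - (n : ℤ) • Lam0) i + natEps (fockEps i) (fockPhi i) v : ℤ) :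
        WithBot ℤ) ∧
    (layerCrystal n).e i (v, u) = (wordE fock i v).map (fun v => (v, ())) ∧
    (layerCrystal n).f i (v, u) = (wordF fock i v).map (fun v => (v, ())) := by
  have hs := (fock_semi i).words
  obtain ⟨h1, h2, h3, h4⟩ := tensor_T fock.words (-((n : ℤ) • Lam0)) i v u (hs.phi_eq v)
  refine ⟨(sub_eq_add_neg _ _).symm, h1.trans (hs.eps_eq v), h2.trans ?_, h3, h4⟩
  rw [hs.phi_eq, ← WithBot.coe_add, sub_eq_add_neg, pairing_add]
  have := hs.pair v
  change pairing (wordWt fock v) i = _ at this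
  rw [this]
  congr 1
  ring

namespace PlanePartition

theorem layer_eq_bot {π : PlanePartition} {c : ℕ} (hc : π.entry (0, 0) ≤ c) : π.layer c = ⊥ := by
  refine YoungDiagram.ext (Finset.ext fun x => ?_)
  have := π.entry_le x
  rw [YoungDiagram.mem_cells, mem_layer]
  simp only [YoungDiagram.cells_bot, Finset.notMem_empty, iff_false]
  omega

theorem layerWord_succ (N : ℕ) (π : PlanePartition) :
    layerWord (N + 1) π = layerWord N π ++ [ofPartition (π.layer N)] := by
  rw [layerWord, layerWord, List.range'_concat, List.flatMap_append]
  simp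

theorem wordWt_append {B : Type} (C : CrystalData B) (u v : List B) :
    wordWt C (u ++ v) = wordWt C u + wordWt C v := by
  induction u with
  | nil => simp [wordWt]
  | cons b u ih => rw [List.cons_append, wordWt, wordWt, ih, add_assoc]

/-- The weight of a plane partition. -/
def planeWt (π : PlanePartition) : Weight :=
  wordWt fock (layerWord (π.entry (0, 0)) π) - ((π.entry (0, 0) : ℕ) : ℤ) • Lam0

/-- An empty layer has weight Λ_0, which the twist by -NΛ_0 removes; so the weight is independent of
N. -/
theorem wordWt_layerWord (N : ℕ) (π : PlanePartition) (hN : π.entry (0, 0) ≤ N) :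
    wordWt fock (layerWord N π) - (N : ℤ) • Lam0 = planeWt π := by
  induction N, hN using Nat.le_induction with
  | base => rfl
  | succ N hN ih =>
    rw [layerWord_succ, wordWt_append, layer_eq_bot hN, ofPartition_bot, ← ih]
    simp only [wordWt, fock_wt_H]
    push_cast
    rw [add_smul, one_smul, add_zero]
    abel

theorem planeCrystal_wt (π : PlanePartition) : planeCrystal.wt π = planeWt π := by
  change (layerCrystal (enough π)).wt (ofLayers (enough π) π) = _
  rw [ofLayers_eq, (layerCrystal_values _ 0 _ _).1]
  exact wordWt_layerWord _ π (by rw [enough]; omega)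

theorem planeCrystal_eps (i : ℤ) (π : PlanePartition) :
    planeCrystal.eps i π = ((planeEps i π : ℤ) : WithBot ℤ) := by
  change (layerCrystal (enough π)).eps i (ofLayers (enough π) π) = _
  rw [ofLayers_eq, (layerCrystal_values _ i _ _).2.1,
    natEps_layerWord i _ π (by rw [enough]; omega)]

theorem planeCrystal_phi (i : ℤ) (π : PlanePartition) :
    planeCrystal.phi i π = ((pairing (planeWt π) i + planeEps i π : ℤ) : WithBot ℤ) := by
  change (layerCrystal (enough π)).phi i (ofLayers (enough π) π) = _
  rw [ofLayers_eq, (layerCrystal_values _ i _ _).2.2.1,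
    natEps_layerWord i _ π (by rw [enough]; omega),
    wordWt_layerWord _ π (by rw [enough]; omega)]

/-- The raising operator on words needs no separate analysis: if it acts then ε is positive, so some
arrow ends at π, and inverting f along that arrow determines the result. -/
theorem wordE_layerWord {k : ℤ} {N : ℕ} {π π' : PlanePartition} (hN : π.entry (0, 0) ≤ N)
    (hN' : π'.entry (0, 0) ≤ N) :
    wordE fock k (layerWord N π) = some (layerWord N π') ↔ Arrow k π' π := by
  constructor
  · intro h
    have h1 : planeEps k π ≠ 0 := by
      intro h0
      rw [← natEps_layerWord k N π hN, ← ((fock_semi k).word_none _).1, h] at h0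
      exact absurd h0 (by simp)
    obtain ⟨π'', h2⟩ := exists_arrow_of_pos (Nat.pos_of_ne_zero h1)
    have h3 := ((fock_semi k).wordF_iff_wordE _ _).mp (h2.wordF hN)
    rw [h, Option.some.injEq] at h3
    rwa [layerWord_injective hN' ((h2.entry_le_entry _).trans hN) h3]
  · intro h
    exact ((fock_semi k).wordF_iff_wordE _ _).mp (h.wordF hN)

theorem wordF_layerWord {k : ℤ} {N : ℕ} {π π' : PlanePartition} (hN : π.entry (0, 0) ≤ N)
    (hN' : π'.entry (0, 0) ≤ N) :
    CrystalData.wordF fock k (layerWord N π) = some (layerWord N π') ↔ Arrow k π π' := by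
  rw [(fock_semi k).wordF_iff_wordE, wordE_layerWord hN' hN]

theorem Arrow.unique {k : ℤ} {π π' π'' : PlanePartition} (h : Arrow k π π')
    (h' : Arrow k π π'') : π' = π'' := by
  have h1 := h.wordF (le_max_left _ (π''.entry (0, 0)))
  rw [h'.wordF (le_max_right _ _), Option.some.injEq] at h1
  exact (layerWord_injective (le_max_right _ _) (le_max_left _ _) h1).symm

theorem Arrow.unique_left {k : ℤ} {π π' π'' : PlanePartition} (h : Arrow k π' π)
    (h' : Arrow k π'' π) : π' = π'' := by
  have h1 := (wordE_layerWord le_rfl (h.entry_le_entry _)).mpr h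
  rw [(wordE_layerWord le_rfl (h'.entry_le_entry _)).mpr h', Option.some.injEq] at h1
  exact (layerWord_injective (h'.entry_le_entry _) (h.entry_le_entry _) h1).symm

/-- The choice in the definition is harmless because arrows are unique, and `enough` layers suffice
because an arrow raises the corner entry by at most one. -/
theorem planeCrystal_f (i : ℤ) (π π' : PlanePartition) :
    planeCrystal.f i π = some π' ↔ Arrow i π π' := by
  have hle : π.entry (0, 0) ≤ enough π := by rw [enough]; omega
  have hiff : ∀ π' : PlanePartition, (π'.entry (0, 0) ≤ enough π ∧
      (layerCrystal (enough π)).f i (ofLayers (enough π) π) = some (ofLayers (enough π) π')) ↔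
      Arrow i π π' := by
    intro π'
    rw [ofLayers_eq, ofLayers_eq, (layerCrystal_values _ i _ _).2.2.2.2]
    constructor
    · rintro ⟨h1, h2⟩
      rw [Option.map_eq_some_iff] at h2
      obtain ⟨v, h3, h4⟩ := h2
      rw [Prod.mk.injEq] at h4
      rw [h4.1] at h3
      exact (wordF_layerWord hle h1).mp h3
    · intro h
      have h1 : π'.entry (0, 0) ≤ enough π := h.entry_le_succ (0, 0)
      exact ⟨h1, by rw [h.wordF h1]; rfl⟩
  simp only [planeCrystal]
  constructor
  · intro h
    split_ifs at h with h1
    rw [← Option.some.inj h]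
    exact (hiff _).mp h1.choose_spec
  · intro h
    have h1 : ∃ π'' : PlanePartition, π''.entry (0, 0) ≤ enough π ∧
        (layerCrystal (enough π)).f i (ofLayers (enough π) π) =
          some (ofLayers (enough π) π'') := ⟨π', (hiff π').mpr h⟩
    rw [dif_pos h1]
    exact congrArg some (((hiff _).mp h1.choose_spec).unique h)

theorem planeCrystal_e (i : ℤ) (π π' : PlanePartition) :
    planeCrystal.e i π = some π' ↔ Arrow i π' π := by
  have hle : π.entry (0, 0) ≤ enough π := by rw [enough]; omega
  have hiff : ∀ π' : PlanePartition, (π'.entry (0, 0) ≤ enough π ∧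
      (layerCrystal (enough π)).e i (ofLayers (enough π) π) = some (ofLayers (enough π) π')) ↔
      Arrow i π' π := by
    intro π'
    rw [ofLayers_eq, ofLayers_eq, (layerCrystal_values _ i _ _).2.2.2.1]
    constructor
    · rintro ⟨h1, h2⟩
      rw [Option.map_eq_some_iff] at h2
      obtain ⟨v, h3, h4⟩ := h2
      rw [Prod.mk.injEq] at h4
      rw [h4.1] at h3
      exact (wordE_layerWord hle h1).mp h3
    · intro h
      have h1 := (h.entry_le_entry (0, 0)).trans hle
      exact ⟨h1, by rw [(wordE_layerWord hle h1).mpr h]; rfl⟩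
  simp only [planeCrystal]
  constructor
  · intro h
    split_ifs at h with h1
    rw [← Option.some.inj h]
    exact (hiff _).mp h1.choose_spec
  · intro h
    have h1 : ∃ π'' : PlanePartition, π''.entry (0, 0) ≤ enough π ∧
        (layerCrystal (enough π)).e i (ofLayers (enough π) π) =
          some (ofLayers (enough π) π'') := ⟨π', (hiff π').mpr h⟩
    rw [dif_pos h1]
    exact congrArg some (((hiff _).mp h1.choose_spec).unique_left h)

theorem Arrow.values {k : ℤ} {π π' : PlanePartition} (h : Arrow k π π') :
    planeEps k π' = planeEps k π + 1 ∧ planeWt π' = planeWt π - simpleRoot k := by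
  have hle := h.entry_le_entry (0, 0)
  obtain ⟨h1, -, h2⟩ := (fock_semi k).wordF_some _ _ (h.wordF le_rfl)
  rw [natEps_layerWord k _ _ le_rfl, natEps_layerWord k _ _ hle] at h1
  refine ⟨h1, ?_⟩
  rw [← wordWt_layerWord _ π hle, planeWt, h2]
  abel

end PlanePartition

theorem pairing_simpleRoot (i : ℤ) : pairing (simpleRoot i) i = 2 := by
  have h := lo_ne_hi i
  simp [pairing, simpleRoot, epsW, h, h.symm]

theorem planeCrystal_isCrystal : planeCrystal.IsCrystal := by
  have hf : ∀ i b b', planeCrystal.f i b = some b' →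
      planeCrystal.eps i b' = planeCrystal.eps i b + ((1 : ℤ) : WithBot ℤ) ∧
      planeCrystal.phi i b' = planeCrystal.phi i b + ((-1 : ℤ) : WithBot ℤ) ∧
      planeCrystal.wt b' = planeCrystal.wt b - simpleRoot i := by
    intro i b b' h
    obtain ⟨h1, h2⟩ := ((PlanePartition.planeCrystal_f i b b').mp h).values
    simp only [PlanePartition.planeCrystal_eps, PlanePartition.planeCrystal_phi,
      PlanePartition.planeCrystal_wt, ← WithBot.coe_add, WithBot.coe_inj]
    rw [h1, h2, pairing_sub, pairing_simpleRoot]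
    refine ⟨by push_cast; ring, by push_cast; ring, rfl⟩
  refine ⟨fun i b => ?_, fun i b b' h => ?_, hf, fun i b b' => ?_, fun i b h => ?_⟩
  · rw [PlanePartition.planeCrystal_eps, PlanePartition.planeCrystal_phi,
      PlanePartition.planeCrystal_wt, ← WithBot.coe_add]
  · have h' := (PlanePartition.planeCrystal_f i b' b).mpr
      ((PlanePartition.planeCrystal_e i b b').mp h)
    obtain ⟨h1, h2, h3⟩ := hf i b' b h'
    rw [h1, h2, h3]
    refine ⟨?_, ?_, by abel⟩
    · rw [add_assoc, ← WithBot.coe_add, add_neg_cancel, WithBot.coe_zero, add_zero]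
    · rw [add_assoc, ← WithBot.coe_add, neg_add_cancel, WithBot.coe_zero, add_zero]
  · rw [PlanePartition.planeCrystal_f, PlanePartition.planeCrystal_e]
  · rw [PlanePartition.planeCrystal_phi] at h
    exact absurd h WithBot.coe_ne_bot

/-! ### Crystals under restriction and isomorphism -/

namespace CrystalData

variable {B B₁ B₂ : Type}

theorem restrict_f (C : CrystalData B) (S : Set B) (i : ℤ) (b b' : S) :
    (C.restrict S).f i b = some b' ↔ C.f i b = some b'.1 := by
  classical
  simp only [restrict, Option.bind_eq_some_iff]
  constructor
  · rintro ⟨c, h1, h2⟩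
    split_ifs at h2 with h3
    rw [h1, ← Option.some.inj h2]
  · intro h
    exact ⟨b'.1, h, by rw [dif_pos b'.2]⟩

theorem restrict_e (C : CrystalData B) (S : Set B) (i : ℤ) (b b' : S) :
    (C.restrict S).e i b = some b' ↔ C.e i b = some b'.1 := by
  classical
  simp only [restrict, Option.bind_eq_some_iff]
  constructor
  · rintro ⟨c, h1, h2⟩
    split_ifs at h2 with h3
    rw [h1, ← Option.some.inj h2]
  · intro h
    exact ⟨b'.1, h, by rw [dif_pos b'.2]⟩

theorem IsCrystal.restrict {C : CrystalData B} (h : C.IsCrystal) (S : Set B) :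
    (C.restrict S).IsCrystal where
  phi_eq i b := h.phi_eq i b
  e_some i b b' hb := h.e_some i b b' ((restrict_e C S i b b').mp hb)
  f_some i b b' hb := h.f_some i b b' ((restrict_f C S i b b').mp hb)
  f_iff_e i b b' := by rw [restrict_f, restrict_e, h.f_iff_e]
  bot i b hb := by
    obtain ⟨h1, h2⟩ := h.bot i b hb
    simp [CrystalData.restrict, h1, h2]

theorem IsCrystal.of_iso {C₁ : CrystalData B₁} {C₂ : CrystalData B₂} (h : C₁.IsCrystal)
    (Φ : Iso C₁ C₂) : C₂.IsCrystal := by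
  have hf : ∀ i b b', C₂.f i (Φ.toFun b) = some (Φ.toFun b') ↔ C₁.f i b = some b' := by
    intro i b b'
    rw [Φ.f_eq, Option.map_eq_some_iff]
    exact ⟨fun ⟨c, h1, h2⟩ => by rwa [← Φ.toEquiv.injective h2], fun h => ⟨b', h, rfl⟩⟩
  have he : ∀ i b b', C₂.e i (Φ.toFun b) = some (Φ.toFun b') ↔ C₁.e i b = some b' := by
    intro i b b'
    rw [Φ.e_eq, Option.map_eq_some_iff]
    exact ⟨fun ⟨c, h1, h2⟩ => by rwa [← Φ.toEquiv.injective h2], fun h => ⟨b', h, rfl⟩⟩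
  have surj : ∀ b, ∃ a, Φ.toFun a = b := Φ.toEquiv.surjective
  refine ⟨fun i b => ?_, fun i b b' hb => ?_, fun i b b' hb => ?_, fun i b b' => ?_,
    fun i b hb => ?_⟩
  · obtain ⟨a, rfl⟩ := surj b
    rw [Φ.phi_eq, Φ.wt_eq, Φ.eps_eq, h.phi_eq]
  · obtain ⟨a, rfl⟩ := surj b
    obtain ⟨a', rfl⟩ := surj b'
    rw [Φ.phi_eq, Φ.wt_eq, Φ.eps_eq, Φ.phi_eq, Φ.wt_eq, Φ.eps_eq]
    exact h.e_some i a a' ((he i a a').mp hb)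
  · obtain ⟨a, rfl⟩ := surj b
    obtain ⟨a', rfl⟩ := surj b'
    rw [Φ.phi_eq, Φ.wt_eq, Φ.eps_eq, Φ.phi_eq, Φ.wt_eq, Φ.eps_eq]
    exact h.f_some i a a' ((hf i a a').mp hb)
  · obtain ⟨a, rfl⟩ := surj b
    obtain ⟨a', rfl⟩ := surj b'
    rw [hf, he, h.f_iff_e]
  · obtain ⟨a, rfl⟩ := surj b
    rw [Φ.phi_eq] at hb
    obtain ⟨h1, h2⟩ := h.bot i a hb
    rw [Φ.e_eq, Φ.f_eq, h1, h2]
    exact ⟨rfl, rfl⟩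

end CrystalData

end GlInf

end

/-! ### The crystal graph on matrices. -/

noncomputable section

namespace GlInf

open CrystalData PlanePartition

/-! ### Arrows of the crystal of matrices -/

/-- `ε` of the tails of the word of a matrix, for the columns `k` and `k + 1`. -/
structure IsTailEps (B : Mat) (k : ℕ) (F : ℕ → ℕ) : Prop where
  step : ∀ r, F r = B (r, k + 1) + (F (r + 1) - B (r, k))
  zero : ∃ T, ∀ r, T ≤ r → F r = 0

theorem exists_isTailEps (B : Mat) (k : ℕ) : ∃ F, IsTailEps B k F := by
  obtain ⟨N, hN⟩ := GlInf.exists_bound B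
  -- The recursion for F runs from the last row upwards, so it is solved in the reversed index N -
  -- r.
  let G : ℕ → ℕ := fun n => Nat.rec 0 (fun n x => B (N - (n + 1), k + 1) + (x - B (N - (n + 1), k))) n
  have hG : ∀ n, G (n + 1) = B (N - (n + 1), k + 1) + (G n - B (N - (n + 1), k)) := fun n => rfl
  refine ⟨fun r => G (N - r), fun r => ?_, N, fun r hr => ?_⟩
  · rcases Nat.lt_or_ge r N with h | h
    · rw [show N - r = N - (r + 1) + 1 by omega, hG, show N - (N - (r + 1) + 1) = r by omega]
    · rw [hN r _ (Or.inl h), hN r _ (Or.inl h), show N - r = 0 by omega,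
        show N - (r + 1) = 0 by omega]
      rfl
  · rw [show N - r = 0 by omega]
    rfl

/-- The lowering operator moves a unit from the entry `(r, k)` to the entry `(r, k + 1)`. -/
structure Moves (B B' : Mat) (k : ℕ) (F : ℕ → ℕ) (r : ℕ) : Prop where
  lt : F (r + 1) < B (r, k)
  le : ∀ s, s < r → B (s, k) ≤ F (s + 1)
  src : B' (r, k) + 1 = B (r, k)
  tgt : B' (r, k + 1) = B (r, k + 1) + 1
  other : ∀ s j, ¬ (s = r ∧ (j = k ∨ j = k + 1)) → B' (s, j) = B (s, j)

theorem Moves.add_eq {B B' : Mat} {k : ℕ} {F : ℕ → ℕ} {r : ℕ} (h : Moves B B' k F r) :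
    B' + Finsupp.single (r, k) 1 = B + Finsupp.single (r, k + 1) 1 := by
  ext ⟨s, j⟩
  rw [Finsupp.add_apply, Finsupp.add_apply, Finsupp.single_apply, Finsupp.single_apply]
  simp only [Prod.mk.injEq]
  by_cases h1 : s = r ∧ (j = k ∨ j = k + 1)
  · obtain ⟨rfl, rfl | rfl⟩ := h1
    · have := h.src
      rw [if_pos ⟨rfl, rfl⟩, if_neg (by omega)]; omega
    · have := h.tgt
      rw [if_neg (by omega), if_pos ⟨rfl, rfl⟩]; omega
  · rw [h.other s j h1, if_neg (by tauto), if_neg (by tauto)]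

/-- If `ε > 0` then the raising operator acts. -/
theorem IsTailEps.exists_moves {B : Mat} {k : ℕ} {F : ℕ → ℕ} (hF : IsTailEps B k F)
    (h0 : 0 < F 0) : ∃ B' F' r, IsTailEps B' k F' ∧ Moves B' B k F' r := by
  classical
  obtain ⟨T, hT⟩ := hF.zero
  -- In the first such row the signs - from below are all cancelled; in every earlier row some
  -- survive. Hence this row contains the rightmost surviving -.
  have hex : ∃ r, F (r + 1) ≤ B (r, k) := ⟨T, by rw [hT _ (by omega)]; omega⟩
  have h1 := Nat.find_spec hex
  have h2 : ∀ s, s < Nat.find hex → B (s, k) < F (s + 1) := fun s hs =>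
    not_le.mp (Nat.find_min hex hs)
  generalize Nat.find hex = r at h1 h2
  have h3 : 0 < B (r, k + 1) := by
    have h4 : 0 < F r := by
      cases r with
      | zero => exact h0
      | succ r => have := h2 r (by omega); omega
    have := hF.step r
    omega
  let B' : Mat := B + Finsupp.single (r, k) 1 - Finsupp.single (r, k + 1) 1
  have src : B' (r, k) = B (r, k) + 1 := by
    simp [B', Finsupp.tsub_apply]
  have tgt : B' (r, k + 1) = B (r, k + 1) - 1 := by
    simp [B', Finsupp.tsub_apply]
  have other : ∀ s j, ¬ (s = r ∧ (j = k ∨ j = k + 1)) → B' (s, j) = B (s, j) := by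
    intro s j h
    simp only [B', Finsupp.tsub_apply, Finsupp.add_apply, Finsupp.single_apply, Prod.mk.injEq]
    rw [if_neg (by tauto), if_neg (by tauto)]
    omega
  refine ⟨B', fun s => if s ≤ r then F s - 1 else F s, r, ⟨fun s => ?_, T, fun s hs => ?_⟩,
    ?_, ?_, ?_, ?_, ?_⟩
  · have hs := hF.step s
    rcases lt_trichotomy s r with h | h | h
    · have := h2 s h
      rw [if_pos (by omega), if_pos (by omega), other s _ (by omega), other s _ (by omega)]
      omega
    · subst h
      rw [if_pos (by omega), if_neg (by omega), src, tgt]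
      omega
    · rw [if_neg (by omega), if_neg (by omega), other s _ (by omega), other s _ (by omega)]
      exact hs
  · have := hT s hs
    split_ifs <;> omega
  · rw [if_neg (by omega), src]
    omega
  · intro s hs
    have := h2 s hs
    rw [if_pos (by omega), other s _ (by omega)]
    omega
  · rw [src]
  · rw [tgt]; omega
  · intro s j h; exact (other s j h).symm

/-- The sum of the entries, weighted by the distance of the position from the corner. -/
def matDegree (A : Mat) : ℕ := A.sum fun c a => a * (c.1 + c.2 + 1)

theorem matDegree_add (A B : Mat) : matDegree (A + B) = matDegree A + matDegree B :=
  Finsupp.sum_add_index' (fun _ => by simp) fun _ _ _ => by ring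

theorem matDegree_single (c : ℕ × ℕ) : matDegree (Finsupp.single c 1) = c.1 + c.2 + 1 := by
  rw [matDegree, Finsupp.sum_single_index (by simp), one_mul]

theorem matWt_add (A B : Mat) : matWt (A + B) = matWt A + matWt B :=
  Finsupp.sum_add_index' (fun _ => by simp) fun _ _ _ => by push_cast; rw [add_smul]

theorem matWt_single (c : ℕ × ℕ) :
    matWt (Finsupp.single c 1) = epsW (pos c.2) - epsW (neg c.1) := by
  rw [matWt, Finsupp.sum_single_index (by simp), Nat.cast_one, one_smul]

/-- An `i`-arrow of the crystal of matrices. -/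
structure MatStep (i : ℤ) (A A' : Mat) : Prop where
  f : matCrystal.f i A = some A'
  e : matCrystal.e i A' = some A
  wt : matWt A' = matWt A - simpleRoot i
  degree : matDegree A' = matDegree A + 1

theorem lo_pos (k : ℕ) : lo ((k : ℤ) + 1) = pos k := by
  refine Subtype.ext ?_
  simp only [lo, pos]; rw [if_neg (by omega)]

theorem hi_pos (k : ℕ) : hi ((k : ℤ) + 1) = pos (k + 1) := by
  refine Subtype.ext ?_
  simp only [hi, pos]; rw [if_neg (by omega)]; push_cast; rfl

theorem hi_neg (k : ℕ) : hi (-((k : ℤ) + 1)) = neg k := by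
  refine Subtype.ext ?_
  simp only [hi, neg]; rw [if_pos (by omega)]

theorem lo_neg (k : ℕ) : lo (-((k : ℤ) + 1)) = neg (k + 1) := by
  refine Subtype.ext ?_
  simp only [lo, neg]; rw [if_pos (by omega)]; push_cast; ring

theorem matCrystal_pos (k : ℕ) (A : Mat) :
    matCrystal.eps (k + 1) A = wordEps natural (k + 1) (lexWord pos A) ∧
    matCrystal.phi (k + 1) A = wordPhi natural (k + 1) (lexWord pos A) ∧
    matCrystal.e (k + 1) A = (wordE natural (k + 1) (lexWord pos A)).map (replaceCols A) ∧
    matCrystal.f (k + 1) A = (wordF natural (k + 1) (lexWord pos A)).map (replaceCols A) := by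
  have h1 : ¬ (k : ℤ) + 1 < 0 := by omega
  have h2 : ¬ (k : ℤ) + 1 = 0 := by omega
  simp only [matCrystal, if_neg h1, if_neg h2, colWord_eq]
  exact ⟨rfl, rfl, rfl, rfl⟩

theorem matCrystal_neg (k : ℕ) (A : Mat) :
    matCrystal.eps (-(k + 1)) A =
      wordEps natural.dual (-(k + 1)) (lexWord neg (transposeMat A)) ∧
    matCrystal.phi (-(k + 1)) A =
      wordPhi natural.dual (-(k + 1)) (lexWord neg (transposeMat A)) ∧
    matCrystal.e (-(k + 1)) A =
      (wordE natural.dual (-(k + 1)) (lexWord neg (transposeMat A))).map (replaceRows A) ∧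
    matCrystal.f (-(k + 1)) A =
      (wordF natural.dual (-(k + 1)) (lexWord neg (transposeMat A))).map (replaceRows A) := by
  have h1 : -((k : ℤ) + 1) < 0 := by omega
  simp only [matCrystal, if_pos h1, rowWord_eq]
  exact ⟨rfl, rfl, rfl, rfl⟩

/-- Moving a unit one column to the right changes the weight by ε_{k+2} - ε_{k+1} = -α_{k+1} and the
weighted degree by one. -/
theorem matStep_pos {A A' : Mat} {k : ℕ} {F : ℕ → ℕ} {r : ℕ} (hF : IsTailEps A k F)
    (h : Moves A A' k F r) : MatStep (k + 1) A A' := by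
  obtain ⟨T, hT⟩ := hF.zero
  obtain ⟨h1, h2⟩ := (pos_letterArrow k).wordF_lexWord_some A A' F T hF.step hT r h.lt h.le h.src
    h.tgt h.other
  refine ⟨?_, ?_, ?_, ?_⟩
  · rw [(matCrystal_pos k A).2.2.2, h1, Option.map_some, ← colWord_eq, replaceCols_eq A A' h2]
  · rw [(matCrystal_pos k A').2.2.1, ((pos_letterArrow k).semi.wordF_iff_wordE _ _).mp h1,
      Option.map_some, ← colWord_eq, replaceCols_eq A' A h2.symm]
  · have h3 := congrArg matWt h.add_eq
    rw [matWt_add, matWt_add, matWt_single, matWt_single] at h3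
    rw [simpleRoot, lo_pos, hi_pos, eq_sub_of_add_eq h3]
    abel
  · have h3 := congrArg matDegree h.add_eq
    rw [matDegree_add, matDegree_add, matDegree_single, matDegree_single] at h3
    dsimp only at h3
    omega

theorem transposeMat_transposeMat (A : Mat) : transposeMat (transposeMat A) = A := by
  ext ⟨i, j⟩
  rw [transposeMat_apply, transposeMat_apply]

theorem transposeMat_add (A B : Mat) : transposeMat (A + B) = transposeMat A + transposeMat B :=
  Finsupp.mapDomain_add

theorem transposeMat_single (c : ℕ × ℕ) :
    transposeMat (Finsupp.single c 1) = Finsupp.single c.swap 1 :=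
  Finsupp.mapDomain_single

theorem matStep_neg {A A' : Mat} {k : ℕ} {F : ℕ → ℕ} {r : ℕ}
    (hF : IsTailEps (transposeMat A) k F) (h : Moves (transposeMat A) (transposeMat A') k F r) :
    MatStep (-(k + 1)) A A' := by
  obtain ⟨T, hT⟩ := hF.zero
  obtain ⟨h1, h2⟩ := (neg_letterArrow k).wordF_lexWord_some (transposeMat A) (transposeMat A') F T
    hF.step hT r h.lt h.le h.src h.tgt h.other
  have hadd := congrArg transposeMat h.add_eq
  rw [transposeMat_add, transposeMat_add, transposeMat_transposeMat, transposeMat_transposeMat,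
    transposeMat_single, transposeMat_single] at hadd
  refine ⟨?_, ?_, ?_, ?_⟩
  · rw [(matCrystal_neg k A).2.2.2, h1, Option.map_some, ← rowWord_eq, replaceRows_eq A A' h2]
  · rw [(matCrystal_neg k A').2.2.1, ((neg_letterArrow k).semi.wordF_iff_wordE _ _).mp h1,
      Option.map_some, ← rowWord_eq, replaceRows_eq A' A h2.symm]
  · have h3 := congrArg matWt hadd
    rw [matWt_add, matWt_add, matWt_single, matWt_single] at h3
    rw [simpleRoot, lo_neg, hi_neg, eq_sub_of_add_eq h3]
    simp only [Prod.fst_swap, Prod.snd_swap]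
    abel
  · have h3 := congrArg matDegree hadd
    rw [matDegree_add, matDegree_add, matDegree_single, matDegree_single] at h3
    simp only [Prod.fst_swap, Prod.snd_swap] at h3
    omega

theorem matStep_zero {A A' : Mat} (h : A' = A + Finsupp.single (0, 0) 1) : MatStep 0 A A' := by
  subst h
  refine ⟨by simp [matCrystal], ?_, ?_, ?_⟩
  · simp [matCrystal]
  · rw [matWt_add, matWt_single, simpleRoot]
    have h1 : lo 0 = neg 0 := rfl
    have h2 : hi 0 = pos 0 := rfl
    rw [h1, h2]
    abel
  · rw [matDegree_add, matDegree_single, zero_add, zero_add]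

theorem IsTailEps.eps_pos {A : Mat} {k : ℕ} {F : ℕ → ℕ} (hF : IsTailEps A k F) :
    matCrystal.eps (k + 1) A = ((F 0 : ℤ) : WithBot ℤ) ∧
    (F 0 = 0 → matCrystal.e (k + 1) A = none) ∧
    ((∀ r, A (r, k) ≤ F (r + 1)) → matCrystal.f (k + 1) A = none) := by
  obtain ⟨T, hT⟩ := hF.zero
  have h1 := (pos_letterArrow k).natEps_lexWord A F T hF.step hT
  obtain ⟨c1, c2, c3, c4⟩ := matCrystal_pos k A
  refine ⟨?_, fun h => ?_, fun h => ?_⟩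
  · rw [c1, ((pos_letterArrow k).semi.word_values _).1, h1]
  · rw [c3, ((pos_letterArrow k).semi.word_none _).1.mpr (h1.trans h), Option.map_none]
  · rw [c4, (pos_letterArrow k).wordF_lexWord_none A F T hF.step hT h, Option.map_none]

theorem IsTailEps.eps_neg {A : Mat} {k : ℕ} {F : ℕ → ℕ} (hF : IsTailEps (transposeMat A) k F) :
    matCrystal.eps (-(k + 1)) A = ((F 0 : ℤ) : WithBot ℤ) ∧
    (F 0 = 0 → matCrystal.e (-(k + 1)) A = none) ∧
    ((∀ r, A (k, r) ≤ F (r + 1)) → matCrystal.f (-(k + 1)) A = none) := by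
  obtain ⟨T, hT⟩ := hF.zero
  have h1 := (neg_letterArrow k).natEps_lexWord (transposeMat A) F T hF.step hT
  obtain ⟨c1, c2, c3, c4⟩ := matCrystal_neg k A
  refine ⟨?_, fun h => ?_, fun h => ?_⟩
  · rw [c1, ((neg_letterArrow k).semi.word_values _).1, h1]
  · rw [c3, ((neg_letterArrow k).semi.word_none _).1.mpr (h1.trans h), Option.map_none]
  · rw [c4, (neg_letterArrow k).wordF_lexWord_none (transposeMat A) F T hF.step hT
      fun r => by rw [transposeMat_apply]; exact h r, Option.map_none]

/-- Every non-zero matrix is the end of an arrow. -/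
theorem exists_matStep {A : Mat} (hA : A ≠ 0) : ∃ i A', MatStep i A' A := by
  classical
  by_cases h00 : A (0, 0) = 0
  · have hex : ∃ r, ∃ j, A (r, j) ≠ 0 := by
      by_contra hcon
      push Not at hcon
      exact hA (Finsupp.ext fun c => hcon c.1 c.2)
    obtain ⟨j, hj⟩ := Nat.find_spec hex
    have hlt : ∀ s, s < Nat.find hex → ∀ j, A (s, j) = 0 := by
      intro s hs j
      have := Nat.find_min hex hs
      push Not at this
      exact this j
    generalize Nat.find hex = r at hj hlt
    cases j with
    | succ j =>
      obtain ⟨F, hF⟩ := exists_isTailEps A j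
      -- The rows above r vanish, so they contain no + that could cancel the - contributed by the
      -- entry in column j+1.
      have h0 : ∀ s, s ≤ r → 0 < F s := by
        intro s hs
        induction hs using Nat.decreasingInduction with
        | self => rw [hF.step]; omega
        | of_succ s hs ih => rw [hF.step, hlt s hs, hlt s hs]; omega
      obtain ⟨A', F', s, h1, h2⟩ := hF.exists_moves (h0 0 (Nat.zero_le _))
      exact ⟨_, A', matStep_pos h1 h2⟩
    | zero =>
      -- The corner entry vanishes, so a non-zero entry of column 0 is not in row 0. It gives a sign
      -- - in the first block of the transposed word, and nothing precedes that sign.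
      obtain ⟨k, rfl⟩ : ∃ k, r = k + 1 := ⟨r - 1, by cases r <;> simp_all⟩
      obtain ⟨F, hF⟩ := exists_isTailEps (transposeMat A) k
      have h0 : 0 < F 0 := by rw [hF.step, transposeMat_apply]; omega
      obtain ⟨B', F', s, h1, h2⟩ := hF.exists_moves h0
      rw [← transposeMat_transposeMat B'] at h1 h2
      exact ⟨_, transposeMat B', matStep_neg h1 h2⟩
  · refine ⟨0, A - Finsupp.single (0, 0) 1, matStep_zero ?_⟩
    ext c
    rw [Finsupp.add_apply, Finsupp.tsub_apply, Finsupp.single_apply]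
    split_ifs with h
    · subst h; omega
    · omega

/-! ### The relation between `φ` and `ε` -/

theorem pairing_wordWt {B : Type} (C : CrystalData B) (i : ℤ) (w : List B) :
    pairing (wordWt C w) i = (w.map fun b => pairing (C.wt b) i).sum := by
  induction w with
  | nil => exact pairing_zero i
  | cons b w ih => rw [wordWt, pairing_add, ih, List.map_cons, List.sum_cons]

theorem pairing_lexWord (C : CrystalData NZ) (ι : ℕ → NZ) (i : ℤ) (A : Mat) :
    pairing (wordWt C (lexWord ι A)) i =
      ((Finsupp.toMultiset A).map fun c => pairing (C.wt (ι c.2)) i).sum := by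
  rw [pairing_wordWt, lexWord, List.map_map, ← Multiset.sum_coe, ← Multiset.map_coe, biwordByRow,
    Multiset.sort_eq, Multiset.map_map]
  rfl

theorem pairing_matWt (A : Mat) (i : ℤ) : pairing (matWt A) i =
    ((Finsupp.toMultiset A).map fun c => pairing (epsW (pos c.2) - epsW (neg c.1)) i).sum := by
  induction A using Finsupp.induction_linear with
  | zero => simp [matWt, pairing_zero]
  | add A B hA hB =>
    rw [matWt_add, pairing_add, hA, hB, Finsupp.toMultiset_add, Multiset.map_add,
      Multiset.sum_add]
  | single c a =>
    rw [matWt, Finsupp.sum_single_index (by simp), pairing_smul, Finsupp.toMultiset_single,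
      Multiset.map_nsmul, Multiset.map_singleton, Multiset.sum_nsmul, Multiset.sum_singleton,
      nsmul_eq_mul]

theorem pairing_epsW_neg (r k : ℕ) : pairing (epsW (neg r)) (k + 1) = 0 := by
  have h1 : neg r ≠ pos k := by rw [Ne, ← Subtype.coe_inj]; simp only [neg, pos]; omega
  have h2 : neg r ≠ pos (k + 1) := by rw [Ne, ← Subtype.coe_inj]; simp only [neg, pos]; omega
  simp [pairing, epsW, lo_pos, hi_pos, h1.symm, h2.symm]

theorem pairing_epsW_pos (r k : ℕ) : pairing (epsW (pos r)) (-(k + 1)) = 0 := by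
  have h1 : pos r ≠ neg k := by rw [Ne, ← Subtype.coe_inj]; simp only [neg, pos]; omega
  have h2 : pos r ≠ neg (k + 1) := by rw [Ne, ← Subtype.coe_inj]; simp only [neg, pos]; omega
  simp only [pairing, epsW, lo_neg, hi_neg]
  simp [h1.symm, h2.symm]

theorem int_cases' (i : ℤ) : i = 0 ∨ (∃ k : ℕ, i = k + 1) ∨ ∃ k : ℕ, i = -(k + 1) := by
  rcases lt_trichotomy i 0 with h | h | h
  · exact Or.inr (Or.inr ⟨(-i - 1).toNat, by omega⟩)
  · exact Or.inl h
  · exact Or.inr (Or.inl ⟨(i - 1).toNat, by omega⟩)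

/-- For i > 0 only the column letters pair non-trivially with h_i, for i < 0 only the row letters,
so the seminormal identity for the respective word is the one for the whole weight. -/
theorem matCrystal_phi (i : ℤ) (A : Mat) :
    matCrystal.phi i A = ((pairing (matWt A) i : ℤ) : WithBot ℤ) + matCrystal.eps i A := by
  rcases int_cases' i with rfl | ⟨k, rfl⟩ | ⟨k, rfl⟩
  · simp [matCrystal]
  · obtain ⟨c1, c2, -, -⟩ := matCrystal_pos k A
    obtain ⟨h1, h2, h3⟩ := (pos_letterArrow k).semi.word_values (lexWord pos A)
    have h4 : pairing (wordWt natural (lexWord pos A)) (k + 1) = pairing (matWt A) (k + 1) := by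
      rw [pairing_lexWord, pairing_matWt]
      refine congrArg Multiset.sum (Multiset.map_congr rfl fun c _ => ?_)
      rw [pairing_sub, pairing_epsW_neg, sub_zero]
      rfl
    rw [c1, c2, h1, h2, ← WithBot.coe_add, ← h4, h3]
    congr 1
    ring
  · obtain ⟨c1, c2, -, -⟩ := matCrystal_neg k A
    obtain ⟨h1, h2, h3⟩ := (neg_letterArrow k).semi.word_values (lexWord neg (transposeMat A))
    have h4 : pairing (wordWt natural.dual (lexWord neg (transposeMat A))) (-(k + 1)) =
        pairing (matWt A) (-(k + 1)) := by
      rw [pairing_lexWord, pairing_matWt, transposeMat, ← Finsupp.toMultiset_map,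
        Multiset.map_map]
      refine congrArg Multiset.sum (Multiset.map_congr rfl fun c _ => ?_)
      rw [pairing_sub, pairing_epsW_pos, zero_sub, ← pairing_neg]
      rfl
    rw [c1, c2, h1, h2, ← WithBot.coe_add, ← h4, h3]
    congr 1
    ring

end GlInf

end

/-! ### The isomorphism between plane partitions and matrices. -/

noncomputable section

namespace GlInf

open CrystalData PlanePartition

namespace PlanePartition

/-- The diagonals on and above the main diagonal. -/
def top (π : PlanePartition) (j t : ℕ) : ℕ := π.entry (t, t + j)

/-- The diagonals on and below the main diagonal. -/
def left (π : PlanePartition) (i t : ℕ) : ℕ := π.entry (t + i, t)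

theorem isBoundary (π : PlanePartition) : ∃ T, IsBoundary (top π) (left π) T := by
  obtain ⟨T, hT⟩ := π.exists_bound
  have anti : ∀ a b a' b', a ≤ a' → b ≤ b' → π.entry (a', b') ≤ π.entry (a, b) :=
    fun a b a' b' h1 h2 => π.antitone ⟨h1, h2⟩
  refine ⟨T, rfl, fun j t => ⟨anti _ _ _ _ ?_ ?_, anti _ _ _ _ ?_ ?_⟩,
    fun j t => ⟨anti _ _ _ _ ?_ ?_, anti _ _ _ _ ?_ ?_⟩, fun n hn => hT _ _ ?_,
    fun j hj n => hT _ _ ?_, fun j hj n => hT _ _ ?_⟩ <;> omega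

/-- The matrix of a plane partition. -/
def toMat (π : PlanePartition) : Mat :=
  Finsupp.ofSupportFinite (fun c => growthLabel (top π) (left π) c.1 c.2) (by
    obtain ⟨T, h⟩ := π.isBoundary
    refine (Set.Finite.prod (Set.finite_lt_nat T) (Set.finite_lt_nat T)).subset fun c hc => ?_
    by_contra hcon
    rw [Set.mem_prod, not_and_or] at hcon
    simp only [Set.mem_ofPred_eq, not_lt] at hcon
    exact hc (h.growthLabel_eq_zero _ _ hcon))

theorem toMat_apply (π : PlanePartition) (i j : ℕ) :
    toMat π (i, j) = growthLabel (top π) (left π) i j := rfl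

theorem transposeMat_toMat (π : PlanePartition) (i j : ℕ) :
    transposeMat (toMat π) (i, j) = growthLabel (left π) (top π) i j := by
  obtain ⟨T, h⟩ := π.isBoundary
  rw [transposeMat_apply, toMat_apply, h.swap.growthLabel_swap]

theorem strip_pos (π : PlanePartition) (k : ℕ) :
    strip (k + 1) π = stripEps (top π k) (top π (k + 1)) (top π (k + 2)) := rfl

theorem int_neg_succ (k : ℕ) : -((k : ℤ) + 1) = Int.negSucc k := by
  rw [Int.negSucc_eq]

theorem strip_neg (π : PlanePartition) (k : ℕ) :
    strip (-(k + 1)) π = stripEps (left π k) (left π (k + 1)) (left π (k + 2)) := by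
  rw [int_neg_succ]
  rfl

theorem acts_pos (π : PlanePartition) (k t : ℕ) :
    Acts (k + 1) π t ↔ ActsAt (top π k) (top π (k + 1)) (top π (k + 2)) t := Iff.rfl

theorem acts_neg (π : PlanePartition) (k t : ℕ) :
    Acts (-(k + 1)) π t ↔ ActsAt (left π k) (left π (k + 1)) (left π (k + 2)) t := by
  rw [int_neg_succ]
  exact Iff.rfl

/-- The signature of the main diagonal and the carry of the corner square are one recursion, shifted
by one: the neighbour of residue -1 enters with P (t+1) = `left π 1 t`. -/
theorem strip_zero_succ (π : PlanePartition) (t : ℕ) :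
    strip 0 π (t + 1) = carry (top π 0) (left π 1) (top π 1) t := by
  induction t with
  | zero =>
    change π.entry (0, 0) - π.entry (0, 1) + (0 - _) = π.entry (0, 0) - π.entry (0, 1)
    rw [Nat.zero_sub, add_zero]
  | succ t ih =>
    rw [carry, ← ih]
    rfl

/-- The sequence of `ε` of the tails of the column word. -/
def growthEps (top left : ℕ → ℕ → ℕ) (k i : ℕ) : ℕ :=
  eventual (stripEps (growth top left i k) (growth top left i (k + 1))
    (growth top left i (k + 2)))

theorem isTailEps_growthEps {top left : ℕ → ℕ → ℕ} {T : ℕ} (h : IsBoundary top left T) (k : ℕ)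
    (A : Mat) (hA : ∀ i j, A (i, j) = growthLabel top left i j) :
    IsTailEps A k (growthEps top left k) :=
  ⟨fun r => by rw [hA, hA]; exact h.strip_eq r k, T, fun r hr => h.strip_zero r k hr⟩

theorem growthEps_zero {top left : ℕ → ℕ → ℕ} (k : ℕ) : growthEps top left k 0 =
    eventual (stripEps (top k) (top (k + 1)) (top (k + 2))) := by
  rw [growthEps, growth_zero_row, growth_zero_row, growth_zero_row]

theorem isTailEps_toMat (π : PlanePartition) (k : ℕ) :
    IsTailEps (toMat π) k (growthEps (top π) (left π) k) ∧
    IsTailEps (transposeMat (toMat π)) k (growthEps (left π) (top π) k) := by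
  obtain ⟨T, h⟩ := π.isBoundary
  exact ⟨isTailEps_growthEps h k _ (toMat_apply π),
    isTailEps_growthEps h.swap k _ (transposeMat_toMat π)⟩

theorem planeEps_pos (π : PlanePartition) (k : ℕ) :
    planeEps (k + 1) π = growthEps (top π) (left π) k 0 := by
  rw [planeEps, strip_pos, growthEps_zero]

theorem planeEps_neg (π : PlanePartition) (k : ℕ) :
    planeEps (-(k + 1)) π = growthEps (left π) (top π) k 0 := by
  rw [planeEps, strip_neg, growthEps_zero]

theorem planeEps_zero (π : PlanePartition) : planeEps 0 π = toMat π (0, 0) := by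
  obtain ⟨T, h⟩ := π.isBoundary
  obtain ⟨T', h0, hT'⟩ := strip_const 0 π
  rw [toMat_apply, growthLabel, growth_zero_row, growth_zero_row, growth_zero_col (top := top π) (left := left π) rfl, label]
  refine (eventual_eq (T := T') fun n hn => ?_).symm
  rw [← strip_zero_succ, (hT' (n + 1) (by omega)).1]

theorem matCrystal_eps_toMat (i : ℤ) (π : PlanePartition) :
    matCrystal.eps i (toMat π) = ((planeEps i π : ℤ) : WithBot ℤ) ∧
    (planeEps i π = 0 → matCrystal.e i (toMat π) = none) := by
  rcases int_cases' i with rfl | ⟨k, rfl⟩ | ⟨k, rfl⟩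
  · rw [planeEps_zero]
    simp [matCrystal]
  · have h := (isTailEps_toMat π k).1.eps_pos
    rw [planeEps_pos]
    exact ⟨h.1, h.2.1⟩
  · have h := (isTailEps_toMat π k).2.eps_neg
    rw [planeEps_neg]
    exact ⟨h.1, h.2.1⟩

theorem bump_of_entry {π π' : PlanePartition} {k : ℤ} {t : ℕ}
    (h : ∀ c, π'.entry c = π.entry c + if c = cell k t then 1 else 0) :
    (∀ j : ℕ, (j : ℤ) ≠ k → top π' j = top π j) ∧ (∀ j : ℕ, (-j : ℤ) ≠ k → left π' j = left π j) ∧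
    (∀ j : ℕ, (j : ℤ) = k → top π' j = bump (top π j) t) ∧
    ∀ j : ℕ, (-j : ℤ) = k → left π' j = bump (left π j) t := by
  have h1 := mem_cell_diagonal k t
  refine ⟨fun j hj => ?_, fun j hj => ?_, fun j hj => ?_, fun j hj => ?_⟩
  · funext s
    rw [top, top, h, if_neg, add_zero]
    intro h2
    rw [← h2] at h1
    push_cast at h1
    omega
  · funext s
    rw [left, left, h, if_neg, add_zero]
    intro h2
    rw [← h2] at h1
    push_cast at h1
    omega
  · funext s
    subst hj
    rw [top, bump, h]
    have : cell (j : ℤ) t = (t, t + j) := rfl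
    simp only [this, Prod.mk.injEq]
    simp only [top]
    split_ifs <;> omega
  · funext s
    subst hj
    rw [left, bump, h]
    have : cell (-(j : ℤ)) t = (t + j, t) := by
      cases j with
      | zero => rfl
      | succ j => push_cast; rw [int_neg_succ]; rfl
    simp only [this, Prod.mk.injEq]
    simp only [left]
    split_ifs <;> omega

/-- An arrow changes one boundary sequence of the growth diagram: the corner for i = 0, one of the
first row for i > 0, one of the first column for i < 0. The three cases are `corner_some`,
`strip_some` and its transpose. -/
theorem Arrow.matStep {i : ℤ} {π π' : PlanePartition} (h : Arrow i π π') :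
    MatStep i (toMat π) (toMat π') := by
  obtain ⟨t, hact, hentry⟩ := h
  obtain ⟨b1, b2, b3, b4⟩ := bump_of_entry hentry
  obtain ⟨T, hB⟩ := π.isBoundary
  rcases int_cases' i with rfl | ⟨k, rfl⟩ | ⟨k, rfl⟩
  · refine matStep_zero (Finsupp.ext fun c => ?_)
    have h1 := hact.1
    rw [Finsupp.add_apply, Finsupp.single_apply]
    have key := hB.corner_some (top' := top π') (left' := left π') t ?_ ?_
      (fun j hj => b1 j (by omega)) (fun j hj => b2 j (by omega)) (b3 0 rfl) c.1 c.2
    · change growthLabel _ _ c.1 c.2 = growthLabel _ _ c.1 c.2 + _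
      rw [key]
      congr 1
      refine if_congr ?_ rfl rfl
      rw [Prod.ext_iff]
      exact and_congr eq_comm eq_comm
    · rintro s rfl
      rw [← strip_zero_succ]
      exact hact.1
    · intro s hs
      rw [← strip_zero_succ]
      exact hact.2 (s + 1) (by omega)
  · rw [acts_pos] at hact
    have hl : left π' = left π := funext fun j => b2 j (by omega)
    obtain ⟨r, h1, h2, h3, h4, h5⟩ := hB.strip_some (top' := top π') k t hact
      (fun j hj => b1 j (by omega)) (b3 (k + 1) (by push_cast; rfl))
    rw [← hl] at h3 h4 h5
    refine matStep_pos (isTailEps_toMat π k).1 (r := r) ⟨h1, h2, ?_, ?_, ?_⟩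
    · rw [hl] at h3; rw [toMat_apply, toMat_apply, hl]; exact h3
    · rw [hl] at h4; rw [toMat_apply, toMat_apply, hl]; exact h4
    · intro s j hs; rw [hl] at h5; rw [toMat_apply, toMat_apply, hl]; exact h5 s j hs
  · rw [acts_neg] at hact
    have hl : top π' = top π := funext fun j => b1 j (by omega)
    obtain ⟨r, h1, h2, h3, h4, h5⟩ := hB.swap.strip_some (top' := left π') k t hact
      (fun j hj => b2 j (by omega)) (b4 (k + 1) (by push_cast; rfl))
    refine matStep_neg (isTailEps_toMat π k).2 (r := r)
      ⟨by rw [transposeMat_toMat]; exact h1,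
        fun s hs => by rw [transposeMat_toMat]; exact h2 s hs, ?_, ?_, ?_⟩
    · rw [transposeMat_toMat, transposeMat_toMat, hl]; exact h3
    · rw [transposeMat_toMat, transposeMat_toMat, hl]; exact h4
    · intro s j hs; rw [transposeMat_toMat, transposeMat_toMat, hl]; exact h5 s j hs

theorem exists_arrow_zero (π : PlanePartition) : ∃ π', Arrow 0 π π' := by
  obtain ⟨T, -, hT⟩ := strip_const 0 π
  obtain ⟨s, hs⟩ := exists_actsAt (t := 0) (Q := diagOut 0 π)
    (fun s hs => (hT s hs).2 (π.entry (0, 0) + 1)) (by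
      change 0 < π.entry (0, 0) + 1 - π.entry (0, 0)
      omega)
  obtain ⟨π', h, -⟩ := Acts.exists_arrow hs
  exact ⟨π', h⟩

/-- Needed because `Arrow.matStep` does not exclude that the matrix operator acts where no arrow
starts. -/
theorem matCrystal_f_toMat_none {i : ℤ} {π : PlanePartition} (h : ¬ ∃ π', Arrow i π π') :
    matCrystal.f i (toMat π) = none := by
  obtain ⟨T, hB⟩ := π.isBoundary
  have hn : ∀ t, diagIn (π.entry (0, 0) + 1) i π t - diag i π t ≤ strip i π t := by
    by_contra hcon
    push Not at hcon
    obtain ⟨t, ht⟩ := hcon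
    obtain ⟨T, -, hT⟩ := strip_const i π
    obtain ⟨s, hs⟩ := exists_actsAt (fun s hs => (hT s hs).2 _) ht
    obtain ⟨π', h1, -⟩ := Acts.exists_arrow hs
    exact h ⟨π', h1⟩
  rcases int_cases' i with rfl | ⟨k, rfl⟩ | ⟨k, rfl⟩
  · exact absurd (exists_arrow_zero π) h
  · exact (isTailEps_toMat π k).1.eps_pos.2.2 (hB.strip_none k hn)
  · rw [int_neg_succ] at hn
    refine (isTailEps_toMat π k).2.eps_neg.2.2 fun r => ?_
    rw [← transposeMat_apply, transposeMat_toMat]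
    exact hB.swap.strip_none k hn r

theorem matCrystal_f_toMat (i : ℤ) (π : PlanePartition) :
    matCrystal.f i (toMat π) = (planeCrystal.f i π).map toMat := by
  by_cases h : ∃ π', Arrow i π π'
  · obtain ⟨π', h⟩ := h
    rw [h.matStep.f, (planeCrystal_f i π π').mpr h, Option.map_some]
  · rw [matCrystal_f_toMat_none h]
    cases hf : planeCrystal.f i π with
    | none => rfl
    | some π' => exact absurd ⟨π', (planeCrystal_f i π π').mp hf⟩ h

theorem matCrystal_e_toMat (i : ℤ) (π : PlanePartition) :
    matCrystal.e i (toMat π) = (planeCrystal.e i π).map toMat := by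
  by_cases h : ∃ π', Arrow i π' π
  · obtain ⟨π', h⟩ := h
    rw [h.matStep.e, (planeCrystal_e i π π').mpr h, Option.map_some]
  · rw [(matCrystal_eps_toMat i π).2]
    · cases hf : planeCrystal.e i π with
      | none => rfl
      | some π' => exact absurd ⟨π', (planeCrystal_e i π π').mp hf⟩ h
    · by_contra h0
      exact h (exists_arrow_of_pos (Nat.pos_of_ne_zero h0))

/-- The empty plane partition. -/
def empty : PlanePartition := ⟨0, fun _ _ => le_rfl, fun _ _ => le_rfl⟩

theorem toMat_empty : toMat empty = 0 := by
  ext ⟨i, j⟩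
  have h : IsBoundary (top empty) (left empty) 0 :=
    ⟨rfl, fun _ _ => ⟨le_rfl, le_rfl⟩, fun _ _ => ⟨le_rfl, le_rfl⟩, fun _ _ => rfl,
      fun _ _ _ => rfl, fun _ _ _ => rfl⟩
  exact h.growthLabel_eq_zero i j (Or.inl (Nat.zero_le _))

/-- A removable box of the shape with residue `k` makes `ε_k` positive. -/
theorem planeEps_pos_of_corner {π : PlanePartition} {k : ℤ} {a b : ℕ} (hk : (b : ℤ) = a + k)
    (h0 : π.entry (a, b) ≠ 0) (h1 : π.entry (a, b + 1) = 0) (h2 : π.entry (a + 1, b) = 0) :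
    0 < planeEps k π := by
  obtain ⟨t, ht⟩ : ∃ t, (a, b) = cell k t := by
    match k with
    | .ofNat k => exact ⟨a, by simp only [cell, Prod.mk.injEq, true_and]; rw [Int.ofNat_eq_natCast] at hk; omega⟩
    | .negSucc k =>
      exact ⟨b, by simp only [cell, Prod.mk.injEq, and_true]; rw [Int.negSucc_eq] at hk; omega⟩
  have hD := diagonalWord k (π.entry (0, 0) + 1) π (by omega)
  obtain ⟨-, -, h3, h4⟩ := diag_neighbours k π (π.entry (0, 0) + 1) t a b
  have h3 := h3 ht
  have h4 := h4 ht
  have hzero : diagOut k π t = 0 ∧ diagIn (π.entry (0, 0) + 1) k π (t + 1) = 0 := by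
    match k with
    | .ofNat 0 =>
      simp only [cell, Prod.mk.injEq] at ht
      obtain ⟨rfl, rfl⟩ := ht
      exact ⟨h1, h2⟩
    | .ofNat (k + 1) =>
      simp only [cell, Prod.mk.injEq] at ht
      obtain ⟨rfl, rfl⟩ := ht
      refine ⟨h1, ?_⟩
      rw [← h2, diagIn]; congr 2; omega
    | .negSucc k =>
      simp only [cell, Prod.mk.injEq] at ht
      obtain ⟨rfl, rfl⟩ := ht
      refine ⟨h2, ?_⟩
      rw [← h1, diagIn]; congr 2; omega
  have hm : diag k π t ≠ 0 := by rwa [diag, ← ht]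
  have key : ∀ s, t + 1 ≤ s → 0 < strip k π s ∧ diagIn (π.entry (0, 0) + 1) k π s = 0 := by
    intro s hs
    induction s, hs using Nat.le_induction with
    | base =>
      refine ⟨?_, hzero.2⟩
      rw [strip, stripEps, hzero.1]
      omega
    | succ s hs ih =>
      have e1 := hD.le_P s
      have e2 := hD.P_le s
      refine ⟨?_, by omega⟩
      rw [strip, stripEps]
      have := ih.1
      rw [strip] at this
      omega
  obtain ⟨T, -, hT⟩ := strip_const k π
  rw [← (hT (T + t + 1) (by omega)).1]
  exact (key _ (by omega)).1

/-- A non-empty shape has a removable box, found here at the end of the last row, and its residue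
has positive ε. -/
theorem eq_empty_of_eps {π : PlanePartition} (h : ∀ i, planeEps i π = 0) : π = empty := by
  classical
  by_contra hne
  obtain ⟨T, hT⟩ := π.exists_bound
  have h00 : π.entry (0, 0) ≠ 0 := by
    intro h0
    refine hne (PlanePartition.ext (Finsupp.ext fun c => ?_))
    have := π.entry_le c
    change π.entry c = 0
    omega
  have hex : ∃ a, π.entry (a + 1, 0) = 0 := ⟨T, hT _ _ (by omega)⟩
  obtain ⟨a, ha0, ha⟩ : ∃ a, π.entry (a, 0) ≠ 0 ∧ π.entry (a + 1, 0) = 0 := by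
    refine ⟨Nat.find hex, ?_, Nat.find_spec hex⟩
    rcases hn : Nat.find hex with _ | n
    · exact h00
    · exact Nat.find_min hex (by omega)
  have hex' : ∃ b, π.entry (a, b + 1) = 0 := ⟨T, hT _ _ (by omega)⟩
  obtain ⟨b, hb0, hb⟩ : ∃ b, π.entry (a, b) ≠ 0 ∧ π.entry (a, b + 1) = 0 := by
    refine ⟨Nat.find hex', ?_, Nat.find_spec hex'⟩
    rcases hn : Nat.find hex' with _ | n
    · exact ha0
    · exact Nat.find_min hex' (by omega)
  have hdown : π.entry (a + 1, b) = 0 := by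
    have : π.entry (a + 1, b) ≤ π.entry (a + 1, 0) := π.antitone ⟨le_rfl, Nat.zero_le _⟩
    omega
  have := planeEps_pos_of_corner (k := (b : ℤ) - a) (by ring) hb0 hb hdown
  have := h ((b : ℤ) - a)
  omega

theorem exists_arrow_of_ne_empty {π : PlanePartition} (h : π ≠ empty) :
    ∃ i π', Arrow i π' π := by
  by_contra hcon
  push Not at hcon
  refine h (eq_empty_of_eps fun i => ?_)
  by_contra h0
  obtain ⟨π', h1⟩ := exists_arrow_of_pos (Nat.pos_of_ne_zero h0)
  exact hcon i π' h1

theorem planeEps_empty (i : ℤ) : planeEps i empty = 0 := by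
  by_contra h0
  obtain ⟨π', t, -, h⟩ := exists_arrow_of_pos (Nat.pos_of_ne_zero h0)
  have := h (cell i t)
  rw [if_pos rfl] at this
  change 0 = _ + 1 at this
  omega

/-- Induction along the arrows of the crystal graph. -/
theorem arrow_induction {P : PlanePartition → Prop} (h0 : P empty)
    (hs : ∀ i π π', Arrow i π π' → P π → P π') (π : PlanePartition) : P π := by
  -- The degree of the associated matrix grows by one along every arrow, so it serves as the measure
  -- of induction.
  generalize hn : matDegree (toMat π) = n
  induction n using Nat.strong_induction_on generalizing π with
  | _ n ih =>
    by_cases h : π = empty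
    · rwa [h]
    · obtain ⟨i, π', h1⟩ := exists_arrow_of_ne_empty h
      have := h1.matStep.degree
      exact hs i π' π h1 (ih _ (by omega) π' rfl)

theorem planeWt_eq (π : PlanePartition) : matWt (toMat π) = planeWt π := by
  induction π using arrow_induction with
  | h0 =>
    rw [toMat_empty]
    simp [matWt, planeWt, empty, layerWord, wordWt]
  | hs i π π' h ih => rw [h.matStep.wt, h.values.2, ih]

/-- Equal matrices have equal ε, so along an arrow ending at one plane partition the other can be
raised too; the raised ones have equal matrices, and f is single-valued. -/
theorem toMat_injective : Function.Injective toMat := by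
  intro π ρ h
  induction π using arrow_induction generalizing ρ with
  | h0 =>
    refine (eq_empty_of_eps fun i => ?_).symm
    have h1 := (matCrystal_eps_toMat i ρ).1
    rw [← h, (matCrystal_eps_toMat i empty).1, planeEps_empty] at h1
    have := WithBot.coe_injective h1
    omega
  | hs i π π' hπ ih =>
    have h1 := (matCrystal_eps_toMat i ρ).1
    rw [← h, (matCrystal_eps_toMat i π').1, hπ.values.1] at h1
    have h2 := WithBot.coe_injective h1
    obtain ⟨ρ', hρ⟩ := exists_arrow_of_pos (k := i) (π := ρ) (by omega)
    have h3 := hπ.matStep.e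
    rw [h, hρ.matStep.e, Option.some.injEq] at h3
    obtain rfl := ih h3.symm
    exact hπ.unique hρ

/-- A non-zero matrix is f_i of one of smaller degree, which has a preimage; as f_i commutes with
`toMat`, it produces a preimage. -/
theorem toMat_surjective : Function.Surjective toMat := by
  intro A
  generalize hn : matDegree A = n
  induction n using Nat.strong_induction_on generalizing A with
  | _ n ih =>
    by_cases h : A = 0
    · exact ⟨empty, by rw [h, toMat_empty]⟩
    · obtain ⟨i, A', h1⟩ := exists_matStep h
      have := h1.degree
      obtain ⟨π, rfl⟩ := ih _ (by omega) A' rfl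
      have h2 := h1.f
      rw [matCrystal_f_toMat, Option.map_eq_some_iff] at h2
      obtain ⟨π', -, h3⟩ := h2
      exact ⟨π', h3⟩

end PlanePartition

/-- The isomorphism from plane partitions to matrices. -/
def planeIso : Iso planeCrystal matCrystal where
  toEquiv := Equiv.ofBijective toMat ⟨toMat_injective, toMat_surjective⟩
  wt_eq π := by rw [planeCrystal_wt]; exact planeWt_eq π
  eps_eq i π := by rw [planeCrystal_eps]; exact (matCrystal_eps_toMat i π).1
  phi_eq i π := by
    rw [planeCrystal_phi]
    refine (matCrystal_phi i (toMat π)).trans ?_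
    rw [(matCrystal_eps_toMat i π).1, planeWt_eq, ← WithBot.coe_add]
  e_eq i π := matCrystal_e_toMat i π
  f_eq i π := matCrystal_f_toMat i π

end GlInf

end

/-! ### Demazure subsets as conditions on the shape. -/

noncomputable section

namespace GlInf

open CrystalData PlanePartition

/-- `μ` is obtained from the empty partition by adding boxes whose residues, from the last one to the
first one, are given by the list. -/
def BoxChain : List ℤ → YoungDiagram → Prop
  | [], μ => μ = ⊥
  | i :: l, μ => ∃ μ', BoxChain l μ' ∧ ∃ a b : ℕ, (b : ℤ) = a + i ∧ (a, b) ∉ μ' ∧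
      ∀ c, c ∈ μ ↔ c = (a, b) ∨ c ∈ μ'

namespace PlanePartition

theorem shape_le_iff {π : PlanePartition} {μ : YoungDiagram} :
    π.shape ≤ μ ↔ ∀ c, π.entry c ≠ 0 → c ∈ μ :=
  ⟨fun h c hc => h ((mem_shape π c).mpr hc), fun h c hc => h c ((mem_shape π c).mp hc)⟩

theorem shape_le_bot {π : PlanePartition} : π.shape ≤ ⊥ ↔ π = empty := by
  rw [shape_le_iff]
  constructor
  · intro h
    refine PlanePartition.ext (Finsupp.ext fun c => ?_)
    by_contra hc
    exact YoungDiagram.notMem_bot _ (h c hc)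
  · rintro rfl c hc
    exact absurd rfl hc

theorem Arrow.shape_le {i : ℤ} {π π' : PlanePartition} (h : Arrow i π π') {μ : YoungDiagram}
    (hμ : π'.shape ≤ μ) : π.shape ≤ μ := by
  rw [shape_le_iff] at hμ ⊢
  intro c hc
  have := h.entry_le_entry c
  exact hμ c (by omega)

/-- A lowering operator whose residue is that of a removable box of `μ` preserves the plane
partitions of shape contained in `μ`. -/
theorem Arrow.shape_le' {i : ℤ} {π π' : PlanePartition} (h : Arrow i π π') {μ μ' : YoungDiagram}
    {a b : ℕ} (hab : (b : ℤ) = a + i) (hnot : (a, b) ∉ μ')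
    (hμ : ∀ c, c ∈ μ ↔ c = (a, b) ∨ c ∈ μ') (hπ : π.shape ≤ μ) : π'.shape ≤ μ := by
  rw [shape_le_iff] at hπ ⊢
  obtain ⟨t, -, hentry⟩ := h
  intro c hc
  by_cases h0 : π.entry c = 0
  · have h1 := hentry c
    have hct : c = cell i t := by
      by_contra hne
      rw [if_neg hne] at h1
      omega
    have hres := mem_cell_diagonal i t
    rw [← hct] at hres
    obtain ⟨x, y⟩ := c
    dsimp only at hres
    have hab' : (a, b) ∈ μ := (hμ _).mpr (Or.inl rfl)
    rcases Nat.lt_or_ge a x with hx | hx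
    -- The new cell c would lie beyond (a,b) on the diagonal. Then the cell above c was already in
    -- the shape, so (a,b+1) belongs to μ and hence to μ', which forces (a,b) into μ'.
    · exfalso
      obtain ⟨x, rfl⟩ : ∃ x', x = x' + 1 := ⟨x - 1, by omega⟩
      have h2 := π'.col x y
      have h3 := hentry (x, y)
      rw [if_neg (by rw [← hct]; simp)] at h3
      have h4 : (x, y) ∈ μ := hπ _ (by omega)
      have h5 : (a, b + 1) ∈ μ := μ.up_left_mem (by omega) (by omega) h4
      rcases (hμ _).mp h5 with h6 | h6
      · simp at h6
      · exact hnot (μ'.up_left_mem le_rfl (Nat.le_succ b) h6)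
    · exact μ.up_left_mem hx (by omega) hab'
  · exact hπ c h0

variable {B : Type}

/-- The crystal C is only required to parametrise, through `v`, a set of plane partitions closed
under raising operators. One inclusion is `Arrow.shape_le'`; the other raises by e_i as long as
possible. -/
theorem demazure_eq (C : CrystalData B) (v : B → PlanePartition) (hinj : Function.Injective v)
    (hf : ∀ i b b', C.f i b = some b' ↔ Arrow i (v b) (v b'))
    (hdown : ∀ i b π, Arrow i π (v b) → ∃ b', v b' = π) (h : B) (hh : v h = empty) (l : List ℤ)
    (μ : YoungDiagram) (hl : BoxChain l μ) : C.demazure h l = {b | (v b).shape ≤ μ} := by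
  induction l generalizing μ with
  | nil =>
    rw [BoxChain] at hl
    subst hl
    ext b
    simp only [demazure, Set.mem_singleton_iff, Set.mem_ofPred_eq, shape_le_bot, ← hh]
    exact hinj.eq_iff.symm
  | cons i l ih =>
    obtain ⟨μ', hl, a, b, hab, hnot, hμ⟩ := hl
    ext x
    simp only [demazure, ih μ' hl, Set.mem_ofPred_eq]
    constructor
    · rintro ⟨y, hy, m, hm⟩
      induction m generalizing x with
      | zero =>
        obtain rfl : y = x := Option.some.inj hm
        exact hy.trans fun c hc => (hμ c).mpr (Or.inr hc)
      | succ m ihm =>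
        rw [fPow, Option.bind_eq_some_iff] at hm
        obtain ⟨z, hz, hzx⟩ := hm
        exact ((hf i z x).mp hzx).shape_le' hab hnot hμ (ihm z hz)
    · intro hx
      generalize hn : planeEps i (v x) = n
      induction n generalizing x with
      | zero =>
        -- When ε_i = 0 the box (a,b) is not in the shape: it is a corner of μ, so it would be a
        -- removable box of residue i. The shape is therefore already inside μ'.
        refine ⟨x, ?_, 0, rfl⟩
        rw [shape_le_iff] at hx ⊢
        intro c hc
        rcases (hμ c).mp (hx c hc) with rfl | h1
        · exfalso
          have hout : ∀ c' : ℕ × ℕ, c' ≠ (a, b) → (a, b) ≤ c' → (v x).entry c' = 0 := by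
            intro c' h1 h2
            by_contra h3
            rcases (hμ c').mp (hx c' h3) with h4 | h4
            · exact h1 h4
            · exact hnot (μ'.isLowerSet h2 h4)
          have := planeEps_pos_of_corner hab hc (hout (a, b + 1) (by simp) ⟨le_rfl, Nat.le_succ b⟩)
            (hout (a + 1, b) (by simp) ⟨Nat.le_succ a, le_rfl⟩)
          omega
        · exact h1
      | succ n ihn =>
        obtain ⟨π, hπ⟩ := exists_arrow_of_pos (k := i) (π := v x) (by omega)
        obtain ⟨z, rfl⟩ := hdown i x π hπ
        have := hπ.values.1
        obtain ⟨y, hy, m, hm⟩ := ihn z (hπ.shape_le hx) (by omega)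
        refine ⟨y, hy, m + 1, ?_⟩
        rw [fPow, hm]
        exact (hf i z x).mpr hπ

end PlanePartition

namespace CrystalData

variable {B₁ B₂ : Type}

/-- A bijection that preserves the arrows in both directions is an isomorphism. -/
def Iso.ofArrows {C₁ : CrystalData B₁} {C₂ : CrystalData B₂} (Φ : B₁ ≃ B₂)
    (wt_eq : ∀ b, C₂.wt (Φ b) = C₁.wt b) (eps_eq : ∀ i b, C₂.eps i (Φ b) = C₁.eps i b)
    (phi_eq : ∀ i b, C₂.phi i (Φ b) = C₁.phi i b)
    (e_iff : ∀ i b b', C₂.e i (Φ b) = some (Φ b') ↔ C₁.e i b = some b')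
    (f_iff : ∀ i b b', C₂.f i (Φ b) = some (Φ b') ↔ C₁.f i b = some b') : Iso C₁ C₂ where
  toEquiv := Φ
  wt_eq := wt_eq
  eps_eq := eps_eq
  phi_eq := phi_eq
  e_eq i b := by
    refine Option.ext fun c => ?_
    obtain ⟨c, rfl⟩ := Φ.surjective c
    refine (e_iff i b c).trans ?_
    rw [Option.map_eq_some_iff]
    exact ⟨fun h => ⟨c, h, rfl⟩, fun ⟨c', h1, h2⟩ => by rwa [← Φ.injective h2]⟩
  f_eq i b := by
    refine Option.ext fun c => ?_
    obtain ⟨c, rfl⟩ := Φ.surjective c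
    refine (f_iff i b c).trans ?_
    rw [Option.map_eq_some_iff]
    exact ⟨fun h => ⟨c, h, rfl⟩, fun ⟨c', h1, h2⟩ => by rwa [← Φ.injective h2]⟩

theorem Iso.f_iff {C₁ : CrystalData B₁} {C₂ : CrystalData B₂} (Φ : Iso C₁ C₂) (i : ℤ) (b b' : B₁) :
    C₂.f i (Φ.toEquiv b) = some (Φ.toEquiv b') ↔ C₁.f i b = some b' := by
  have h := Φ.f_eq i b
  change C₂.f i (Φ.toEquiv b) = Option.map Φ.toEquiv _ at h
  rw [h, Option.map_eq_some_iff]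
  exact ⟨fun ⟨c, h1, h2⟩ => by rwa [← Φ.toEquiv.injective h2], fun h => ⟨b', h, rfl⟩⟩

theorem Iso.e_iff {C₁ : CrystalData B₁} {C₂ : CrystalData B₂} (Φ : Iso C₁ C₂) (i : ℤ) (b b' : B₁) :
    C₂.e i (Φ.toEquiv b) = some (Φ.toEquiv b') ↔ C₁.e i b = some b' := by
  have h := Φ.e_eq i b
  change C₂.e i (Φ.toEquiv b) = Option.map Φ.toEquiv _ at h
  rw [h, Option.map_eq_some_iff]
  exact ⟨fun ⟨c, h1, h2⟩ => by rwa [← Φ.toEquiv.injective h2], fun h => ⟨b', h, rfl⟩⟩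

/-- The restriction of an isomorphism. -/
def Iso.restrict {C₁ : CrystalData B₁} {C₂ : CrystalData B₂} (Φ : Iso C₁ C₂) (S₁ : Set B₁)
    (S₂ : Set B₂) (h : ∀ b, b ∈ S₁ ↔ Φ.toEquiv b ∈ S₂) :
    Iso (C₁.restrict S₁) (C₂.restrict S₂) :=
  Iso.ofArrows (Φ.toEquiv.subtypeEquiv h) (fun b => Φ.wt_eq b) (fun i b => Φ.eps_eq i b)
    (fun i b => Φ.phi_eq i b)
    (fun i b b' => by rw [restrict_e, restrict_e]; exact Φ.e_iff i b b')
    (fun i b b' => by rw [restrict_f, restrict_f]; exact Φ.f_iff i b b')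

end CrystalData

/-- The Demazure subset of the crystal of matrices. -/
theorem mem_demazure_matCrystal {l : List ℤ} {μ : YoungDiagram} (hl : BoxChain l μ)
    (π : PlanePartition) :
    π ∈ inside μ ↔ planeIso.toEquiv π ∈ matCrystal.demazure 0 l := by
  rw [demazure_eq matCrystal planeIso.toEquiv.symm planeIso.toEquiv.symm.injective
    (fun i b b' => ?_) (fun i b π h => ⟨planeIso.toEquiv π, planeIso.toEquiv.symm_apply_apply π⟩)
    0 ?_ l μ hl]
  · rw [Set.mem_ofPred_eq, planeIso.toEquiv.symm_apply_apply]
    rfl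
  · rw [Equiv.symm_apply_eq]
    exact toMat_empty.symm
  · rw [← planeCrystal_f, ← planeIso.f_iff, Equiv.apply_symm_apply, Equiv.apply_symm_apply]

end GlInf

end

/-! ### 𝐁(nΛ_0) as the set of plane partitions with at most n layers. -/

noncomputable section

namespace GlInf

open CrystalData PlanePartition

/-! ### The component of the empty partition -/

/-- The word ends like `H_{Λ_0}`. -/
def SemiInf.IsNeutral (w : SemiInf) : Prop := ∃ N, ∀ k, N ≤ k → w.toFun k = neg k

theorem SemiInf.isNeutral_H : SemiInf.H.IsNeutral := ⟨0, fun _ _ => rfl⟩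

/-- An operator only exchanges the letters of index i, and the letters -(k+1) with k ≥ |i| + 2 are
neither of them. So the normalisation of the tail is constant on a component. -/
theorem isNeutral_iff_of_f {i : ℤ} {x y : SemiInf} (h : fock.f i x = some y) :
    x.IsNeutral ↔ y.IsNeutral := by
  classical
  have hy : ∀ k, y.toFun k = if x.toFun k = lo i then hi i else x.toFun k := by
    simp only [fock] at h
    split_ifs at h
    rw [← Option.some.inj h]
    intro k
    rfl
  have hne : ∀ k : ℕ, i.natAbs + 2 ≤ k → neg k ≠ lo i ∧ neg k ≠ hi i := by
    intro k hk
    rw [Ne, Ne, ← Subtype.coe_inj, ← Subtype.coe_inj]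
    simp only [neg, lo, hi]
    constructor <;> split_ifs <;> omega
  constructor
  · rintro ⟨N, hN⟩
    refine ⟨N + i.natAbs + 2, fun k hk => ?_⟩
    rw [hy, hN k (by omega), if_neg (hne k (by omega)).1]
  · rintro ⟨N, hN⟩
    refine ⟨N + i.natAbs + 2, fun k hk => ?_⟩
    have h1 := hN k (by omega)
    rw [hy] at h1
    split_ifs at h1 with h2
    · exact absurd h1.symm (hne k (by omega)).2
    · exact h1

/-- The Young diagram with given row lengths. -/
def youngOfRows (r : ℕ → ℕ) (hr : Antitone r) (N : ℕ) : YoungDiagram where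
  cells := (Finset.range N ×ˢ Finset.range (r 0)).filter fun c => c.2 < r c.1
  isLowerSet := by
    rintro ⟨a, b⟩ ⟨a', b'⟩ ⟨h1, h2⟩ h
    simp only [Finset.coe_filter, Finset.mem_product, Finset.mem_range, Set.mem_ofPred_eq] at *
    have := hr h1
    omega

theorem rowLen_youngOfRows (r : ℕ → ℕ) (hr : Antitone r) (N : ℕ) (hN : ∀ k, N ≤ k → r k = 0)
    (k : ℕ) : (youngOfRows r hr N).rowLen k = r k := by
  refine eq_of_forall_lt_iff fun j => ?_
  rw [← YoungDiagram.mem_iff_lt_rowLen, ← YoungDiagram.mem_cells, youngOfRows]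
  simp only [Finset.mem_filter, Finset.mem_product, Finset.mem_range]
  have h1 := hr (Nat.zero_le k)
  have h2 := hN k
  omega

theorem SemiInf.IsNeutral.exists_ofPartition {w : SemiInf} (h : w.IsNeutral) :
    ∃ μ, ofPartition μ = w := by
  obtain ⟨N, hN⟩ := h
  -- Inverse of `skipZero`; row k of the partition will have length m k + k + 1.
  let m : ℕ → ℤ := fun k => if (w.toFun k : ℤ) < 0 then w.toFun k else w.toFun k - 1
  have hm : ∀ k, skipZero (m k) = w.toFun k := by
    intro k
    have := (w.toFun k).2
    refine Subtype.ext ?_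
    simp only [skipZero, m]
    split_ifs <;> omega
  have hanti : ∀ k, m (k + 1) < m k := by
    intro k
    have h1 : (w.toFun (k + 1) : ℤ) < w.toFun k := w.anti (Nat.lt_succ_self k)
    have := (w.toFun k).2
    simp only [m]
    split_ifs <;> omega
  have hz : ∀ k, N ≤ k → m k + (k + 1) = 0 := by
    intro k hk
    simp only [m, hN k hk, neg]
    split_ifs <;> omega
  have hmono : Antitone fun k : ℕ => m k + (k + 1) := antitone_nat_of_succ_le fun k => by
    have := hanti k
    push_cast
    omega
  have hpos : ∀ k, 0 ≤ m k + (k + 1) := by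
    intro k
    have h1 := hmono (Nat.le_add_right k N)
    have h2 := hz (k + N) (by omega)
    dsimp only at h1
    omega
  have hr : Antitone fun k : ℕ => (m k + (k + 1)).toNat :=
    fun a b hab => Int.toNat_le_toNat (hmono hab)
  refine ⟨youngOfRows _ hr N, SemiInf.ext (funext fun k => ?_)⟩
  have hrow := rowLen_youngOfRows _ hr N (fun k hk => by rw [hz k hk]; rfl) k
  rw [← hm k]
  simp only [ofPartition]
  rw [hrow]
  congr 1
  have := hpos k
  omega

theorem ofPartition_mem_BLam0 (μ : YoungDiagram) : ofPartition μ ∈ BLam0 := by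
  classical
  generalize hn : μ.cells.card = n
  induction n generalizing μ with
  | zero =>
    have : μ = ⊥ := YoungDiagram.ext (Finset.card_eq_zero.mp hn)
    rw [this, ofPartition_bot]
    exact Relation.EqvGen.refl _
  | succ n ih =>
    -- A maximal cell is a removable box; restoring it is an arrow of residue b - a.
    obtain ⟨⟨a, b⟩, hc⟩ := μ.cells.exists_maximal (Finset.card_pos.mp (by omega))
    let μ' : YoungDiagram := ⟨μ.cells.erase (a, b), by
      intro x y hyx hx
      simp only [Finset.coe_erase, Set.mem_sdiff, Finset.mem_coe, Set.mem_singleton_iff] at hx ⊢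
      refine ⟨μ.isLowerSet hyx hx.1, ?_⟩
      rintro rfl
      exact hx.2 (le_antisymm (hc.2 hx.1 hyx) hyx)⟩
    have h1 : ofPartition μ' ∈ BLam0 := ih μ' (by
      change (μ.cells.erase (a, b)).card = n
      rw [Finset.card_erase_of_mem hc.1, hn]
      rfl)
    refine Relation.EqvGen.trans _ _ _ h1 (Relation.EqvGen.rel _ _ ⟨(b : ℤ) - a, ?_⟩)
    refine fock_f_ofPartition μ' μ _ a b (by ring) ?_ fun c => ?_
    · rw [← YoungDiagram.mem_cells]
      exact Finset.notMem_erase _ _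
    · rw [← YoungDiagram.mem_cells, ← YoungDiagram.mem_cells]
      change _ ↔ _ ∨ c ∈ μ.cells.erase (a, b)
      rw [Finset.mem_erase]
      by_cases h : c = (a, b)
      · rw [h]; simpa using hc.1
      · simp [h]

theorem mem_BLam0_iff (w : SemiInf) : w ∈ BLam0 ↔ ∃ μ, ofPartition μ = w := by
  constructor
  · intro h
    refine SemiInf.IsNeutral.exists_ofPartition ?_
    have key : ∀ x y, Relation.EqvGen (fun x y => ∃ i, fock.f i x = some y) x y →
        (x.IsNeutral ↔ y.IsNeutral) := by
      intro x y hxy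
      induction hxy with
      | rel x y h => exact isNeutral_iff_of_f h.choose_spec
      | refl x => exact Iff.rfl
      | symm x y _ ih => exact ih.symm
      | trans x y z _ _ ih1 ih2 => exact ih1.trans ih2
    exact (key _ _ h).mp SemiInf.isNeutral_H
  · rintro ⟨μ, rfl⟩
    exact ofPartition_mem_BLam0 μ

theorem rowLen_mono {μ ν : YoungDiagram} : μ ≤ ν ↔ ∀ k, μ.rowLen k ≤ ν.rowLen k := by
  constructor
  · intro h k
    refine le_of_forall_lt fun j hj => ?_
    exact YoungDiagram.mem_iff_lt_rowLen.mp (h (YoungDiagram.mem_iff_lt_rowLen.mpr hj))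
  · rintro h ⟨a, b⟩ hc
    exact YoungDiagram.mem_iff_lt_rowLen.mpr
      ((YoungDiagram.mem_iff_lt_rowLen.mp hc).trans_le (h a))

theorem skipZero_le_skipZero {a b : ℤ} : skipZero a ≤ skipZero b ↔ a ≤ b := by
  rw [← Subtype.coe_le_coe]
  simp only [skipZero]
  split_ifs <;> omega

theorem ofPartition_le {μ ν : YoungDiagram} :
    (∀ k, (ofPartition μ).toFun k ≤ (ofPartition ν).toFun k) ↔ μ ≤ ν := by
  rw [rowLen_mono]
  refine forall_congr' fun k => ?_
  simp only [ofPartition, skipZero_le_skipZero]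
  omega

/-! ### The layers of a plane partition as an element of `𝐁(nΛ_0)` -/

/-- The plane partition with given layers. -/
theorem exists_planePartition (μ : ℕ → YoungDiagram) (hμ : Antitone μ) (n : ℕ) (hn : μ n = ⊥) :
    ∃ π : PlanePartition, π.entry (0, 0) ≤ n ∧ ∀ k, π.layer k = μ k := by
  classical
  have hex : ∀ c, ∃ k, c ∉ μ k := fun c => ⟨n, by rw [hn]; exact YoungDiagram.notMem_bot c⟩
  have hlt : ∀ c k, k < Nat.find (hex c) ↔ c ∈ μ k := by
    intro c k
    constructor
    · intro h
      exact not_not.mp (Nat.find_min (hex c) h)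
    · intro h
      by_contra h1
      exact Nat.find_spec (hex c) (hμ (not_lt.mp h1) h)
  -- The entry at c is the number of layers that contain c, obtained as the first layer not
  -- containing it.
  let g : ℕ × ℕ →₀ ℕ := Finsupp.ofSupportFinite (fun c => Nat.find (hex c)) (by
    refine (μ 0).cells.finite_toSet.subset fun c hc => ?_
    exact (hlt c 0).mp (Nat.pos_of_ne_zero hc))
  have hg : ∀ c k, k < g c ↔ c ∈ μ k := hlt
  let π : PlanePartition := ⟨g,
    fun i j => le_of_forall_lt fun k hk => (hg _ _).mpr
      ((μ k).up_left_mem le_rfl (Nat.le_succ j) ((hg _ _).mp hk)),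
    fun i j => le_of_forall_lt fun k hk => (hg _ _).mpr
      ((μ k).up_left_mem (Nat.le_succ i) le_rfl ((hg _ _).mp hk))⟩
  refine ⟨π, ?_, fun k => YoungDiagram.ext (Finset.ext fun c => ?_)⟩
  · by_contra h
    have h1 := (hg (0, 0) n).mp (not_le.mp h)
    rw [hn] at h1
    exact YoungDiagram.notMem_bot _ h1
  · rw [YoungDiagram.mem_cells, YoungDiagram.mem_cells, mem_layer]
    exact hg c k

theorem layerWord_eq_map (n : ℕ) (π : PlanePartition) :
    layerWord n π = (List.range n).map fun k => ofPartition (π.layer k) := by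
  rw [layerWord, ← List.map_eq_flatMap, ← List.range_eq_range']

theorem layerWord_mem (n : ℕ) (π : PlanePartition) : layerWord n π ∈ BnLam0 n := by
  rw [layerWord_eq_map]
  refine ⟨by simp, fun w hw => ?_, ?_⟩
  · obtain ⟨k, -, rfl⟩ := List.mem_map.mp hw
    exact ofPartition_mem_BLam0 _
  · rw [List.isChain_iff_getElem]
    intro k hk
    simp only [List.getElem_map, List.getElem_range]
    refine ofPartition_le.mpr fun c hc => ?_
    rw [mem_layer] at hc ⊢
    omega

theorem exists_layerWord {n : ℕ} {v : List SemiInf} (hv : v ∈ BnLam0 n) :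
    ∃ π : PlanePartition, π.entry (0, 0) ≤ n ∧ layerWord n π = v := by
  classical
  obtain ⟨hlen, hmem, hchain⟩ := hv
  have hex : ∀ k, ∃ μ : YoungDiagram, (∀ h : k < v.length, ofPartition μ = v[k]) ∧
      (v.length ≤ k → μ = ⊥) := by
    intro k
    by_cases h : k < v.length
    · obtain ⟨μ, hμ⟩ := (mem_BLam0_iff _).mp (hmem v[k] (List.getElem_mem h))
      exact ⟨μ, fun _ => hμ, fun h' => by omega⟩
    · exact ⟨⊥, fun h' => absurd h' h, fun _ => rfl⟩
  choose μ h1 h2 using hex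
  rw [List.isChain_iff_getElem] at hchain
  have hanti : Antitone μ := antitone_nat_of_succ_le fun k => by
    by_cases h : k + 1 < v.length
    · rw [← ofPartition_le, h1 k (by omega), h1 (k + 1) h]
      exact hchain k h
    · rw [h2 (k + 1) (by omega)]
      exact bot_le
  obtain ⟨π, h3, h4⟩ := exists_planePartition μ hanti n (h2 n hlen.le)
  refine ⟨π, h3, ?_⟩
  rw [layerWord_eq_map]
  refine List.ext_getElem (by simp [hlen]) fun k hk hk' => ?_
  simp only [List.getElem_map, List.getElem_range]
  rw [h4, h1]

/-- Plane partitions with at most `n` layers, as elements of `𝐁(nΛ_0)`. -/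
def layersEquiv (n : ℕ) : {π : PlanePartition // π.entry (0, 0) ≤ n} ≃ BnLam0 n :=
  Equiv.ofBijective (fun π => ⟨layerWord n π.1, layerWord_mem n π.1⟩)
    ⟨fun π π' h => Subtype.ext (layerWord_injective π.2 π'.2 (congrArg Subtype.val h)),
      fun v => by
        obtain ⟨π, h1, h2⟩ := exists_layerWord v.2
        exact ⟨⟨π, h1⟩, Subtype.ext h2⟩⟩

theorem layersEquiv_val (n : ℕ) (π : {π : PlanePartition // π.entry (0, 0) ≤ n}) :
    (layersEquiv n π).1 = layerWord n π.1 := rfl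

theorem BnLam0Crystal_f (n : ℕ) (i : ℤ) (π π' : {π : PlanePartition // π.entry (0, 0) ≤ n}) :
    (BnLam0Crystal n).f i (layersEquiv n π) = some (layersEquiv n π') ↔ Arrow i π.1 π'.1 := by
  rw [BnLam0Crystal, restrict_f]
  exact wordF_layerWord π.2 π'.2

theorem BnLam0Crystal_e (n : ℕ) (i : ℤ) (π π' : {π : PlanePartition // π.entry (0, 0) ≤ n}) :
    (BnLam0Crystal n).e i (layersEquiv n π) = some (layersEquiv n π') ↔ Arrow i π'.1 π.1 := by
  rw [BnLam0Crystal, restrict_e]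
  exact wordE_layerWord π.2 π'.2

/-- The Demazure subset of `𝐁(nΛ_0)`. -/
theorem mem_demazure_BnLam0 {l : List ℤ} {μ : YoungDiagram} (hl : BoxChain l μ) (n : ℕ)
    (π : {π : PlanePartition // π.entry (0, 0) ≤ n}) :
    layersEquiv n π ∈ (BnLam0Crystal n).demazure (Hn n) l ↔ π.1.shape ≤ μ := by
  rw [demazure_eq (BnLam0Crystal n) (fun v => ((layersEquiv n).symm v).1)
    (Subtype.val_injective.comp (layersEquiv n).symm.injective) (fun i b b' => ?_)
    (fun i b ρ h => ?_) (Hn n) ?_ l μ hl]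
  · rw [Set.mem_ofPred_eq, Equiv.symm_apply_apply]
  · have : (layersEquiv n).symm (Hn n) = ⟨empty, Nat.zero_le _⟩ := by
      rw [Equiv.symm_apply_eq]
      refine Subtype.ext ?_
      rw [layersEquiv_val, layerWord_eq_map]
      simp only [layer_eq_bot (π := empty) (Nat.zero_le _), ofPartition_bot]
      simp [Hn]
    rw [this]
  · rw [← BnLam0Crystal_f, Equiv.apply_symm_apply, Equiv.apply_symm_apply]
  -- Closure under raising: an arrow never decreases the corner entry, so its source also has at
  -- most n layers.
  · have h1 := (h.entry_le_entry (0, 0)).trans ((layersEquiv n).symm b).2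
    exact ⟨layersEquiv n ⟨ρ, h1⟩, by rw [Equiv.symm_apply_apply]⟩

/-- The plane partitions in a given shape with entries at most `n` form a Demazure crystal. -/
def insideLEIso {l : List ℤ} {μ : YoungDiagram} (hl : BoxChain l μ) (n : ℕ) :
    Iso (planeCrystal.restrict (insideLE μ n))
      (((BnLam0Crystal n).restrict ((BnLam0Crystal n).demazure (Hn n) l)).tensor
        (T (-((n : ℤ) • Lam0)))) := by
  have hphi : ∀ i (b : (BnLam0Crystal n).demazure (Hn n) l),
      ((BnLam0Crystal n).restrict ((BnLam0Crystal n).demazure (Hn n) l)).phi i b =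
        ((natPhi (fockEps i) (fockPhi i) b.1.1 : ℤ) : WithBot ℤ) :=
    fun i b => (fock_semi i).words.phi_eq b.1.1
  let Φ : insideLE μ n ≃ (BnLam0Crystal n).demazure (Hn n) l × Unit :=
    { toFun := fun π => (⟨layersEquiv n ⟨π.1, π.2.2⟩,
        (mem_demazure_BnLam0 hl n ⟨π.1, π.2.2⟩).mpr π.2.1⟩, ())
      invFun := fun v => ⟨((layersEquiv n).symm v.1.1).1, by
        refine ⟨(mem_demazure_BnLam0 hl n _).mp ?_, ((layersEquiv n).symm v.1.1).2⟩
        rw [Equiv.apply_symm_apply]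
        exact v.1.2⟩
      left_inv := fun π => by simp
      right_inv := fun v => by simp }
  have hval : ∀ π : insideLE μ n, (Φ π).1.1.1 = layerWord n π.1 := fun π => rfl
  refine Iso.ofArrows Φ (fun π => ?_) (fun i π => ?_) (fun i π => ?_) (fun i π π' => ?_)
    (fun i π π' => ?_)
  · refine Eq.trans ?_ (planeCrystal_wt π.1).symm
    rw [← wordWt_layerWord n π.1 π.2.2, sub_eq_add_neg]
    rfl
  · refine Eq.trans ?_ (planeCrystal_eps i π.1).symm
    rw [← natEps_layerWord i n π.1 π.2.2]
    exact (tensor_T _ _ i (Φ π).1 () (hphi i _)).1.trans ((fock_semi i).words.eps_eq _)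
  · refine Eq.trans ?_ (planeCrystal_phi i π.1).symm
    rw [← natEps_layerWord i n π.1 π.2.2, ← wordWt_layerWord n π.1 π.2.2]
    refine (tensor_T _ _ i (Φ π).1 () (hphi i _)).2.1.trans ?_
    rw [hphi, hval, ← WithBot.coe_add, sub_eq_add_neg, pairing_add,
      ((fock_semi i).word_values _).2.2]
    congr 1
    ring
  · refine Iff.trans ?_ (restrict_e _ _ i π π').symm
    rw [planeCrystal_e]
    change _ = some ((Φ π').1, ()) ↔ _
    rw [show Φ π = ((Φ π).1, ()) from rfl, (tensor_T _ _ i (Φ π).1 () (hphi i _)).2.2.1]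
    refine Iff.trans ?_ (BnLam0Crystal_e n i ⟨π.1, π.2.2⟩ ⟨π'.1, π'.2.2⟩)
    refine Iff.trans ?_ (restrict_e _ _ i (Φ π).1 (Φ π').1)
    rw [Option.map_eq_some_iff]
    exact ⟨fun ⟨c, h1, h2⟩ => by rw [h1, (Prod.mk.inj h2).1], fun h => ⟨_, h, rfl⟩⟩
  · refine Iff.trans ?_ (restrict_f _ _ i π π').symm
    rw [planeCrystal_f]
    change _ = some ((Φ π').1, ()) ↔ _
    rw [show Φ π = ((Φ π).1, ()) from rfl, (tensor_T _ _ i (Φ π).1 () (hphi i _)).2.2.2]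
    refine Iff.trans ?_ (BnLam0Crystal_f n i ⟨π.1, π.2.2⟩ ⟨π'.1, π'.2.2⟩)
    refine Iff.trans ?_ (restrict_f _ _ i (Φ π).1 (Φ π').1)
    rw [Option.map_eq_some_iff]
    exact ⟨fun ⟨c, h1, h2⟩ => by rw [h1, (Prod.mk.inj h2).1], fun h => ⟨_, h, rfl⟩⟩

end GlInf

end

/-! ### From reduced expressions to sequences of boxes. -/

noncomputable section

namespace GlInf

open CrystalData PlanePartition

/-! ### Reduced expressions of minimal coset representatives -/

/-- The product of simple reflections. -/
def reflProd (l : List ℤ) : Equiv.Perm NZ := (l.map simpleRefl).prod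

theorem reflProd_cons (i : ℤ) (l : List ℤ) : reflProd (i :: l) = simpleRefl i * reflProd l := by
  rw [reflProd, List.map_cons, List.prod_cons, reflProd]

theorem simpleRefl_mul_self (i : ℤ) : simpleRefl i * simpleRefl i = 1 := Equiv.swap_mul_self _ _

theorem lo_lt_hi (i : ℤ) : lo i < hi i := by
  rw [← Subtype.coe_lt_coe]
  simp only [lo, hi]
  split_ifs <;> omega

theorem coe_simpleRefl (i : ℤ) (x : NZ) : ((simpleRefl i x : NZ) : ℤ) =
    if (x : ℤ) = lo i then (hi i : ℤ) else if (x : ℤ) = hi i then (lo i : ℤ) else x := by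
  rw [simpleRefl, Equiv.swap_apply_def]
  simp only [Subtype.coe_inj]
  split_ifs <;> rfl

/-- A transposition of neighbours reverses the order of that one pair only. -/
theorem simpleRefl_lt {i : ℤ} {x y : NZ} (h : x < y) (hne : ¬ (x = lo i ∧ y = hi i)) :
    simpleRefl i x < simpleRefl i y := by
  have hx := x.2
  have hy := y.2
  rw [← Subtype.coe_lt_coe] at h ⊢
  rw [← Subtype.coe_inj, ← Subtype.coe_inj] at hne
  rw [coe_simpleRefl, coe_simpleRefl]
  simp only [lo, hi] at *
  split_ifs at * <;> omega

/-- A reversed pair of arguments gives a shorter expression. -/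
theorem exchange (l : List ℤ) {a b : NZ} (hab : a < b) (h : reflProd l b < reflProd l a) :
    ∃ l' : List ℤ, l'.length + 1 = l.length ∧ reflProd l' = reflProd l * Equiv.swap a b := by
  induction l with
  | nil => exact absurd h (not_lt.mpr hab.le)
  | cons i t ih =>
    rw [reflProd_cons] at h ⊢
    rcases lt_trichotomy (reflProd t a) (reflProd t b) with h1 | h1 | h1
    · by_cases h2 : reflProd t a = lo i ∧ reflProd t b = hi i
      · refine ⟨t, rfl, ?_⟩
        rw [mul_assoc, Equiv.mul_swap_eq_swap_mul, h2.1, h2.2, ← simpleRefl, ← mul_assoc,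
          simpleRefl_mul_self, one_mul]
      · exact absurd (simpleRefl_lt h1 h2) (not_lt.mpr h.le)
    · exact absurd ((reflProd t).injective h1) hab.ne
    · obtain ⟨t', h2, h3⟩ := ih h1
      exact ⟨i :: t', by rw [List.length_cons, List.length_cons, h2],
        by rw [reflProd_cons, h3, mul_assoc]⟩

/-- The list is a reduced expression of a permutation that increases on the negative and on the
positive integers. -/
structure IsMinimal (l : List ℤ) : Prop where
  reduced : ∀ l', reflProd l' = reflProd l → l.length ≤ l'.length
  lt : ∀ i, i ≠ 0 → reflProd l (lo i) < reflProd l (hi i)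

theorem isMinimal_of_isReducedExpr {w : Equiv.Perm NZ} (hw : w ∈ minimalReps Lam0) {l : List ℤ}
    (hl : IsReducedExpr w l) : IsMinimal l := by
  have hle : ∀ l', length (reflProd l') ≤ l'.length := fun l' => Nat.sInf_le ⟨l', rfl, rfl⟩
  have hw' : reflProd l = w := hl.1
  refine ⟨fun l' h => ?_, fun i hi0 => ?_⟩
  · rw [hl.2, ← hw', ← h]
    exact hle l'
  · have h1 := hw.2 i (by
      have : pairing Lam0 i = 0 := by simp [pairing, Lam0, hi0]
      rw [reflect, this, zero_smul, sub_zero])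
    by_contra hcon
    have h2 : reflProd l (hi i) < reflProd l (lo i) :=
      lt_of_le_of_ne (not_lt.mp hcon) fun h =>
        lo_ne_hi i ((reflProd l).injective h).symm
    obtain ⟨l', h3, h4⟩ := exchange l (lo_lt_hi i) h2
    have h5 := hle l'
    rw [h4, hw', ← simpleRefl] at h5
    have := hl.2
    omega

/-- If t reversed a pair lo j, hi j with j ≠ 0, the exchange could be applied twice: once to t, and
once to the resulting expression of w s_j, which reverses that pair because w does not. This gives
an expression of w s_j s_j = w that is two letters too short. -/
theorem IsMinimal.tail {i : ℤ} {t : List ℤ} (h : IsMinimal (i :: t)) : IsMinimal t := by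
  refine ⟨fun l' hl' => ?_, fun j hj => ?_⟩
  · have := h.reduced (i :: l') (by rw [reflProd_cons, reflProd_cons, hl'])
    simpa using this
  · by_contra hcon
    have h2 : reflProd t (hi j) < reflProd t (lo j) :=
      lt_of_le_of_ne (not_lt.mp hcon) fun h =>
        lo_ne_hi j ((reflProd t).injective h).symm
    obtain ⟨t', h3, h4⟩ := exchange t (lo_lt_hi j) h2
    have h5 : reflProd (i :: t') = reflProd (i :: t) * simpleRefl j := by
      rw [reflProd_cons, h4, ← mul_assoc, ← reflProd_cons]
      rfl
    obtain ⟨l'', h6, h7⟩ := exchange (i :: t') (lo_lt_hi j) (by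
      rw [h5, Equiv.Perm.mul_apply, Equiv.Perm.mul_apply, simpleRefl, Equiv.swap_apply_left,
        Equiv.swap_apply_right]
      exact h.lt j hj)
    have h8 := h.reduced l'' (by
      rw [h7, h5, mul_assoc, ← simpleRefl, simpleRefl_mul_self, mul_one])
    rw [List.length_cons] at h6 h8
    omega

theorem IsMinimal.neg_succ_lt {l : List ℤ} (h : IsMinimal l) (p : ℕ) :
    reflProd l (neg (p + 1)) < reflProd l (neg p) := by
  have := h.lt (-((p : ℤ) + 1)) (by omega)
  rwa [lo_neg, hi_neg] at this

theorem IsMinimal.pos_lt_succ {l : List ℤ} (h : IsMinimal l) (p : ℕ) :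
    reflProd l (pos p) < reflProd l (pos (p + 1)) := by
  have := h.lt ((p : ℤ) + 1) (by omega)
  rwa [lo_pos, hi_pos] at this

theorem eq_neg_or_eq_pos (x : NZ) : (∃ p, x = neg p) ∨ ∃ p, x = pos p := by
  have hx := x.2
  rcases lt_or_gt_of_ne hx with h | h
  · exact Or.inl ⟨(-(x : ℤ) - 1).toNat, Subtype.ext (by simp only [neg]; omega)⟩
  · exact Or.inr ⟨((x : ℤ) - 1).toNat, Subtype.ext (by simp only [pos]; omega)⟩

theorem neg_lt_neg_iff' {p q : ℕ} : neg p < neg q ↔ q < p := by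
  rw [← Subtype.coe_lt_coe]; simp only [neg]; omega

theorem pos_lt_pos_iff {p q : ℕ} : pos p < pos q ↔ p < q := by
  rw [← Subtype.coe_lt_coe]; simp only [pos]; omega

theorem neg_lt_pos (p q : ℕ) : neg p < pos q := by
  rw [← Subtype.coe_lt_coe]; simp only [neg, pos]; omega

theorem neg_injective : Function.Injective neg := by
  intro p q h
  have := congrArg Subtype.val h
  simp only [neg] at this
  omega

/-- The last letter of a reduced expression exchanges the image of a negative with that of a positive
integer. -/
theorem IsMinimal.exists_swap {i : ℤ} {t : List ℤ} (h : IsMinimal (i :: t)) :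
    ∃ p q, reflProd t (neg p) = lo i ∧ reflProd t (pos q) = hi i := by
  obtain ⟨a, ha⟩ := (reflProd t).surjective (lo i)
  obtain ⟨b, hb⟩ := (reflProd t).surjective (hi i)
  -- Otherwise t already reverses b < a, and exchanging would give a shorter expression of s_i t.
  have hab : a < b := by
    by_contra hcon
    have hne : b ≠ a := by
      rintro rfl
      exact lo_ne_hi i (ha.symm.trans hb)
    obtain ⟨t', h1, h2⟩ := exchange t (lt_of_le_of_ne (not_lt.mp hcon) hne) (by
      rw [ha, hb]; exact lo_lt_hi i)
    have h3 := h.reduced t' (by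
      rw [h2, reflProd_cons, Equiv.mul_swap_eq_swap_mul, ha, hb, Equiv.swap_comm]
      rfl)
    rw [List.length_cons] at h3
    omega
  have hva : reflProd (i :: t) a = hi i := by
    rw [reflProd_cons, Equiv.Perm.mul_apply, ha, simpleRefl, Equiv.swap_apply_left]
  have hvb : reflProd (i :: t) b = lo i := by
    rw [reflProd_cons, Equiv.Perm.mul_apply, hb, simpleRefl, Equiv.swap_apply_right]
  have hnot : ¬ reflProd (i :: t) a < reflProd (i :: t) b := by
    rw [hva, hvb]
    exact not_lt.mpr (lo_lt_hi i).le
  -- The pair a < b is reversed by the whole product, which increases on the negative and on the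
  -- positive integers; so a is negative and b positive.
  rcases eq_neg_or_eq_pos a with ⟨p, rfl⟩ | ⟨p, rfl⟩
  · rcases eq_neg_or_eq_pos b with ⟨q, rfl⟩ | ⟨q, rfl⟩
    · have hanti : StrictAnti fun p => reflProd (i :: t) (neg p) :=
        strictAnti_nat_of_succ_lt h.neg_succ_lt
      exact absurd (hanti (neg_lt_neg_iff'.mp hab)) hnot
    · exact ⟨p, q, ha, hb⟩
  · rcases eq_neg_or_eq_pos b with ⟨q, rfl⟩ | ⟨q, rfl⟩
    · exact absurd hab (not_lt.mpr (neg_lt_pos q p).le)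
    · have hmono : StrictMono fun p => reflProd (i :: t) (pos p) :=
        strictMono_nat_of_lt_succ h.pos_lt_succ
      exact absurd (hmono (pos_lt_pos_iff.mp hab)) hnot

theorem reflProd_neg_eq (l : List ℤ) : ∃ N, ∀ p, N ≤ p → reflProd l (neg p) = neg p := by
  induction l with
  | nil => exact ⟨0, fun _ _ => rfl⟩
  | cons i t ih =>
    obtain ⟨N, hN⟩ := ih
    refine ⟨N + i.natAbs + 2, fun p hp => ?_⟩
    rw [reflProd_cons, Equiv.Perm.mul_apply, hN p (by omega)]
    refine Subtype.ext ?_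
    rw [coe_simpleRefl]
    simp only [neg, lo, hi]
    split_ifs <;> omega

/-- The images of the negative integers. -/
def IsMinimal.word {l : List ℤ} (h : IsMinimal l) : SemiInf where
  toFun p := reflProd l (neg p)
  anti := strictAnti_nat_of_succ_lt h.neg_succ_lt
  tail := by
    obtain ⟨N, hN⟩ := reflProd_neg_eq l
    exact ⟨0, N, fun k hk => by rw [hN k hk]; simp [neg]⟩

theorem IsMinimal.exists_partition {l : List ℤ} (h : IsMinimal l) :
    ∃ μ, ∀ p, reflProd l (neg p) = (ofPartition μ).toFun p := by
  have h1 : h.word.IsNeutral := reflProd_neg_eq l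
  obtain ⟨μ, hμ⟩ := h1.exists_ofPartition
  exact ⟨μ, fun p => by rw [hμ]; rfl⟩

/-- The arguments whose images are inverted with that of `neg p`. -/
def inversions (l : List ℤ) (p : ℕ) : Set NZ :=
  {x | neg p < x ∧ reflProd l x < reflProd l (neg p)}

theorem permShape_reflProd (l : List ℤ) (p : ℕ) :
    permShape (reflProd l) p = (inversions l p).ncard := by
  rw [permShape, ← Set.ncard_image_of_injective (inversions l p) (reflProd l).injective]
  congr 1
  ext j
  simp only [permDiagram, inversions, Set.mem_ofPred_eq, Set.mem_image]
  constructor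
  · rintro ⟨h1, h2⟩
    exact ⟨(reflProd l)⁻¹ j, ⟨h1, ((reflProd l).apply_symm_apply j).trans_lt h2⟩,
      (reflProd l).apply_symm_apply j⟩
  · rintro ⟨x, ⟨h1, h2⟩, rfl⟩
    exact ⟨h1.trans_eq ((reflProd l).symm_apply_apply x).symm, h2⟩

/-- The images of the negative integers form the word of a partition. Prepending i changes the
letter lo i in one row into hi i, which adds a box of residue i to that row. It also creates exactly
one new inversion, in the same row, so inversions keep counting row lengths. -/
theorem IsMinimal.exists_boxChain {l : List ℤ} (h : IsMinimal l) :
    ∃ μ, BoxChain l μ ∧ (∀ p, reflProd l (neg p) = (ofPartition μ).toFun p) ∧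
      ∀ p, (inversions l p).Finite ∧ (inversions l p).ncard = μ.rowLen p := by
  induction l with
  | nil =>
    refine ⟨⊥, rfl, fun p => by rw [ofPartition_bot]; rfl, fun p => ?_⟩
    have h1 : inversions [] p = ∅ := by
      ext x
      simp only [inversions, Set.mem_ofPred_eq, Set.mem_empty_iff_false, iff_false, not_and,
        not_lt]
      exact fun h => h.le
    have h2 : (⊥ : YoungDiagram).rowLen p = 0 := by
      by_contra h
      exact YoungDiagram.notMem_bot (p, 0)
        (YoungDiagram.mem_iff_lt_rowLen.mpr (Nat.pos_of_ne_zero h))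
    rw [h1, h2]
    exact ⟨Set.finite_empty, Set.ncard_empty _⟩
  | cons i t ih =>
    obtain ⟨μ', c1, c2, c3⟩ := ih h.tail
    obtain ⟨μ, hμ⟩ := h.exists_partition
    obtain ⟨p₀, q, hp₀, hq⟩ := h.exists_swap
    have hval : ∀ p, reflProd (i :: t) (neg p) =
        if p = p₀ then hi i else reflProd t (neg p) := by
      intro p
      rw [reflProd_cons, Equiv.Perm.mul_apply]
      split_ifs with h1
      · rw [h1, hp₀, simpleRefl, Equiv.swap_apply_left]
      · refine Equiv.swap_apply_of_ne_of_ne ?_ ?_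
        · rw [← hp₀, (reflProd t).injective.ne_iff]
          exact fun h => h1 (neg_injective h)
        · rw [← hq, (reflProd t).injective.ne_iff]
          exact (neg_lt_pos p q).ne
    have hrow₀ : (μ'.rowLen p₀ : ℤ) = p₀ + i := by
      have h1 := c2 p₀
      rw [hp₀, lo_eq] at h1
      have h2 := skipZero_injective h1
      omega
    have hrow : ∀ p, μ.rowLen p = μ'.rowLen p + if p = p₀ then 1 else 0 := by
      intro p
      have h1 := hval p
      rw [hμ p] at h1
      split_ifs at h1 ⊢ with h2
      · subst h2
        rw [hi_eq] at h1
        have h3 := skipZero_injective h1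
        omega
      · rw [c2 p] at h1
        have h3 := skipZero_injective h1
        omega
    refine ⟨μ, ⟨μ', c1, p₀, μ'.rowLen p₀, hrow₀, ?_, fun c => ?_⟩, hμ, fun p => ?_⟩
    · rw [YoungDiagram.mem_iff_lt_rowLen]; exact lt_irrefl _
    · obtain ⟨x, y⟩ := c
      rw [YoungDiagram.mem_iff_lt_rowLen, YoungDiagram.mem_iff_lt_rowLen, hrow, Prod.mk.injEq]
      by_cases h1 : x = p₀
      · subst h1
        simp only [if_true, true_and]
        omega
      · simp [h1]
    -- The reflection changes the relative order of the images only for the pair (neg p₀, pos q).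
    · have hlt : ∀ x, neg p < x → ¬ (p = p₀ ∧ x = pos q) →
          (reflProd (i :: t) x < reflProd (i :: t) (neg p) ↔
            reflProd t x < reflProd t (neg p)) := by
        intro x hx hne
        rw [reflProd_cons, Equiv.Perm.mul_apply, Equiv.Perm.mul_apply]
        have e1 : ¬ (reflProd t (neg p) = lo i ∧ reflProd t x = hi i) := by
          rintro ⟨h1, h2⟩
          rw [← hp₀] at h1
          rw [← hq] at h2
          exact hne ⟨neg_injective ((reflProd t).injective h1), (reflProd t).injective h2⟩
        have e2 : ¬ (reflProd t x = lo i ∧ reflProd t (neg p) = hi i) := by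
          rintro ⟨h1, h2⟩
          rw [← hq] at h2
          exact (neg_lt_pos p q).ne ((reflProd t).injective h2)
        constructor
        · intro h1
          rcases lt_trichotomy (reflProd t x) (reflProd t (neg p)) with h2 | h2 | h2
          · exact h2
          · rw [h2] at h1; exact absurd h1 (lt_irrefl _)
          · exact absurd (simpleRefl_lt h2 e1) (not_lt.mpr h1.le)
        · intro h1
          exact simpleRefl_lt h1 e2
      obtain ⟨f1, f2⟩ := c3 p
      by_cases hp : p = p₀
      · subst hp
        have hset : inversions (i :: t) p = insert (pos q) (inversions t p) := by
          ext x
          simp only [inversions, Set.mem_insert_iff, Set.mem_ofPred_eq]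
          by_cases hx : x = pos q
          · subst hx
            simp only [true_or, iff_true]
            refine ⟨neg_lt_pos p q, ?_⟩
            rw [hval p, if_pos rfl, reflProd_cons, Equiv.Perm.mul_apply, hq, simpleRefl,
              Equiv.swap_apply_right]
            exact lo_lt_hi i
          · simp only [hx, false_or]
            exact and_congr_right fun h1 => hlt x h1 fun h2 => hx h2.2
        have hnot : pos q ∉ inversions t p := by
          rintro ⟨-, h2⟩
          rw [hp₀, hq] at h2
          exact absurd h2 (not_lt.mpr (lo_lt_hi i).le)
        rw [hset, Set.ncard_insert_of_notMem hnot f1, f2, hrow, if_pos rfl]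
        exact ⟨f1.insert _, rfl⟩
      · have hset : inversions (i :: t) p = inversions t p := by
          ext x
          exact and_congr_right fun h1 => hlt x h1 fun h2 => hp h2.1
        rw [hset, f2, hrow, if_neg hp]
        exact ⟨f1, rfl⟩

theorem boxChain_of_isReducedExpr {w : Equiv.Perm NZ} (hw : w ∈ minimalReps Lam0)
    {lam : YoungDiagram} (hshape : ∀ p, permShape w p = lam.rowLen p) {l : List ℤ}
    (hl : IsReducedExpr w l) : BoxChain l lam := by
  obtain ⟨μ, h1, -, h2⟩ := (isMinimal_of_isReducedExpr hw hl).exists_boxChain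
  have hrow : ∀ p, μ.rowLen p = lam.rowLen p := by
    intro p
    rw [← hshape, ← (h2 p).2, ← permShape_reflProd]
    exact congrArg (fun v => permShape v p) hl.1
  have : μ = lam := le_antisymm (rowLen_mono.mpr fun k => (hrow k).le)
    (rowLen_mono.mpr fun k => (hrow k).ge)
  rwa [← this]

end GlInf

end

theorem mainTheorem10 (lam : YoungDiagram) (n : ℕ) (hn : 1 ≤ n)
    (w : Equiv.Perm GlInf.NZ) (hw : w ∈ GlInf.minimalReps GlInf.Lam0)
    (hshape : ∀ p, GlInf.permShape w p = lam.rowLen p)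
    (l : List ℤ) (hl : GlInf.IsReducedExpr w l) :
    ((GlInf.planeCrystal.restrict (GlInf.PlanePartition.inside lam)).IsCrystal ∧
      (GlInf.matCrystal.restrict (GlInf.matCrystal.demazure 0 l)).IsCrystal ∧
      Nonempty (GlInf.CrystalData.Iso
        (GlInf.planeCrystal.restrict (GlInf.PlanePartition.inside lam))
        (GlInf.matCrystal.restrict (GlInf.matCrystal.demazure 0 l)))) ∧
    ((GlInf.planeCrystal.restrict (GlInf.PlanePartition.insideLE lam n)).IsCrystal ∧
      (((GlInf.BnLam0Crystal n).restrict
        ((GlInf.BnLam0Crystal n).demazure (GlInf.Hn n) l)).tensor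
          (GlInf.CrystalData.T (-((n : ℤ) • GlInf.Lam0)))).IsCrystal ∧
      Nonempty (GlInf.CrystalData.Iso
        (GlInf.planeCrystal.restrict (GlInf.PlanePartition.insideLE lam n))
        (((GlInf.BnLam0Crystal n).restrict
          ((GlInf.BnLam0Crystal n).demazure (GlInf.Hn n) l)).tensor
            (GlInf.CrystalData.T (-((n : ℤ) • GlInf.Lam0)))))) := by
  have hbox := GlInf.boxChain_of_isReducedExpr hw hshape hl
  have h1 := GlInf.planeCrystal_isCrystal.restrict (GlInf.PlanePartition.inside lam)
  have h2 := GlInf.planeCrystal_isCrystal.restrict (GlInf.PlanePartition.insideLE lam n)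
  -- By its description through shapes, the Demazure subset of matrices is the image of the plane
  -- partitions inside `lam`.
  have Φ := GlInf.planeIso.restrict (GlInf.PlanePartition.inside lam)
    (GlInf.matCrystal.demazure 0 l) (GlInf.mem_demazure_matCrystal hbox)
  have Ψ := GlInf.insideLEIso hbox n
  exact ⟨⟨h1, h1.of_iso Φ, ⟨Φ⟩⟩, h2, h2.of_iso Ψ, ⟨Ψ⟩⟩
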